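/- Let $R$ be a commutative ring with unity, and let $C$ and $D$ be (coassociative, counital) $R$-coalgebras which are flat as $R$-modules. Let $\mathcal M^C$ (resp. ${}^C\mathcal M$) denote the $R$-linear category of right (resp. left) $C$-comodules, and let $M\,\square_C N\subseteq M\otimes_R N$ denote the cotensor product, i.e. the kernel of $\varrho_M\otimes \mathrm{id}-\mathrm{id}\otimes\varrho_N$. A right $D$-comodule $X$ is called - *quasi-finite* if the functor $-\otimes_R X: R\text{-Mod}\to\mathcal M^D$ has a left adjoint, which is then denoted $h_D(X,-)$; - *faithfully coflat* if the functor $X\,\square_D -:{}^D\mathcal M\to R\text{-Mod}$ is exact and faithful; - an *injector* if the functor $-\otimes_R X: R\text{-Mod}\to\mathcal M^D$ preserves injective objects. If $X$ is quasi-finite with unit of adjunction $\eta: X\to h_D(X,X)\otimes X$, its *coendomorphism coalgebra* is $e_D(X)=h_D(X,X)$, whose comultiplication $\Delta$ and counit $\varepsilon$ are the $R$-linear maps determined by $(\Delta\otimes\mathrm{id})\eta=(\mathrm{id}\otimes\eta)\eta$ and $(\varepsilon\otimes\mathrm{id})\eta=$ the canonical isomorphism $X\to R\otimes X$. The notions for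 left comodules are defined symmetrically. Equivalences between comodule categories are understood to be $R$-linear. Then the following are equivalent: 1. $\mathcal M^C$ and $\mathcal M^D$ are equivalent ($C$ and $D$ are Morita–Takeuchi equivalent). 2. ${}^C\mathcal M$ and ${}^D\mathcal M$ are equivalent. 3. There exists a $C$-$D$-bicomodule $X$ such that $X_D$ is quasi-finite, faithfully coflat and an injector, and $e_D(X)\cong C$ as coalgebras. 4. There exists a $C$-$D$-bicomodule $X$ such that ${}_CX$ is quasi-finite, faithfully coflat and an injector, and $e_C(X)\cong D$ as coalgebras. 5. There exists a $D$-$C$-bicomodule $Y$ such that $Y_C$ is quasi-finite, faithfully coflat and an injector, and $e_C(Y)\cong D$ as coalgebras. 6. There exists a $D$-$C$-bicomodule $Y$ such that ${}_DY$ is quasi-finite, faithfully coflat and an injector, and $e_D(Y)\cong C$ as coalgebras. -/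

import Mathlib

open CategoryTheory
open scoped TensorProduct

universe u

namespace MoritaTakeuchi

section Comodules

variable (R : Type u) [CommRing R] (C : Type u) [AddCommGroup C] [Module R C] [Coalgebra R C]

/-- Right `C`-comodules: an `R`-module `M` with a coassociative and counital `R`-linear coaction
`M → M ⊗ C`. -/
structure RightComodule where
  carrier : Type u
  [addCommGroup : AddCommGroup carrier]
  [module : Module R carrier]
  coact : carrier →ₗ[R] carrier ⊗[R] C
  coassoc : TensorProduct.assoc R carrier C C ∘ₗ coact.rTensor C ∘ₗ coact =
    (Coalgebra.comul (R := R) (A := C)).lTensor carrier ∘ₗ coact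
  counit : (Coalgebra.counit (R := R) (A := C)).lTensor carrier ∘ₗ coact =
    (TensorProduct.mk R carrier R).flip 1

/-- Left `C`-comodules: an `R`-module `M` with a coassociative and counital `R`-linear coaction
`M → C ⊗ M`. -/
structure LeftComodule where
  carrier : Type u
  [addCommGroup : AddCommGroup carrier]
  [module : Module R carrier]
  coact : carrier →ₗ[R] C ⊗[R] carrier
  coassoc : TensorProduct.assoc R C C carrier ∘ₗ
      (Coalgebra.comul (R := R) (A := C)).rTensor carrier ∘ₗ coact =
    coact.lTensor C ∘ₗ coact
  counit : (Coalgebra.counit (R := R) (A := C)).rTensor carrier ∘ₗ coact =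
    TensorProduct.mk R R carrier 1

attribute [instance] RightComodule.addCommGroup RightComodule.module
attribute [instance] LeftComodule.addCommGroup LeftComodule.module

end Comodules

/-- `C`-`D`-bicomodules: a left `C`-comodule and right `D`-comodule on the same `R`-module whose
two coactions commute, that is, the left coaction `X → C ⊗ X` is right `D`-colinear. -/
structure Bicomodule (R : Type u) [CommRing R]
    (C : Type u) [AddCommGroup C] [Module R C] [Coalgebra R C]
    (D : Type u) [AddCommGroup D] [Module R D] [Coalgebra R D] where
  carrier : Type u
  [addCommGroup : AddCommGroup carrier]
  [module : Module R carrier]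
  lcoact : carrier →ₗ[R] C ⊗[R] carrier
  lcoassoc : TensorProduct.assoc R C C carrier ∘ₗ
      (Coalgebra.comul (R := R) (A := C)).rTensor carrier ∘ₗ lcoact =
    lcoact.lTensor C ∘ₗ lcoact
  lcounit : (Coalgebra.counit (R := R) (A := C)).rTensor carrier ∘ₗ lcoact =
    TensorProduct.mk R R carrier 1
  rcoact : carrier →ₗ[R] carrier ⊗[R] D
  rcoassoc : TensorProduct.assoc R carrier D D ∘ₗ rcoact.rTensor D ∘ₗ rcoact =
    (Coalgebra.comul (R := R) (A := D)).lTensor carrier ∘ₗ rcoact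
  rcounit : (Coalgebra.counit (R := R) (A := D)).lTensor carrier ∘ₗ rcoact =
    (TensorProduct.mk R carrier R).flip 1
  bicolinear : TensorProduct.assoc R C carrier D ∘ₗ lcoact.rTensor D ∘ₗ rcoact =
    rcoact.lTensor C ∘ₗ lcoact

attribute [instance] Bicomodule.addCommGroup Bicomodule.module

variable {R : Type u} [CommRing R] {C : Type u} [AddCommGroup C] [Module R C] [Coalgebra R C]
  {D : Type u} [AddCommGroup D] [Module R D] [Coalgebra R D]

/-- The underlying right `D`-comodule of a `C`-`D`-bicomodule. -/
abbrev Bicomodule.right (X : Bicomodule R C D) : RightComodule R D where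
  carrier := X.carrier
  coact := X.rcoact
  coassoc := X.rcoassoc
  counit := X.rcounit

/-- The underlying left `C`-comodule of a `C`-`D`-bicomodule. -/
abbrev Bicomodule.left (X : Bicomodule R C D) : LeftComodule R C where
  carrier := X.carrier
  coact := X.lcoact
  coassoc := X.lcoassoc
  counit := X.lcounit

/-! ### The `R`-linear categories of right and of left comodules -/

namespace RightComodule

/-- Right colinear maps. -/
@[ext]
structure Hom (M N : RightComodule R C) where
  hom : M.carrier →ₗ[R] N.carrier
  colinear : N.coact ∘ₗ hom = hom.rTensor C ∘ₗ M.coact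

instance : Category (RightComodule R C) where
  Hom M N := Hom M N
  id M := ⟨LinearMap.id, by simp⟩
  comp f g := ⟨g.hom ∘ₗ f.hom, by
    rw [← LinearMap.comp_assoc, g.colinear, LinearMap.comp_assoc, f.colinear,
      ← LinearMap.comp_assoc, LinearMap.rTensor_comp]⟩

section

variable {M N P : RightComodule R C}

@[ext]
theorem hom_ext {f g : M ⟶ N} (h : f.hom = g.hom) : f = g := Hom.ext h

@[simp] theorem id_hom : (𝟙 M : M ⟶ M).hom = LinearMap.id := rfl

@[simp] theorem comp_hom (f : M ⟶ N) (g : N ⟶ P) : (f ≫ g).hom = g.hom ∘ₗ f.hom := rfl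

theorem colinear_apply (f : M ⟶ N) (x : M.carrier) :
    N.coact (f.hom x) = f.hom.rTensor C (M.coact x) :=
  LinearMap.congr_fun f.colinear x

instance : Zero (M ⟶ N) := ⟨⟨0, by simp⟩⟩

instance : Add (M ⟶ N) := ⟨fun f g => ⟨f.hom + g.hom, by
  rw [LinearMap.comp_add, f.colinear, g.colinear, LinearMap.rTensor_add, LinearMap.add_comp]⟩⟩

instance : Neg (M ⟶ N) := ⟨fun f => ⟨-f.hom, by
  rw [LinearMap.comp_neg, f.colinear, LinearMap.rTensor_neg, LinearMap.neg_comp]⟩⟩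

instance : SMul R (M ⟶ N) := ⟨fun r f => ⟨r • f.hom, by
  rw [LinearMap.comp_smul, f.colinear, LinearMap.rTensor_smul, LinearMap.smul_comp]⟩⟩

@[simp] theorem zero_hom : (0 : M ⟶ N).hom = 0 := rfl

@[simp] theorem add_hom (f g : M ⟶ N) : (f + g).hom = f.hom + g.hom := rfl

@[simp] theorem neg_hom (f : M ⟶ N) : (-f).hom = -f.hom := rfl

@[simp] theorem smul_hom (r : R) (f : M ⟶ N) : (r • f).hom = r • f.hom := rfl

instance : AddCommGroup (M ⟶ N) where
  add_assoc f g h := by ext; simp [add_assoc]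
  zero_add f := by ext; simp
  add_zero f := by ext; simp
  nsmul := nsmulRec
  zsmul := zsmulRec
  neg_add_cancel f := by ext; simp
  add_comm f g := by ext; simp [add_comm]

instance : Module R (M ⟶ N) where
  one_smul f := by ext; simp
  mul_smul r s f := by ext; simp [mul_smul]
  smul_zero r := by ext; simp
  smul_add r f g := by ext; simp
  add_smul r s f := by ext; simp [add_smul]
  zero_smul f := by ext; simp

end

instance : Preadditive (RightComodule R C) where
  add_comp _ _ _ f g h := by ext; simp
  comp_add _ _ _ f g h := by ext; simp

instance : Linear R (RightComodule R C) where
  smul_comp _ _ _ r f g := by ext; simp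
  comp_smul _ _ _ f r g := by ext; simp

end RightComodule

namespace LeftComodule

/-- Left colinear maps. -/
@[ext]
structure Hom (M N : LeftComodule R C) where
  hom : M.carrier →ₗ[R] N.carrier
  colinear : N.coact ∘ₗ hom = hom.lTensor C ∘ₗ M.coact

instance : Category (LeftComodule R C) where
  Hom M N := Hom M N
  id M := ⟨LinearMap.id, by simp⟩
  comp f g := ⟨g.hom ∘ₗ f.hom, by
    rw [← LinearMap.comp_assoc, g.colinear, LinearMap.comp_assoc, f.colinear,
      ← LinearMap.comp_assoc, LinearMap.lTensor_comp]⟩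

section

variable {M N P : LeftComodule R C}

@[ext]
theorem hom_ext {f g : M ⟶ N} (h : f.hom = g.hom) : f = g := Hom.ext h

@[simp] theorem id_hom : (𝟙 M : M ⟶ M).hom = LinearMap.id := rfl

@[simp] theorem comp_hom (f : M ⟶ N) (g : N ⟶ P) : (f ≫ g).hom = g.hom ∘ₗ f.hom := rfl

theorem colinear_apply (f : M ⟶ N) (x : M.carrier) :
    N.coact (f.hom x) = f.hom.lTensor C (M.coact x) :=
  LinearMap.congr_fun f.colinear x

instance : Zero (M ⟶ N) := ⟨⟨0, by simp⟩⟩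

instance : Add (M ⟶ N) := ⟨fun f g => ⟨f.hom + g.hom, by
  rw [LinearMap.comp_add, f.colinear, g.colinear, LinearMap.lTensor_add, LinearMap.add_comp]⟩⟩

instance : Neg (M ⟶ N) := ⟨fun f => ⟨-f.hom, by
  rw [LinearMap.comp_neg, f.colinear, LinearMap.lTensor_neg, LinearMap.neg_comp]⟩⟩

instance : SMul R (M ⟶ N) := ⟨fun r f => ⟨r • f.hom, by
  rw [LinearMap.comp_smul, f.colinear, LinearMap.lTensor_smul, LinearMap.smul_comp]⟩⟩

@[simp] theorem zero_hom : (0 : M ⟶ N).hom = 0 := rfl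

@[simp] theorem add_hom (f g : M ⟶ N) : (f + g).hom = f.hom + g.hom := rfl

@[simp] theorem neg_hom (f : M ⟶ N) : (-f).hom = -f.hom := rfl

@[simp] theorem smul_hom (r : R) (f : M ⟶ N) : (r • f).hom = r • f.hom := rfl

instance : AddCommGroup (M ⟶ N) where
  add_assoc f g h := by ext; simp [add_assoc]
  zero_add f := by ext; simp
  add_zero f := by ext; simp
  nsmul := nsmulRec
  zsmul := zsmulRec
  neg_add_cancel f := by ext; simp
  add_comm f g := by ext; simp [add_comm]

instance : Module R (M ⟶ N) where
  one_smul f := by ext; simp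
  mul_smul r s f := by ext; simp [mul_smul]
  smul_zero r := by ext; simp
  smul_add r f g := by ext; simp
  add_smul r s f := by ext; simp [add_smul]
  zero_smul f := by ext; simp

end

instance : Preadditive (LeftComodule R C) where
  add_comp _ _ _ f g h := by ext; simp
  comp_add _ _ _ f g h := by ext; simp

instance : Linear R (LeftComodule R C) where
  smul_comp _ _ _ r f g := by ext; simp
  comp_smul _ _ _ f r g := by ext; simp

end LeftComodule

/-- Two coalgebras have equivalent categories of right comodules: there is an `R`-linear
equivalence between them. -/
def RightComodule.Equivalent (R : Type u) [CommRing R]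
    (C : Type u) [AddCommGroup C] [Module R C] [Coalgebra R C]
    (D : Type u) [AddCommGroup D] [Module R D] [Coalgebra R D] : Prop :=
  ∃ F : RightComodule R C ⥤ RightComodule R D, F.IsEquivalence ∧ F.Additive ∧ F.Linear R

/-- Two coalgebras have equivalent categories of left comodules: there is an `R`-linear
equivalence between them. -/
def LeftComodule.Equivalent (R : Type u) [CommRing R]
    (C : Type u) [AddCommGroup C] [Module R C] [Coalgebra R C]
    (D : Type u) [AddCommGroup D] [Module R D] [Coalgebra R D] : Prop :=
  ∃ F : LeftComodule R C ⥤ LeftComodule R D, F.IsEquivalence ∧ F.Additive ∧ F.Linear R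

/-! ### The functors `- ⊗ X` and `X ⊗ -` from modules to comodules -/

namespace RightComodule

theorem coassoc_apply (X : RightComodule R C) (x : X.carrier) :
    TensorProduct.assoc R X.carrier C C (X.coact.rTensor C (X.coact x)) =
      (Coalgebra.comul (R := R) (A := C)).lTensor X.carrier (X.coact x) :=
  LinearMap.congr_fun X.coassoc x

theorem counit_apply (X : RightComodule R C) (x : X.carrier) :
    (Coalgebra.counit (R := R) (A := C)).lTensor X.carrier (X.coact x) = x ⊗ₜ 1 :=
  LinearMap.congr_fun X.counit x

/-- The right comodule `W ⊗ X`, with coaction `id ⊗ ρ_X`. -/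
abbrev tensor (X : RightComodule R C) (W : Type u) [AddCommGroup W] [Module R W] :
    RightComodule R C where
  carrier := W ⊗[R] X.carrier
  coact := (TensorProduct.assoc R W X.carrier C).symm.toLinearMap ∘ₗ X.coact.lTensor W
  coassoc := by
    ext w x
    have key : ∀ z : X.carrier ⊗[R] C,
        TensorProduct.assoc R (W ⊗[R] X.carrier) C C
          (((TensorProduct.assoc R W X.carrier C).symm.toLinearMap ∘ₗ
            X.coact.lTensor W).rTensor C ((TensorProduct.assoc R W X.carrier C).symm (w ⊗ₜ z))) =
        (TensorProduct.assoc R W X.carrier (C ⊗[R] C)).symm (w ⊗ₜ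
          TensorProduct.assoc R X.carrier C C (X.coact.rTensor C z)) := by
      intro z
      induction z with
      | zero => simp
      | add a b ha hb => simp only [TensorProduct.tmul_add, map_add, ha, hb]
      | tmul a c =>
        simp only [TensorProduct.assoc_symm_tmul, LinearMap.rTensor_tmul, LinearMap.comp_apply,
          LinearMap.lTensor_tmul, LinearEquiv.coe_coe]
        induction X.coact a with
        | zero => simp
        | add a b ha hb => simp only [TensorProduct.tmul_add, TensorProduct.add_tmul, map_add, ha, hb]
        | tmul a c => simp
    have key2 : ∀ z : X.carrier ⊗[R] C,
        (Coalgebra.comul (R := R) (A := C)).lTensor (W ⊗[R] X.carrier)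
          ((TensorProduct.assoc R W X.carrier C).symm (w ⊗ₜ z)) =
        (TensorProduct.assoc R W X.carrier (C ⊗[R] C)).symm (w ⊗ₜ
          (Coalgebra.comul (R := R) (A := C)).lTensor X.carrier z) := by
      intro z
      induction z with
      | zero => simp
      | add a b ha hb => simp only [TensorProduct.tmul_add, map_add, ha, hb]
      | tmul a c => simp
    have := key (X.coact x)
    rw [coassoc_apply, ← key2] at this
    exact this
  counit := by
    ext w x
    have key : ∀ z : X.carrier ⊗[R] C,
        (Coalgebra.counit (R := R) (A := C)).lTensor (W ⊗[R] X.carrier)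
          ((TensorProduct.assoc R W X.carrier C).symm (w ⊗ₜ z)) =
        (TensorProduct.assoc R W X.carrier R).symm (w ⊗ₜ
          (Coalgebra.counit (R := R) (A := C)).lTensor X.carrier z) := by
      intro z
      induction z with
      | zero => simp
      | add a b ha hb => simp only [TensorProduct.tmul_add, map_add, ha, hb]
      | tmul a c => simp
    have := key (X.coact x)
    rw [counit_apply] at this
    exact this

theorem tensor_colinear (X : RightComodule R C) {V W : Type u} [AddCommGroup V] [Module R V]
    [AddCommGroup W] [Module R W] (f : V →ₗ[R] W) :
    (X.tensor W).coact ∘ₗ f.rTensor X.carrier =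
      (f.rTensor X.carrier).rTensor C ∘ₗ (X.tensor V).coact := by
  ext v x
  have key : ∀ z : X.carrier ⊗[R] C,
      (TensorProduct.assoc R W X.carrier C).symm (f v ⊗ₜ z) =
      (f.rTensor X.carrier).rTensor C ((TensorProduct.assoc R V X.carrier C).symm (v ⊗ₜ z)) := by
    intro z
    induction z with
    | zero => simp
    | add a b ha hb => simp only [TensorProduct.tmul_add, map_add, ha, hb]
    | tmul a c => simp
  exact key (X.coact x)

/-- The functor `- ⊗ X` from `R`-modules to right comodules. -/
abbrev tensorFunctor (X : RightComodule R C) : ModuleCat.{u} R ⥤ RightComodule R C where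
  obj W := X.tensor W
  map f := ⟨f.hom.rTensor X.carrier, X.tensor_colinear f.hom⟩
  map_id W := by apply hom_ext; simp
  map_comp f g := by apply hom_ext; simp [LinearMap.rTensor_comp]

/-- `X` is quasi-finite: the functor `- ⊗ X` has a left adjoint. -/
abbrev IsQuasiFinite (X : RightComodule R C) : Prop := X.tensorFunctor.IsRightAdjoint

/-- `X` is an injector: the functor `- ⊗ X` preserves injective objects. -/
def IsInjector (X : RightComodule R C) : Prop := X.tensorFunctor.PreservesInjectiveObjects

end RightComodule

namespace LeftComodule

theorem coassoc_apply (X : LeftComodule R C) (x : X.carrier) :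
    TensorProduct.assoc R C C X.carrier
        ((Coalgebra.comul (R := R) (A := C)).rTensor X.carrier (X.coact x)) =
      X.coact.lTensor C (X.coact x) :=
  LinearMap.congr_fun X.coassoc x

theorem counit_apply (X : LeftComodule R C) (x : X.carrier) :
    (Coalgebra.counit (R := R) (A := C)).rTensor X.carrier (X.coact x) = 1 ⊗ₜ x :=
  LinearMap.congr_fun X.counit x

/-- The left comodule `X ⊗ W`, with coaction `ρ_X ⊗ id`. -/
abbrev tensor (X : LeftComodule R C) (W : Type u) [AddCommGroup W] [Module R W] :
    LeftComodule R C where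
  carrier := X.carrier ⊗[R] W
  coact := (TensorProduct.assoc R C X.carrier W).toLinearMap ∘ₗ X.coact.rTensor W
  coassoc := by
    ext x w
    have key : ∀ z : C ⊗[R] X.carrier,
        ((TensorProduct.assoc R C X.carrier W).toLinearMap ∘ₗ
            X.coact.rTensor W).lTensor C (TensorProduct.assoc R C X.carrier W (z ⊗ₜ w)) =
        (TensorProduct.assoc R C X.carrier W).toLinearMap.lTensor C
          (TensorProduct.assoc R C (C ⊗[R] X.carrier) W (X.coact.lTensor C z ⊗ₜ w)) := by
      intro z
      induction z with
      | zero => simp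
      | add a b ha hb => simp only [TensorProduct.add_tmul, map_add, ha, hb]
      | tmul a c => simp
    have key2 : ∀ z : C ⊗[R] X.carrier,
        TensorProduct.assoc R C C (X.carrier ⊗[R] W)
          ((Coalgebra.comul (R := R) (A := C)).rTensor (X.carrier ⊗[R] W)
            (TensorProduct.assoc R C X.carrier W (z ⊗ₜ w))) =
        (TensorProduct.assoc R C X.carrier W).toLinearMap.lTensor C
          (TensorProduct.assoc R C (C ⊗[R] X.carrier) W
            (TensorProduct.assoc R C C X.carrier
              ((Coalgebra.comul (R := R) (A := C)).rTensor X.carrier z) ⊗ₜ w)) := by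
      intro z
      induction z with
      | zero => simp
      | add a b ha hb => simp only [TensorProduct.add_tmul, map_add, ha, hb]
      | tmul a c =>
        simp only [TensorProduct.assoc_tmul, LinearMap.rTensor_tmul]
        induction (Coalgebra.comul (R := R) (A := C)) a with
        | zero => simp
        | add a b ha hb => simp only [TensorProduct.add_tmul, map_add, ha, hb]
        | tmul a c => simp
    have := key (X.coact x)
    rw [← coassoc_apply, ← key2] at this
    exact this.symm
  counit := by
    ext x w
    have key : ∀ z : C ⊗[R] X.carrier,
        (Coalgebra.counit (R := R) (A := C)).rTensor (X.carrier ⊗[R] W)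
          (TensorProduct.assoc R C X.carrier W (z ⊗ₜ w)) =
        TensorProduct.assoc R R X.carrier W
          ((Coalgebra.counit (R := R) (A := C)).rTensor X.carrier z ⊗ₜ w) := by
      intro z
      induction z with
      | zero => simp
      | add a b ha hb => simp only [TensorProduct.add_tmul, map_add, ha, hb]
      | tmul a c => simp
    have := key (X.coact x)
    rw [counit_apply] at this
    exact this

theorem tensor_colinear (X : LeftComodule R C) {V W : Type u} [AddCommGroup V] [Module R V]
    [AddCommGroup W] [Module R W] (f : V →ₗ[R] W) :
    (X.tensor W).coact ∘ₗ f.lTensor X.carrier =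
      (f.lTensor X.carrier).lTensor C ∘ₗ (X.tensor V).coact := by
  ext x v
  have key : ∀ z : C ⊗[R] X.carrier,
      TensorProduct.assoc R C X.carrier W (z ⊗ₜ f v) =
      (f.lTensor X.carrier).lTensor C (TensorProduct.assoc R C X.carrier V (z ⊗ₜ v)) := by
    intro z
    induction z with
    | zero => simp
    | add a b ha hb => simp only [TensorProduct.add_tmul, map_add, ha, hb]
    | tmul a c => simp
  exact key (X.coact x)

/-- The functor `X ⊗ -` from `R`-modules to left comodules. -/
abbrev tensorFunctor (X : LeftComodule R C) : ModuleCat.{u} R ⥤ LeftComodule R C where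
  obj W := X.tensor W
  map f := ⟨f.hom.lTensor X.carrier, X.tensor_colinear f.hom⟩
  map_id W := by apply hom_ext; simp
  map_comp f g := by apply hom_ext; simp [LinearMap.lTensor_comp]

/-- `X` is quasi-finite: the functor `X ⊗ -` has a left adjoint. -/
abbrev IsQuasiFinite (X : LeftComodule R C) : Prop := X.tensorFunctor.IsRightAdjoint

/-- `X` is an injector: the functor `X ⊗ -` preserves injective objects. -/
def IsInjector (X : LeftComodule R C) : Prop := X.tensorFunctor.PreservesInjectiveObjects

end LeftComodule

/-! ### The cotensor product and faithfully coflat comodules -/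

/-- The map `ρ_M ⊗ id - id ⊗ ρ_N : M ⊗ N → M ⊗ C ⊗ N`. -/
noncomputable def cotensorMap (M : RightComodule R C) (N : LeftComodule R C) :
    M.carrier ⊗[R] N.carrier →ₗ[R] M.carrier ⊗[R] (C ⊗[R] N.carrier) :=
  (TensorProduct.assoc R M.carrier C N.carrier).toLinearMap ∘ₗ M.coact.rTensor N.carrier -
    N.coact.lTensor M.carrier

/-- The cotensor product `M □_C N`, a submodule of `M ⊗ N`. -/
noncomputable def cotensor (M : RightComodule R C) (N : LeftComodule R C) :
    Submodule R (M.carrier ⊗[R] N.carrier) :=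
  LinearMap.ker (cotensorMap M N)

theorem cotensorMap_lTensor (M : RightComodule R C) {N N' : LeftComodule R C} (f : N ⟶ N')
    (z : M.carrier ⊗[R] N.carrier) :
    cotensorMap M N' (f.hom.lTensor M.carrier z) =
      (f.hom.lTensor C).lTensor M.carrier (cotensorMap M N z) := by
  induction z with
  | zero => simp
  | add a b ha hb => simp only [map_add, ha, hb]
  | tmul m n =>
    have key : ∀ z : M.carrier ⊗[R] C,
        TensorProduct.assoc R M.carrier C N'.carrier (z ⊗ₜ f.hom n) =
        (f.hom.lTensor C).lTensor M.carrier
          (TensorProduct.assoc R M.carrier C N.carrier (z ⊗ₜ n)) := by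
      intro z
      induction z with
      | zero => simp
      | add a b ha hb => simp only [TensorProduct.add_tmul, map_add, ha, hb]
      | tmul a c => simp
    simp [cotensorMap, key, LeftComodule.colinear_apply]

theorem cotensorMap_rTensor {M M' : RightComodule R C} (N : LeftComodule R C) (f : M ⟶ M')
    (z : M.carrier ⊗[R] N.carrier) :
    cotensorMap M' N (f.hom.rTensor N.carrier z) =
      f.hom.rTensor (C ⊗[R] N.carrier) (cotensorMap M N z) := by
  induction z with
  | zero => simp
  | add a b ha hb => simp only [map_add, ha, hb]
  | tmul m n =>
    have key : ∀ z : M.carrier ⊗[R] C,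
        TensorProduct.assoc R M'.carrier C N.carrier (f.hom.rTensor C z ⊗ₜ n) =
        f.hom.rTensor (C ⊗[R] N.carrier)
          (TensorProduct.assoc R M.carrier C N.carrier (z ⊗ₜ n)) := by
      intro z
      induction z with
      | zero => simp
      | add a b ha hb => simp only [TensorProduct.add_tmul, map_add, ha, hb]
      | tmul a c => simp
    simp [cotensorMap, key, RightComodule.colinear_apply]

/-- The functor `M □_C -` from left `C`-comodules to `R`-modules. -/
noncomputable def RightComodule.cotensorFunctor (M : RightComodule R C) :
    LeftComodule R C ⥤ ModuleCat.{u} R where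
  obj N := ModuleCat.of R (cotensor M N)
  map {N N'} f := ModuleCat.ofHom ((f.hom.lTensor M.carrier).restrict fun z hz => by
    rw [cotensor, LinearMap.mem_ker] at hz ⊢
    rw [cotensorMap_lTensor, hz, map_zero])
  map_id N := by
    ext z
    exact LinearMap.congr_fun (LinearMap.lTensor_id _ _) z.1
  map_comp f g := by
    ext z
    exact LinearMap.congr_fun (LinearMap.lTensor_comp _ g.hom f.hom) z.1

/-- The functor `- □_C N` from right `C`-comodules to `R`-modules. -/
noncomputable def LeftComodule.cotensorFunctor (N : LeftComodule R C) :
    RightComodule R C ⥤ ModuleCat.{u} R where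
  obj M := ModuleCat.of R (cotensor M N)
  map {M M'} f := ModuleCat.ofHom ((f.hom.rTensor N.carrier).restrict fun z hz => by
    rw [cotensor, LinearMap.mem_ker] at hz ⊢
    rw [cotensorMap_rTensor, hz, map_zero])
  map_id M := by
    ext z
    exact LinearMap.congr_fun (LinearMap.rTensor_id _ _) z.1
  map_comp f g := by
    ext z
    exact LinearMap.congr_fun (LinearMap.rTensor_comp _ g.hom f.hom) z.1

/-- `M` is coflat: the functor `M □_C -` is exact, that is, it carries short exact sequences of
left `C`-comodules to short exact sequences. (For `R`-flat `C`, a sequence of comodules is exact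
if and only if the sequence of underlying `R`-modules is.) -/
def RightComodule.IsCoflat (M : RightComodule R C) : Prop :=
  ∀ ⦃N₁ N₂ N₃ : LeftComodule R C⦄ (f : N₁ ⟶ N₂) (g : N₂ ⟶ N₃),
    Function.Injective f.hom → Function.Exact f.hom g.hom → Function.Surjective g.hom →
    Function.Injective (M.cotensorFunctor.map f).hom ∧
      Function.Exact (M.cotensorFunctor.map f).hom (M.cotensorFunctor.map g).hom ∧
      Function.Surjective (M.cotensorFunctor.map g).hom

/-- `N` is coflat: the functor `- □_C N` is exact, that is, it carries short exact sequences of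
right `C`-comodules to short exact sequences. (For `R`-flat `C`, a sequence of comodules is exact
if and only if the sequence of underlying `R`-modules is.) -/
def LeftComodule.IsCoflat (N : LeftComodule R C) : Prop :=
  ∀ ⦃M₁ M₂ M₃ : RightComodule R C⦄ (f : M₁ ⟶ M₂) (g : M₂ ⟶ M₃),
    Function.Injective f.hom → Function.Exact f.hom g.hom → Function.Surjective g.hom →
    Function.Injective (N.cotensorFunctor.map f).hom ∧
      Function.Exact (N.cotensorFunctor.map f).hom (N.cotensorFunctor.map g).hom ∧
      Function.Surjective (N.cotensorFunctor.map g).hom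

/-- `M` is faithfully coflat: the functor `M □_C -` is exact and faithful. -/
def RightComodule.IsFaithfullyCoflat (M : RightComodule R C) : Prop :=
  M.IsCoflat ∧ M.cotensorFunctor.Faithful

/-- `N` is faithfully coflat: the functor `- □_C N` is exact and faithful. -/
def LeftComodule.IsFaithfullyCoflat (N : LeftComodule R C) : Prop :=
  N.IsCoflat ∧ N.cotensorFunctor.Faithful

/-! ### The cohom functor and the coendomorphism coalgebra -/

namespace RightComodule

/-- The cohom functor `h(X, -)`: the left adjoint of `- ⊗ X`. -/
noncomputable def cohom (X : RightComodule R C) [X.IsQuasiFinite] :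
    RightComodule R C ⥤ ModuleCat.{u} R :=
  X.tensorFunctor.leftAdjoint

/-- The adjunction between `h(X, -)` and `- ⊗ X`. -/
noncomputable def cohomAdj (X : RightComodule R C) [X.IsQuasiFinite] :
    X.cohom ⊣ X.tensorFunctor :=
  Adjunction.ofIsRightAdjoint X.tensorFunctor

/-- The underlying module `h(X, X)` of the coendomorphism coalgebra `e(X)`. -/
def Coend (X : RightComodule R C) [X.IsQuasiFinite] : Type u := X.cohom.obj X

noncomputable instance (X : RightComodule R C) [X.IsQuasiFinite] : AddCommGroup X.Coend :=
  inferInstanceAs (AddCommGroup (X.cohom.obj X))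

noncomputable instance (X : RightComodule R C) [X.IsQuasiFinite] : Module R X.Coend :=
  inferInstanceAs (Module R (X.cohom.obj X))

variable (X : RightComodule R C) [X.IsQuasiFinite]

/-- The unit of adjunction `η : X → h(X, X) ⊗ X`. -/
noncomputable def coendUnit : X ⟶ X.tensor X.Coend := X.cohomAdj.unit.app X

/-- The unit of adjunction as a linear map. -/
noncomputable def coendCoact : X.carrier →ₗ[R] X.Coend ⊗[R] X.carrier := X.coendUnit.hom

/-- The linear map `h(X, X) → W` that corresponds to a colinear map `X → W ⊗ X`. -/
noncomputable def coendLift {W : Type u} [AddCommGroup W] [Module R W] (f : X ⟶ X.tensor W) :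
    X.Coend →ₗ[R] W :=
  ((X.cohomAdj.homEquiv X (ModuleCat.of R W)).symm f).hom

theorem coendLift_spec {W : Type u} [AddCommGroup W] [Module R W] (f : X ⟶ X.tensor W) :
    (X.coendLift f).rTensor X.carrier ∘ₗ X.coendCoact = f.hom := by
  have h := (X.cohomAdj.homEquiv X (ModuleCat.of R W)).apply_symm_apply f
  rw [Adjunction.homEquiv_unit] at h
  exact congrArg Hom.hom h

theorem coend_hom_ext {W : Type u} [AddCommGroup W] [Module R W] {f g : X.Coend →ₗ[R] W}
    (h : ∀ x, f.rTensor X.carrier (X.coendCoact x) = g.rTensor X.carrier (X.coendCoact x)) :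
    f = g := by
  have h' : (X.cohomAdj.homEquiv X (ModuleCat.of R W)) (ModuleCat.ofHom f) =
      (X.cohomAdj.homEquiv X (ModuleCat.of R W)) (ModuleCat.ofHom g) := by
    rw [Adjunction.homEquiv_unit, Adjunction.homEquiv_unit]
    exact hom_ext (LinearMap.ext h)
  exact congrArg ModuleCat.Hom.hom ((X.cohomAdj.homEquiv X (ModuleCat.of R W)).injective h')

/-- The colinear map `id ⊗ f : W ⊗ X → W ⊗ Y`. -/
noncomputable def tensorMap (W : Type u) [AddCommGroup W] [Module R W] {X Y : RightComodule R C}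
    (f : X ⟶ Y) : X.tensor W ⟶ Y.tensor W where
  hom := f.hom.lTensor W
  colinear := by
    ext w x
    have key : ∀ z : X.carrier ⊗[R] C,
        (TensorProduct.assoc R W Y.carrier C).symm (w ⊗ₜ f.hom.rTensor C z) =
        (f.hom.lTensor W).rTensor C ((TensorProduct.assoc R W X.carrier C).symm (w ⊗ₜ z)) := by
      intro z
      induction z with
      | zero => simp
      | add a b ha hb => simp only [TensorProduct.tmul_add, map_add, ha, hb]
      | tmul a c => simp
    have := key (X.coact x)
    rw [← colinear_apply] at this
    exact this

/-- The colinear isomorphism `V ⊗ (W ⊗ X) → (V ⊗ W) ⊗ X`. -/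
noncomputable def tensorAssoc (X : RightComodule R C) (V W : Type u) [AddCommGroup V] [Module R V]
    [AddCommGroup W] [Module R W] : (X.tensor W).tensor V ⟶ X.tensor (V ⊗[R] W) where
  hom := (TensorProduct.assoc R V W X.carrier).symm.toLinearMap
  colinear := by
    apply TensorProduct.ext'
    intro v (y : W ⊗[R] X.carrier)
    induction y with
    | zero => simp
    | add a b ha hb => rw [TensorProduct.tmul_add, map_add, map_add, ha, hb]
    | tmul w x =>
      have key : ∀ z : X.carrier ⊗[R] C,
          (TensorProduct.assoc R (V ⊗[R] W) X.carrier C).symm ((v ⊗ₜ w) ⊗ₜ z) =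
          (TensorProduct.assoc R V W X.carrier).symm.toLinearMap.rTensor C
            ((TensorProduct.assoc R V (W ⊗[R] X.carrier) C).symm
              (v ⊗ₜ (TensorProduct.assoc R W X.carrier C).symm (w ⊗ₜ z))) := by
        intro z
        induction z with
        | zero => simp
        | add a b ha hb => simp only [TensorProduct.tmul_add, map_add, ha, hb]
        | tmul a c => simp
      exact key (X.coact x)

/-- The colinear isomorphism `X → R ⊗ X`. -/
noncomputable def toBaseTensor (X : RightComodule R C) : X ⟶ X.tensor R where
  hom := (TensorProduct.lid R X.carrier).symm.toLinearMap
  colinear := by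
    ext x
    have key : ∀ z : X.carrier ⊗[R] C,
        (TensorProduct.assoc R R X.carrier C).symm (1 ⊗ₜ z) =
        (TensorProduct.lid R X.carrier).symm.toLinearMap.rTensor C z := by
      intro z
      induction z with
      | zero => simp
      | add a b ha hb => simp only [TensorProduct.tmul_add, map_add, ha, hb]
      | tmul a c => simp
    exact key (X.coact x)

/-- The comultiplication of `e(X)`: it corresponds to
`(id ⊗ η) η : X → h(X, X) ⊗ h(X, X) ⊗ X`. -/
noncomputable def coendComul : X.Coend →ₗ[R] X.Coend ⊗[R] X.Coend :=
  X.coendLift (X.coendUnit ≫ tensorMap X.Coend X.coendUnit ≫ X.tensorAssoc X.Coend X.Coend)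

/-- The counit of `e(X)`: it corresponds to the canonical isomorphism `X → R ⊗ X`. -/
noncomputable def coendCounit : X.Coend →ₗ[R] R := X.coendLift X.toBaseTensor

theorem coendComul_spec (x : X.carrier) :
    X.coendComul.rTensor X.carrier (X.coendCoact x) =
      (TensorProduct.assoc R X.Coend X.Coend X.carrier).symm
        (X.coendCoact.lTensor X.Coend (X.coendCoact x)) :=
  LinearMap.congr_fun (X.coendLift_spec _) x

theorem coendCounit_spec (x : X.carrier) :
    X.coendCounit.rTensor X.carrier (X.coendCoact x) = 1 ⊗ₜ x :=
  LinearMap.congr_fun (X.coendLift_spec _) x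

/-- The coendomorphism coalgebra `e(X) = h(X, X)`. -/
noncomputable instance : Coalgebra R X.Coend where
  comul := X.coendComul
  counit := X.coendCounit
  coassoc := by
    apply X.coend_hom_ext
    intro x
    have hl : ∀ z : X.Coend ⊗[R] X.carrier,
        (X.coendComul.rTensor X.Coend).rTensor X.carrier
          ((TensorProduct.assoc R X.Coend X.Coend X.carrier).symm
            (X.coendCoact.lTensor X.Coend z)) =
        (TensorProduct.assoc R (X.Coend ⊗[R] X.Coend) X.Coend X.carrier).symm
          (X.coendCoact.lTensor (X.Coend ⊗[R] X.Coend)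
            (X.coendComul.rTensor X.carrier z)) := by
      intro z
      induction z with
      | zero => simp
      | add a b ha hb => simp only [map_add, ha, hb]
      | tmul e y =>
        simp only [LinearMap.lTensor_tmul, LinearMap.rTensor_tmul]
        induction X.coendCoact y with
        | zero => simp
        | add a b ha hb => simp only [TensorProduct.tmul_add, map_add, ha, hb]
        | tmul a c => simp
    have hr : ∀ z : X.Coend ⊗[R] X.carrier,
        (TensorProduct.assoc R X.Coend X.Coend X.Coend).toLinearMap.rTensor X.carrier
          ((TensorProduct.assoc R (X.Coend ⊗[R] X.Coend) X.Coend X.carrier).symm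
            (X.coendCoact.lTensor (X.Coend ⊗[R] X.Coend)
              ((TensorProduct.assoc R X.Coend X.Coend X.carrier).symm
                (X.coendCoact.lTensor X.Coend z)))) =
        (X.coendComul.lTensor X.Coend).rTensor X.carrier
          ((TensorProduct.assoc R X.Coend X.Coend X.carrier).symm
            (X.coendCoact.lTensor X.Coend z)) := by
      intro z
      induction z with
      | zero => simp
      | add a b ha hb => simp only [map_add, ha, hb]
      | tmul e y =>
        have h1 : ∀ w : X.Coend ⊗[R] X.carrier,
            (X.coendComul.lTensor X.Coend).rTensor X.carrier
              ((TensorProduct.assoc R X.Coend X.Coend X.carrier).symm (e ⊗ₜ w)) =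
            (TensorProduct.assoc R X.Coend (X.Coend ⊗[R] X.Coend) X.carrier).symm
              (e ⊗ₜ X.coendComul.rTensor X.carrier w) := by
          intro w
          induction w with
          | zero => simp
          | add a b ha hb => simp only [TensorProduct.tmul_add, map_add, ha, hb]
          | tmul a c => simp
        rw [LinearMap.lTensor_tmul, h1, coendComul_spec]
        induction X.coendCoact y with
        | zero => simp
        | add a b ha hb => simp only [TensorProduct.tmul_add, map_add, ha, hb]
        | tmul f v =>
          simp only [LinearMap.lTensor_tmul, TensorProduct.assoc_symm_tmul]
          induction X.coendCoact v with
          | zero => simp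
          | add a b ha hb => simp only [TensorProduct.tmul_add, map_add, ha, hb]
          | tmul a c => simp
    simp only [LinearMap.rTensor_comp, LinearMap.comp_apply]
    rw [coendComul_spec, hl, coendComul_spec, hr]
  rTensor_counit_comp_comul := by
    apply X.coend_hom_ext
    intro x
    have h1 : ∀ z : X.Coend ⊗[R] X.carrier,
        (X.coendCounit.rTensor X.Coend).rTensor X.carrier
          ((TensorProduct.assoc R X.Coend X.Coend X.carrier).symm
            (X.coendCoact.lTensor X.Coend z)) =
        (TensorProduct.assoc R R X.Coend X.carrier).symm
          (X.coendCoact.lTensor R (X.coendCounit.rTensor X.carrier z)) := by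
      intro z
      induction z with
      | zero => simp
      | add a b ha hb => simp only [map_add, ha, hb]
      | tmul e y =>
        simp only [LinearMap.lTensor_tmul, LinearMap.rTensor_tmul]
        induction X.coendCoact y with
        | zero => simp
        | add a b ha hb => simp only [TensorProduct.tmul_add, map_add, ha, hb]
        | tmul a c => simp
    rw [LinearMap.rTensor_comp, LinearMap.comp_apply, coendComul_spec, h1, coendCounit_spec,
      LinearMap.lTensor_tmul]
    induction X.coendCoact x with
    | zero => simp
    | add a b ha hb => simp only [TensorProduct.tmul_add, map_add, ha, hb]
    | tmul a c => simp
  lTensor_counit_comp_comul := by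
    apply X.coend_hom_ext
    intro x
    rw [LinearMap.rTensor_comp, LinearMap.comp_apply, coendComul_spec]
    induction X.coendCoact x with
    | zero => simp
    | add a b ha hb => simp only [map_add, ha, hb]
    | tmul e y =>
      have h1 : ∀ w : X.Coend ⊗[R] X.carrier,
          (X.coendCounit.lTensor X.Coend).rTensor X.carrier
            ((TensorProduct.assoc R X.Coend X.Coend X.carrier).symm (e ⊗ₜ w)) =
          (TensorProduct.assoc R X.Coend R X.carrier).symm
            (e ⊗ₜ X.coendCounit.rTensor X.carrier w) := by
        intro w
        induction w with
        | zero => simp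
        | add a b ha hb => simp only [TensorProduct.tmul_add, map_add, ha, hb]
        | tmul a c => simp
      rw [LinearMap.lTensor_tmul, h1, coendCounit_spec]
      simp

end RightComodule

namespace LeftComodule

/-- The cohom functor `h(X, -)`: the left adjoint of `X ⊗ -`. -/
noncomputable def cohom (X : LeftComodule R C) [X.IsQuasiFinite] :
    LeftComodule R C ⥤ ModuleCat.{u} R :=
  X.tensorFunctor.leftAdjoint

/-- The adjunction between `h(X, -)` and `X ⊗ -`. -/
noncomputable def cohomAdj (X : LeftComodule R C) [X.IsQuasiFinite] :
    X.cohom ⊣ X.tensorFunctor :=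
  Adjunction.ofIsRightAdjoint X.tensorFunctor

/-- The underlying module `h(X, X)` of the coendomorphism coalgebra `e(X)`. -/
def Coend (X : LeftComodule R C) [X.IsQuasiFinite] : Type u := X.cohom.obj X

noncomputable instance (X : LeftComodule R C) [X.IsQuasiFinite] : AddCommGroup X.Coend :=
  inferInstanceAs (AddCommGroup (X.cohom.obj X))

noncomputable instance (X : LeftComodule R C) [X.IsQuasiFinite] : Module R X.Coend :=
  inferInstanceAs (Module R (X.cohom.obj X))

variable (X : LeftComodule R C) [X.IsQuasiFinite]

/-- The unit of adjunction `η : X → X ⊗ h(X, X)`. -/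
noncomputable def coendUnit : X ⟶ X.tensor X.Coend := X.cohomAdj.unit.app X

/-- The unit of adjunction as a linear map. -/
noncomputable def coendCoact : X.carrier →ₗ[R] X.carrier ⊗[R] X.Coend := X.coendUnit.hom

/-- The linear map `h(X, X) → W` that corresponds to a colinear map `X → X ⊗ W`. -/
noncomputable def coendLift {W : Type u} [AddCommGroup W] [Module R W] (f : X ⟶ X.tensor W) :
    X.Coend →ₗ[R] W :=
  ((X.cohomAdj.homEquiv X (ModuleCat.of R W)).symm f).hom

theorem coendLift_spec {W : Type u} [AddCommGroup W] [Module R W] (f : X ⟶ X.tensor W) :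
    (X.coendLift f).lTensor X.carrier ∘ₗ X.coendCoact = f.hom := by
  have h := (X.cohomAdj.homEquiv X (ModuleCat.of R W)).apply_symm_apply f
  rw [Adjunction.homEquiv_unit] at h
  exact congrArg Hom.hom h

theorem coend_hom_ext {W : Type u} [AddCommGroup W] [Module R W] {f g : X.Coend →ₗ[R] W}
    (h : ∀ x, f.lTensor X.carrier (X.coendCoact x) = g.lTensor X.carrier (X.coendCoact x)) :
    f = g := by
  have h' : (X.cohomAdj.homEquiv X (ModuleCat.of R W)) (ModuleCat.ofHom f) =
      (X.cohomAdj.homEquiv X (ModuleCat.of R W)) (ModuleCat.ofHom g) := by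
    rw [Adjunction.homEquiv_unit, Adjunction.homEquiv_unit]
    exact hom_ext (LinearMap.ext h)
  exact congrArg ModuleCat.Hom.hom ((X.cohomAdj.homEquiv X (ModuleCat.of R W)).injective h')

/-- The colinear map `f ⊗ id : X ⊗ W → Y ⊗ W`. -/
noncomputable def tensorMap (W : Type u) [AddCommGroup W] [Module R W] {X Y : LeftComodule R C}
    (f : X ⟶ Y) : X.tensor W ⟶ Y.tensor W where
  hom := f.hom.rTensor W
  colinear := by
    ext x w
    have key : ∀ z : C ⊗[R] X.carrier,
        TensorProduct.assoc R C Y.carrier W (f.hom.lTensor C z ⊗ₜ w) =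
        (f.hom.rTensor W).lTensor C (TensorProduct.assoc R C X.carrier W (z ⊗ₜ w)) := by
      intro z
      induction z with
      | zero => simp
      | add a b ha hb => simp only [TensorProduct.add_tmul, map_add, ha, hb]
      | tmul a c => simp
    have := key (X.coact x)
    rw [← colinear_apply] at this
    exact this

/-- The colinear isomorphism `(X ⊗ W) ⊗ V → X ⊗ (W ⊗ V)`. -/
noncomputable def tensorAssoc (X : LeftComodule R C) (V W : Type u) [AddCommGroup V] [Module R V]
    [AddCommGroup W] [Module R W] : (X.tensor W).tensor V ⟶ X.tensor (W ⊗[R] V) where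
  hom := (TensorProduct.assoc R X.carrier W V).toLinearMap
  colinear := by
    apply TensorProduct.ext'
    intro (y : X.carrier ⊗[R] W) v
    induction y with
    | zero => simp
    | add a b ha hb => rw [TensorProduct.add_tmul, map_add, map_add, ha, hb]
    | tmul x w =>
      have key : ∀ z : C ⊗[R] X.carrier,
          TensorProduct.assoc R C X.carrier (W ⊗[R] V) (z ⊗ₜ (w ⊗ₜ v)) =
          (TensorProduct.assoc R X.carrier W V).toLinearMap.lTensor C
            (TensorProduct.assoc R C (X.carrier ⊗[R] W) V
              (TensorProduct.assoc R C X.carrier W (z ⊗ₜ w) ⊗ₜ v)) := by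
        intro z
        induction z with
        | zero => simp
        | add a b ha hb => simp only [TensorProduct.add_tmul, map_add, ha, hb]
        | tmul a c => simp
      exact key (X.coact x)

/-- The colinear isomorphism `X → X ⊗ R`. -/
noncomputable def toBaseTensor (X : LeftComodule R C) : X ⟶ X.tensor R where
  hom := (TensorProduct.rid R X.carrier).symm.toLinearMap
  colinear := by
    ext x
    have key : ∀ z : C ⊗[R] X.carrier,
        TensorProduct.assoc R C X.carrier R (z ⊗ₜ 1) =
        (TensorProduct.rid R X.carrier).symm.toLinearMap.lTensor C z := by
      intro z
      induction z with
      | zero => simp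
      | add a b ha hb => simp only [TensorProduct.add_tmul, map_add, ha, hb]
      | tmul a c => simp
    exact key (X.coact x)

/-- The comultiplication of `e(X)`: it corresponds to
`(η ⊗ id) η : X → X ⊗ h(X, X) ⊗ h(X, X)`. -/
noncomputable def coendComul : X.Coend →ₗ[R] X.Coend ⊗[R] X.Coend :=
  X.coendLift (X.coendUnit ≫ tensorMap X.Coend X.coendUnit ≫ X.tensorAssoc X.Coend X.Coend)

/-- The counit of `e(X)`: it corresponds to the canonical isomorphism `X → X ⊗ R`. -/
noncomputable def coendCounit : X.Coend →ₗ[R] R := X.coendLift X.toBaseTensor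

theorem coendComul_spec (x : X.carrier) :
    X.coendComul.lTensor X.carrier (X.coendCoact x) =
      TensorProduct.assoc R X.carrier X.Coend X.Coend
        (X.coendCoact.rTensor X.Coend (X.coendCoact x)) :=
  LinearMap.congr_fun (X.coendLift_spec _) x

theorem coendCounit_spec (x : X.carrier) :
    X.coendCounit.lTensor X.carrier (X.coendCoact x) = x ⊗ₜ 1 :=
  LinearMap.congr_fun (X.coendLift_spec _) x

/-- The coendomorphism coalgebra `e(X) = h(X, X)`. -/
noncomputable instance : Coalgebra R X.Coend where
  comul := X.coendComul
  counit := X.coendCounit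
  coassoc := by
    apply X.coend_hom_ext
    intro x
    have hl : ∀ z : X.carrier ⊗[R] X.Coend,
        (X.coendComul.lTensor X.Coend).lTensor X.carrier
          (TensorProduct.assoc R X.carrier X.Coend X.Coend
            (X.coendCoact.rTensor X.Coend z)) =
        TensorProduct.assoc R X.carrier X.Coend (X.Coend ⊗[R] X.Coend)
          (X.coendCoact.rTensor (X.Coend ⊗[R] X.Coend)
            (X.coendComul.lTensor X.carrier z)) := by
      intro z
      induction z with
      | zero => simp
      | add a b ha hb => simp only [map_add, ha, hb]
      | tmul y e =>
        simp only [LinearMap.lTensor_tmul, LinearMap.rTensor_tmul]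
        induction X.coendCoact y with
        | zero => simp
        | add a b ha hb => simp only [TensorProduct.add_tmul, map_add, ha, hb]
        | tmul a c => simp
    have hr : ∀ z : X.carrier ⊗[R] X.Coend,
        (TensorProduct.assoc R X.Coend X.Coend X.Coend).toLinearMap.lTensor X.carrier
          ((X.coendComul.rTensor X.Coend).lTensor X.carrier
            (TensorProduct.assoc R X.carrier X.Coend X.Coend
              (X.coendCoact.rTensor X.Coend z))) =
        TensorProduct.assoc R X.carrier X.Coend (X.Coend ⊗[R] X.Coend)
          (X.coendCoact.rTensor (X.Coend ⊗[R] X.Coend)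
            (TensorProduct.assoc R X.carrier X.Coend X.Coend
              (X.coendCoact.rTensor X.Coend z))) := by
      intro z
      induction z with
      | zero => simp
      | add a b ha hb => simp only [map_add, ha, hb]
      | tmul y e =>
        have h1 : ∀ w : X.carrier ⊗[R] X.Coend,
            (X.coendComul.rTensor X.Coend).lTensor X.carrier
              (TensorProduct.assoc R X.carrier X.Coend X.Coend (w ⊗ₜ e)) =
            TensorProduct.assoc R X.carrier (X.Coend ⊗[R] X.Coend) X.Coend
              (X.coendComul.lTensor X.carrier w ⊗ₜ e) := by
          intro w
          induction w with
          | zero => simp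
          | add a b ha hb => simp only [TensorProduct.add_tmul, map_add, ha, hb]
          | tmul a c => simp
        rw [LinearMap.rTensor_tmul, h1, coendComul_spec]
        induction X.coendCoact y with
        | zero => simp
        | add a b ha hb => simp only [TensorProduct.add_tmul, map_add, ha, hb]
        | tmul v f =>
          simp only [LinearMap.rTensor_tmul, TensorProduct.assoc_tmul]
          induction X.coendCoact v with
          | zero => simp
          | add a b ha hb => simp only [TensorProduct.add_tmul, map_add, ha, hb]
          | tmul a c => simp
    simp only [LinearMap.lTensor_comp, LinearMap.comp_apply]
    rw [coendComul_spec, hl, coendComul_spec, hr]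
  rTensor_counit_comp_comul := by
    apply X.coend_hom_ext
    intro x
    rw [LinearMap.lTensor_comp, LinearMap.comp_apply, coendComul_spec]
    induction X.coendCoact x with
    | zero => simp
    | add a b ha hb => simp only [map_add, ha, hb]
    | tmul y e =>
      have h1 : ∀ w : X.carrier ⊗[R] X.Coend,
          (X.coendCounit.rTensor X.Coend).lTensor X.carrier
            (TensorProduct.assoc R X.carrier X.Coend X.Coend (w ⊗ₜ e)) =
          TensorProduct.assoc R X.carrier R X.Coend
            (X.coendCounit.lTensor X.carrier w ⊗ₜ e) := by
        intro w
        induction w with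
        | zero => simp
        | add a b ha hb => simp only [TensorProduct.add_tmul, map_add, ha, hb]
        | tmul a c => simp
      rw [LinearMap.rTensor_tmul, h1, coendCounit_spec]
      simp
  lTensor_counit_comp_comul := by
    apply X.coend_hom_ext
    intro x
    have h1 : ∀ z : X.carrier ⊗[R] X.Coend,
        (X.coendCounit.lTensor X.Coend).lTensor X.carrier
          (TensorProduct.assoc R X.carrier X.Coend X.Coend
            (X.coendCoact.rTensor X.Coend z)) =
        TensorProduct.assoc R X.carrier X.Coend R
          (X.coendCoact.rTensor R (X.coendCounit.lTensor X.carrier z)) := by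
      intro z
      induction z with
      | zero => simp
      | add a b ha hb => simp only [map_add, ha, hb]
      | tmul y e =>
        simp only [LinearMap.lTensor_tmul, LinearMap.rTensor_tmul]
        induction X.coendCoact y with
        | zero => simp
        | add a b ha hb => simp only [TensorProduct.add_tmul, map_add, ha, hb]
        | tmul a c => simp
    rw [LinearMap.lTensor_comp, LinearMap.comp_apply, coendComul_spec, h1, coendCounit_spec,
      LinearMap.rTensor_tmul]
    induction X.coendCoact x with
    | zero => simp
    | add a b ha hb => simp only [TensorProduct.add_tmul, map_add, ha, hb]
    | tmul a c => simp

end LeftComodule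

/-! ### The conditions on a comodule -/

/-- The right `C`-comodule `X` is quasi-finite, faithfully coflat and an injector, and its
coendomorphism coalgebra is isomorphic to the coalgebra `E`. -/
def RightComodule.IsMoritaTakeuchi (X : RightComodule R C)
    (E : Type u) [AddCommGroup E] [Module R E] [Coalgebra R E] : Prop :=
  ∃ _ : X.IsQuasiFinite, X.IsFaithfullyCoflat ∧ X.IsInjector ∧ Nonempty (X.Coend ≃ₗc[R] E)

/-- The left `C`-comodule `X` is quasi-finite, faithfully coflat and an injector, and its
coendomorphism coalgebra is isomorphic to the coalgebra `E`. -/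
def LeftComodule.IsMoritaTakeuchi (X : LeftComodule R C)
    (E : Type u) [AddCommGroup E] [Module R E] [Coalgebra R E] : Prop :=
  ∃ _ : X.IsQuasiFinite, X.IsFaithfullyCoflat ∧ X.IsInjector ∧ Nonempty (X.Coend ≃ₗc[R] E)

end MoritaTakeuchi

/-! Let `X` be a right `D`-comodule that is a quasi-finite injector, flat over `R`, and such that
every comodule embeds into some `W ⊗ X`. Then `h(X, -)` is exact, since `- ⊗ X` preserves
injectives, and it is faithful. If a left coaction makes `C` the module `h(X, X)`, then `h(X, -)`
takes values in right `C`-comodules and `N` is recovered as `h(X, N □ X)` by applying `h(X, -)` to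
the kernel that defines `N □ X`; thus `h(X, -)` is an equivalence from right `D`-comodules to right
`C`-comodules. A linear equivalence carries the regular bicomodule `C` to a bicomodule with these
properties, since it commutes with `W ⊗ -`.

Put `Y = h(X, D)`. Then `h(X, M) = M □ Y`, and `X □ -` is left adjoint to `Y ⊗ -`, with `C` as
coendomorphism coalgebra of `Y`. So `X □ -` is the cohom functor of `Y` and `- □ Y` is the one of
`X`, and the properties of `X` as a right comodule pass to `Y` as a left comodule. Conversely, if
`X □ -` is exact and faithful, then `D → Y ⊗ X` stays injective after tensoring with any `W`, and
every comodule embeds into some `W ⊗ X`. Co-opposite coalgebras exchange left and right, and so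
close the circle of implications. -/

namespace MoritaTakeuchi

variable {R : Type u} [CommRing R] {C : Type u} [AddCommGroup C] [Module R C] [Coalgebra R C]
  {D : Type u} [AddCommGroup D] [Module R D] [Coalgebra R D]

section Associator

variable {A A' B B' E E' F : Type*} [AddCommGroup A] [Module R A] [AddCommGroup A'] [Module R A']
  [AddCommGroup B] [Module R B] [AddCommGroup B'] [Module R B'] [AddCommGroup E] [Module R E]
  [AddCommGroup E'] [Module R E'] [AddCommGroup F] [Module R F]

theorem assoc_rTensor_rTensor (f : A →ₗ[R] A') (z : (A ⊗[R] B) ⊗[R] E) :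
    TensorProduct.assoc R A' B E ((f.rTensor B).rTensor E z) =
      f.rTensor (B ⊗[R] E) (TensorProduct.assoc R A B E z) := by
  rw [LinearMap.rTensor_tensor, LinearMap.comp_apply, LinearMap.comp_apply, LinearEquiv.coe_coe,
    LinearEquiv.coe_coe, LinearEquiv.symm_apply_apply]

theorem assoc_lTensor_rTensor (f : B →ₗ[R] B') (z : (A ⊗[R] B) ⊗[R] E) :
    TensorProduct.assoc R A B' E ((f.lTensor A).rTensor E z) =
      (f.rTensor E).lTensor A (TensorProduct.assoc R A B E z) :=
  (LinearMap.congr_fun (LinearMap.lTensor_rTensor_comp_assoc _ f) z).symm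

theorem assoc_lTensor (f : E →ₗ[R] E') (z : (A ⊗[R] B) ⊗[R] E) :
    TensorProduct.assoc R A B E' (f.lTensor (A ⊗[R] B) z) =
      (f.lTensor B).lTensor A (TensorProduct.assoc R A B E z) := by
  rw [LinearMap.lTensor_tensor, LinearMap.comp_apply, LinearMap.comp_apply, LinearEquiv.coe_coe,
    LinearEquiv.coe_coe, LinearEquiv.apply_symm_apply]

theorem assoc_symm_rTensor (f : A →ₗ[R] A') (z : A ⊗[R] (B ⊗[R] E)) :
    (TensorProduct.assoc R A' B E).symm (f.rTensor (B ⊗[R] E) z) =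
      (f.rTensor B).rTensor E ((TensorProduct.assoc R A B E).symm z) := by
  rw [LinearEquiv.symm_apply_eq, assoc_rTensor_rTensor, LinearEquiv.apply_symm_apply]

theorem assoc_symm_lTensor_rTensor (f : B →ₗ[R] B') (z : A ⊗[R] (B ⊗[R] E)) :
    (TensorProduct.assoc R A B' E).symm ((f.rTensor E).lTensor A z) =
      (f.lTensor A).rTensor E ((TensorProduct.assoc R A B E).symm z) := by
  rw [LinearEquiv.symm_apply_eq, assoc_lTensor_rTensor, LinearEquiv.apply_symm_apply]

theorem assoc_symm_lTensor_lTensor (f : E →ₗ[R] E') (z : A ⊗[R] (B ⊗[R] E)) :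
    (TensorProduct.assoc R A B E').symm ((f.lTensor B).lTensor A z) =
      f.lTensor (A ⊗[R] B) ((TensorProduct.assoc R A B E).symm z) := by
  rw [LinearEquiv.symm_apply_eq, assoc_lTensor, LinearEquiv.apply_symm_apply]

theorem lTensor_rTensor_comm (f : A →ₗ[R] A') (g : B →ₗ[R] B') (z : A ⊗[R] B) :
    g.lTensor A' (f.rTensor B z) = f.rTensor B' (g.lTensor A z) := by
  rw [← LinearMap.comp_apply, ← LinearMap.comp_apply, LinearMap.lTensor_comp_rTensor,
    LinearMap.rTensor_comp_lTensor]

theorem rTensor_assoc_assoc_symm (z : (A ⊗[R] B) ⊗[R] (E ⊗[R] F)) :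
    (TensorProduct.assoc R A B E).toLinearMap.rTensor F
      ((TensorProduct.assoc R (A ⊗[R] B) E F).symm z) =
    (TensorProduct.assoc R A (B ⊗[R] E) F).symm
      ((TensorProduct.assoc R B E F).symm.toLinearMap.lTensor A
        (TensorProduct.assoc R A B (E ⊗[R] F) z)) := by
  have pentagon : (TensorProduct.assoc R A B E).toLinearMap.rTensor F ∘ₗ
      (TensorProduct.assoc R (A ⊗[R] B) E F).symm.toLinearMap =
      (TensorProduct.assoc R A (B ⊗[R] E) F).symm.toLinearMap ∘ₗ
      (TensorProduct.assoc R B E F).symm.toLinearMap.lTensor A ∘ₗ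
      (TensorProduct.assoc R A B (E ⊗[R] F)).toLinearMap := by
    ext
    simp
  exact LinearMap.congr_fun pentagon z

theorem rTensor_assoc_pentagon (z : A ⊗[R] ((B ⊗[R] E) ⊗[R] F)) :
    (TensorProduct.assoc R A B E).toLinearMap.rTensor F
      ((TensorProduct.assoc R (A ⊗[R] B) E F).symm ((TensorProduct.assoc R A B (E ⊗[R] F)).symm
        ((TensorProduct.assoc R B E F).toLinearMap.lTensor A z))) =
      (TensorProduct.assoc R A (B ⊗[R] E) F).symm z := by
  rw [rTensor_assoc_assoc_symm, LinearEquiv.apply_symm_apply, ← LinearMap.lTensor_comp_apply,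
    LinearEquiv.symm_comp, LinearMap.lTensor_id_apply]

theorem rTensor_assoc_symm_assoc_symm (z : A ⊗[R] (B ⊗[R] (E ⊗[R] F))) :
    (TensorProduct.assoc R A B E).symm.toLinearMap.rTensor F
      ((TensorProduct.assoc R A (B ⊗[R] E) F).symm
        ((TensorProduct.assoc R B E F).symm.toLinearMap.lTensor A z)) =
    (TensorProduct.assoc R (A ⊗[R] B) E F).symm
      ((TensorProduct.assoc R A B (E ⊗[R] F)).symm z) := by
  rw [← (TensorProduct.assoc R A B (E ⊗[R] F)).apply_symm_apply z, ← rTensor_assoc_assoc_symm,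
    ← LinearMap.rTensor_comp_apply, LinearEquiv.symm_comp, LinearMap.rTensor_id_apply,
    LinearEquiv.symm_apply_apply]

theorem lTensor_assoc_assoc_rTensor_assoc (z : ((A ⊗[R] B) ⊗[R] E) ⊗[R] F) :
    (TensorProduct.assoc R B E F).toLinearMap.lTensor A (TensorProduct.assoc R A (B ⊗[R] E) F
      ((TensorProduct.assoc R A B E).toLinearMap.rTensor F z)) =
      TensorProduct.assoc R A B (E ⊗[R] F) (TensorProduct.assoc R (A ⊗[R] B) E F z) := by
  have pentagon : (TensorProduct.assoc R B E F).toLinearMap.lTensor A ∘ₗ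
      (TensorProduct.assoc R A (B ⊗[R] E) F).toLinearMap ∘ₗ
        (TensorProduct.assoc R A B E).toLinearMap.rTensor F =
      (TensorProduct.assoc R A B (E ⊗[R] F)).toLinearMap ∘ₗ
        (TensorProduct.assoc R (A ⊗[R] B) E F).toLinearMap := by
    ext
    simp
  exact LinearMap.congr_fun pentagon z

theorem assoc_assoc_rTensor_assoc_symm (z : (A ⊗[R] (B ⊗[R] E)) ⊗[R] F) :
    TensorProduct.assoc R A B (E ⊗[R] F) (TensorProduct.assoc R (A ⊗[R] B) E F
      ((TensorProduct.assoc R A B E).symm.toLinearMap.rTensor F z)) =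
      (TensorProduct.assoc R B E F).toLinearMap.lTensor A
        (TensorProduct.assoc R A (B ⊗[R] E) F z) := by
  rw [← lTensor_assoc_assoc_rTensor_assoc, ← LinearMap.rTensor_comp_apply, LinearEquiv.comp_symm,
    LinearMap.rTensor_id_apply]

theorem lid_lTensor (f : A →ₗ[R] B) (z : R ⊗[R] A) :
    TensorProduct.lid R B (f.lTensor R z) = f (TensorProduct.lid R A z) := by
  have naturality : (TensorProduct.lid R B).toLinearMap ∘ₗ f.lTensor R =
      f ∘ₗ (TensorProduct.lid R A).toLinearMap := by
    ext
    simp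
  exact LinearMap.congr_fun naturality z

theorem lid_assoc_rTensor_mk_one (z : A ⊗[R] B) :
    TensorProduct.lid R (A ⊗[R] B)
      (TensorProduct.assoc R R A B ((TensorProduct.mk R R A 1).rTensor B z)) = z := by
  have triangle : (TensorProduct.lid R (A ⊗[R] B)).toLinearMap ∘ₗ
      (TensorProduct.assoc R R A B).toLinearMap ∘ₗ (TensorProduct.mk R R A 1).rTensor B =
        LinearMap.id := by
    ext
    simp
  exact LinearMap.congr_fun triangle z

theorem lTensor_lid_assoc_rTensor_mk_one (z : A ⊗[R] B) :
    (TensorProduct.lid R B).toLinearMap.lTensor A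
      (TensorProduct.assoc R A R B (((TensorProduct.mk R A R).flip 1).rTensor B z)) = z := by
  have triangle : (TensorProduct.lid R B).toLinearMap.lTensor A ∘ₗ
      (TensorProduct.assoc R A R B).toLinearMap ∘ₗ
        ((TensorProduct.mk R A R).flip 1).rTensor B = LinearMap.id := by
    ext
    simp
  exact LinearMap.congr_fun triangle z

theorem assoc_symm_lTensor_mk_one (z : A ⊗[R] B) :
    (TensorProduct.assoc R A R B).symm ((TensorProduct.mk R R B 1).lTensor A z) =
      ((TensorProduct.mk R A R).flip 1).rTensor B z := by
  have triangle : (TensorProduct.assoc R A R B).symm.toLinearMap ∘ₗ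
      (TensorProduct.mk R R B 1).lTensor A = ((TensorProduct.mk R A R).flip 1).rTensor B := by
    ext
    simp
  exact LinearMap.congr_fun triangle z

end Associator

/-! ### Kernels and cokernels of comodules -/

namespace RightComodule

/-- The functor that forgets the coaction of a right comodule. -/
abbrev forget (R : Type u) [CommRing R] (D : Type u) [AddCommGroup D] [Module R D]
    [Coalgebra R D] : RightComodule R D ⥤ ModuleCat.{u} R where
  obj M := ModuleCat.of R M.carrier
  map f := ModuleCat.ofHom f.hom

instance : (forget R D).Faithful where
  map_injective h := hom_ext (congrArg ModuleCat.Hom.hom h)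

instance : (forget R D).ReflectsIsomorphisms where
  reflects {M N} f _ := by
    let e : M.carrier ≃ₗ[R] N.carrier := (asIso ((forget R D).map f)).toLinearEquiv
    have he : e.toLinearMap = f.hom := rfl
    refine ⟨⟨e.symm.toLinearMap, ?_⟩, hom_ext e.symm_comp, hom_ext e.comp_symm⟩
    refine LinearMap.cancel_right e.surjective |>.1 ?_
    rw [LinearMap.comp_assoc, LinearMap.comp_assoc, e.symm_comp, he, f.colinear,
      ← LinearMap.comp_assoc, ← LinearMap.rTensor_comp, ← he, e.symm_comp, LinearMap.rTensor_id]
    rfl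

section

variable {M N P : RightComodule R D}

theorem mono_of_injective (f : M ⟶ N) (hf : Function.Injective f.hom) : Mono f :=
  (forget R D).mono_of_mono_map ((ModuleCat.mono_iff_injective _).2 hf)

theorem epi_of_surjective (f : M ⟶ N) (hf : Function.Surjective f.hom) : Epi f :=
  (forget R D).epi_of_epi_map ((ModuleCat.epi_iff_surjective _).2 hf)

theorem isIso_of_bijective (f : M ⟶ N) (hf : Function.Bijective f.hom) : IsIso f :=
  have : IsIso ((forget R D).map f) := (ConcreteCategory.isIso_iff_bijective _).2 hf
  isIso_of_reflects_iso f (forget R D)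

theorem exists_comp_eq_of_ker_le (q : M ⟶ N) (hq : Function.Surjective q.hom) (g : M ⟶ P)
    (h : LinearMap.ker q.hom ≤ LinearMap.ker g.hom) : ∃ l : N ⟶ P, q ≫ l = g := by
  obtain ⟨l, hl⟩ : ∃ l : N.carrier →ₗ[R] P.carrier, l ∘ₗ q.hom = g.hom := by
    let e := q.hom.quotKerEquivOfSurjective hq
    refine ⟨(LinearMap.ker q.hom).liftQ g.hom h ∘ₗ e.symm.toLinearMap, LinearMap.ext fun x => ?_⟩
    have hx : e.symm (q.hom x) = Submodule.Quotient.mk x := (LinearEquiv.symm_apply_eq _).2 rfl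
    simp only [LinearMap.comp_apply, LinearEquiv.coe_coe, hx, Submodule.liftQ_apply]
  refine ⟨⟨l, LinearMap.cancel_right hq |>.1 ?_⟩, hom_ext hl⟩
  rw [LinearMap.comp_assoc, LinearMap.comp_assoc, hl, q.colinear, ← LinearMap.comp_assoc,
    ← LinearMap.rTensor_comp, hl, g.colinear]

theorem exists_comp_eq_of_range_le [Module.Flat R D] (i : M ⟶ N)
    (hi : Function.Injective i.hom) (g : P ⟶ N)
    (h : LinearMap.range g.hom ≤ LinearMap.range i.hom) : ∃ l : P ⟶ M, l ≫ i = g := by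
  let l : P.carrier →ₗ[R] M.carrier :=
    g.hom.codRestrictOfInjective i.hom hi fun x => h (LinearMap.mem_range_self _ x)
  have hl : i.hom ∘ₗ l = g.hom := LinearMap.codRestrictOfInjective_comp _ _ _ _
  have hiD := Module.Flat.rTensor_preserves_injective_linearMap (M := D) i.hom hi
  refine ⟨⟨l, LinearMap.cancel_left hiD |>.1 ?_⟩, hom_ext hl⟩
  rw [← LinearMap.comp_assoc, ← i.colinear, LinearMap.comp_assoc, hl, ← LinearMap.comp_assoc,
    ← LinearMap.rTensor_comp, hl, g.colinear]

/-- The comodule structure on the cokernel of a colinear map. -/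
noncomputable abbrev cokernel (f : M ⟶ N) : RightComodule R D where
  carrier := N.carrier ⧸ LinearMap.range f.hom
  coact := (LinearMap.range f.hom).liftQ ((LinearMap.range f.hom).mkQ.rTensor D ∘ₗ N.coact) (by
    rintro _ ⟨x, rfl⟩
    rw [LinearMap.mem_ker, LinearMap.comp_apply, colinear_apply, ← LinearMap.rTensor_comp_apply,
      LinearMap.range_mkQ_comp, LinearMap.rTensor_zero, LinearMap.zero_apply])
  coassoc := by
    refine LinearMap.cancel_right (Submodule.mkQ_surjective _) |>.1 (LinearMap.ext fun x => ?_)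
    simp only [LinearMap.comp_apply, LinearEquiv.coe_coe, Submodule.mkQ_apply,
      Submodule.liftQ_apply]
    rw [← LinearMap.rTensor_comp_apply, Submodule.liftQ_mkQ, LinearMap.rTensor_comp_apply,
      assoc_rTensor_rTensor, coassoc_apply, lTensor_rTensor_comm]
  counit := by
    refine LinearMap.cancel_right (Submodule.mkQ_surjective _) |>.1 (LinearMap.ext fun x => ?_)
    simp only [LinearMap.comp_apply, Submodule.mkQ_apply, Submodule.liftQ_apply]
    rw [lTensor_rTensor_comm, counit_apply]
    rfl

/-- The projection to the cokernel of a colinear map. -/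
noncomputable abbrev cokernelπ (f : M ⟶ N) : N ⟶ cokernel f where
  hom := (LinearMap.range f.hom).mkQ
  colinear := Submodule.liftQ_mkQ _ _ _

section Kernel

variable [Module.Flat R D]

/-- The coaction on the kernel of a colinear map. Flatness of `D` identifies `ker f ⊗ D` with a
submodule of `M ⊗ D`. -/
noncomputable def kernelCoact (f : M ⟶ N) :
    LinearMap.ker f.hom →ₗ[R] LinearMap.ker f.hom ⊗[R] D :=
  (M.coact ∘ₗ (LinearMap.ker f.hom).subtype).codRestrictOfInjective
    ((LinearMap.ker f.hom).subtype.rTensor D)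
    (Module.Flat.rTensor_preserves_injective_linearMap _ (Submodule.injective_subtype _))
    fun x => (Module.Flat.rTensor_exact D f.hom.exact_subtype_ker_map _).1 (by
      rw [LinearMap.comp_apply, ← colinear_apply, Submodule.subtype_apply,
        LinearMap.mem_ker.1 x.2, map_zero])

theorem subtype_comp_kernelCoact (f : M ⟶ N) :
    (LinearMap.ker f.hom).subtype.rTensor D ∘ₗ kernelCoact f =
      M.coact ∘ₗ (LinearMap.ker f.hom).subtype :=
  LinearMap.codRestrictOfInjective_comp _ _ _ _

theorem subtype_kernelCoact (f : M ⟶ N) (x : LinearMap.ker f.hom) :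
    (LinearMap.ker f.hom).subtype.rTensor D (kernelCoact f x) = M.coact x :=
  LinearMap.congr_fun (subtype_comp_kernelCoact f) x

/-- The comodule structure on the kernel of a colinear map. -/
noncomputable abbrev kernel (f : M ⟶ N) : RightComodule R D where
  carrier := LinearMap.ker f.hom
  coact := kernelCoact f
  coassoc := by
    ext x
    apply Module.Flat.rTensor_preserves_injective_linearMap (M := D ⊗[R] D)
      (LinearMap.ker f.hom).subtype (Submodule.injective_subtype _)
    simp only [LinearMap.comp_apply, LinearEquiv.coe_coe]
    rw [← assoc_rTensor_rTensor, ← LinearMap.rTensor_comp_apply, subtype_comp_kernelCoact,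
      LinearMap.rTensor_comp_apply, subtype_kernelCoact, coassoc_apply, ← subtype_kernelCoact,
      lTensor_rTensor_comm]
  counit := by
    ext x
    apply Module.Flat.rTensor_preserves_injective_linearMap (M := R)
      (LinearMap.ker f.hom).subtype (Submodule.injective_subtype _)
    rw [LinearMap.comp_apply, ← lTensor_rTensor_comm, subtype_kernelCoact, counit_apply]
    rfl

/-- The inclusion of the kernel of a colinear map. -/
noncomputable abbrev kernelι (f : M ⟶ N) : kernel f ⟶ M where
  hom := (LinearMap.ker f.hom).subtype
  colinear := (subtype_comp_kernelCoact f).symm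

theorem injective_of_mono (f : M ⟶ N) [Mono f] : Function.Injective f.hom := by
  have hι : kernelι f = 0 := by
    rw [← cancel_mono f, Limits.zero_comp]
    exact hom_ext f.hom.comp_ker_subtype
  rw [← LinearMap.ker_eq_bot, Submodule.eq_bot_iff]
  intro x hx
  exact LinearMap.congr_fun (congrArg Hom.hom hι) (⟨x, hx⟩ : LinearMap.ker f.hom)

end Kernel

end

end RightComodule

namespace RightComodule

/-! ### The cohom functor through its universal property -/

/-- The colinear map `k ⊗ id : V ⊗ X → W ⊗ X` induced by a linear map `k : V → W`. -/
abbrev tensorHom (X : RightComodule R D) {V W : Type u} [AddCommGroup V] [Module R V]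
    [AddCommGroup W] [Module R W] (k : V →ₗ[R] W) : X.tensor V ⟶ X.tensor W :=
  ⟨k.rTensor X.carrier, X.tensor_colinear k⟩

/-- The colinear map `M → W ⊗ M` that sends `m` to `w ⊗ m`. -/
abbrev inclTensor (M : RightComodule R D) {W : Type u} [AddCommGroup W] [Module R W] (w : W) :
    M ⟶ M.tensor W where
  hom := TensorProduct.mk R W M.carrier w
  colinear := by
    have h : (TensorProduct.assoc R W M.carrier D).symm.toLinearMap ∘ₗ
        TensorProduct.mk R W (M.carrier ⊗[R] D) w =
        (TensorProduct.mk R W M.carrier w).rTensor D := by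
      ext
      simp
    exact LinearMap.ext fun m => LinearMap.congr_fun h (M.coact m)

/-- The coalgebra `D` as a right comodule over itself. -/
abbrev regular (R : Type u) [CommRing R] (D : Type u) [AddCommGroup D] [Module R D]
    [Coalgebra R D] : RightComodule R D where
  carrier := D
  coact := Coalgebra.comul
  coassoc := Coalgebra.coassoc
  counit := Coalgebra.lTensor_counit_comp_comul

/-- The coaction of a comodule `M` as a colinear map `M → M ⊗ D` to a cofree comodule. -/
abbrev coactHom (M : RightComodule R D) : M ⟶ (regular R D).tensor M.carrier where
  hom := M.coact
  colinear := LinearMap.ext fun m =>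
    (TensorProduct.assoc R M.carrier D D).symm_apply_eq.2 (M.coassoc_apply m).symm

theorem coact_injective (M : RightComodule R D) : Function.Injective M.coact := by
  refine Function.LeftInverse.injective (g := fun z => TensorProduct.rid R M.carrier
    ((Coalgebra.counit (R := R) (A := D)).lTensor M.carrier z)) fun x => ?_
  beta_reduce
  rw [counit_apply, TensorProduct.rid_tmul, one_smul]

/-- The colinear map `M → V ⊗ X` exhibits `V` as the cohom module `h(X, M)`: every colinear map
`M → W ⊗ X` factors through it by a unique linear map `V → W`. Working with this property instead
of the functor `cohom` allows computing with any convenient model of `h(X, M)`. -/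
structure IsCohom {X M : RightComodule R D} {V : Type u} [AddCommGroup V] [Module R V]
    (η : M ⟶ X.tensor V) : Prop where
  exists_lift : ∀ {W : Type u} [AddCommGroup W] [Module R W] (f : M ⟶ X.tensor W),
    ∃ k : V →ₗ[R] W, k.rTensor X.carrier ∘ₗ η.hom = f.hom
  hom_ext : ∀ {W : Type u} [AddCommGroup W] [Module R W] {k k' : V →ₗ[R] W},
    (∀ x, k.rTensor X.carrier (η.hom x) = k'.rTensor X.carrier (η.hom x)) → k = k'

/-- The unit of adjunction `M → h(X, M) ⊗ X`. -/
noncomputable def cohomUnit (X : RightComodule R D) [X.IsQuasiFinite] (M : RightComodule R D) :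
    M ⟶ X.tensor (X.cohom.obj M) :=
  X.cohomAdj.unit.app M

theorem isCohom_unit_app {X : RightComodule R D} {L : RightComodule R D ⥤ ModuleCat.{u} R}
    (adj : L ⊣ X.tensorFunctor) (M : RightComodule R D) :
    IsCohom (V := L.obj M) (adj.unit.app M) where
  exists_lift {W} _ _ f := by
    refine ⟨((adj.homEquiv M (ModuleCat.of R W)).symm f).hom, ?_⟩
    have h := (adj.homEquiv M (ModuleCat.of R W)).apply_symm_apply f
    rw [Adjunction.homEquiv_unit] at h
    exact congrArg Hom.hom h
  hom_ext {W} _ _ k k' h := by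
    have h' : adj.homEquiv M (ModuleCat.of R W) (ModuleCat.ofHom k) =
        adj.homEquiv M (ModuleCat.of R W) (ModuleCat.ofHom k') := by
      rw [Adjunction.homEquiv_unit, Adjunction.homEquiv_unit]
      exact RightComodule.hom_ext (LinearMap.ext h)
    exact congrArg ModuleCat.Hom.hom ((adj.homEquiv M (ModuleCat.of R W)).injective h')

theorem isCohom_cohomUnit (X : RightComodule R D) [X.IsQuasiFinite] (M : RightComodule R D) :
    IsCohom (X.cohomUnit M) :=
  isCohom_unit_app X.cohomAdj M

theorem isCohom_coendUnit (X : RightComodule R D) [X.IsQuasiFinite] : IsCohom X.coendUnit where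
  exists_lift f := ⟨X.coendLift f, X.coendLift_spec f⟩
  hom_ext h := X.coend_hom_ext h

theorem exists_injective_cokernelπ_comp_eq {M N P : RightComodule R D} (i : M ⟶ N) (f : N ⟶ P)
    (hif : Function.Exact i.hom f.hom) :
    ∃ l : cokernel i ⟶ P, Function.Injective l.hom ∧ cokernelπ i ≫ l = f := by
  obtain ⟨l, rfl⟩ := exists_comp_eq_of_ker_le (cokernelπ i) (Submodule.mkQ_surjective _) f
    (by rw [Submodule.ker_mkQ, hif.linearMap_ker_eq])
  refine ⟨l, (injective_iff_map_eq_zero _).2 fun q hq => ?_, rfl⟩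
  obtain ⟨y, rfl⟩ := Submodule.mkQ_surjective _ q
  exact (Submodule.Quotient.mk_eq_zero _).2 ((hif y).1 hq)

namespace IsCohom

section

variable {X M N P : RightComodule R D} {V V' V'' W : Type u} [AddCommGroup V] [Module R V]
  [AddCommGroup V'] [Module R V'] [AddCommGroup V''] [Module R V''] [AddCommGroup W] [Module R W]
  {η : M ⟶ X.tensor V} {η' : N ⟶ X.tensor V'} {η'' : P ⟶ X.tensor V''}

/-- The linear map `h(X, M) → W` that corresponds to a colinear map `M → W ⊗ X`. -/
noncomputable def lift (h : IsCohom η) (f : M ⟶ X.tensor W) : V →ₗ[R] W :=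
  (h.exists_lift f).choose

theorem lift_apply (h : IsCohom η) (f : M ⟶ X.tensor W) (x : M.carrier) :
    (h.lift f).rTensor X.carrier (η.hom x) = f.hom x :=
  LinearMap.congr_fun (h.exists_lift f).choose_spec x

theorem comp_tensorHom_lift (h : IsCohom η) (f : M ⟶ X.tensor W) :
    η ≫ X.tensorHom (h.lift f) = f :=
  RightComodule.hom_ext (h.exists_lift f).choose_spec

/-- The linear map `h(X, f) : h(X, M) → h(X, N)` of a colinear map `f : M → N`, where `η'` is a
map `N → h(X, N) ⊗ X`. -/
noncomputable def map (h : IsCohom η) (η' : N ⟶ X.tensor V') (f : M ⟶ N) : V →ₗ[R] V' :=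
  h.lift (f ≫ η')

theorem map_apply (h : IsCohom η) (f : M ⟶ N) (x : M.carrier) :
    (h.map η' f).rTensor X.carrier (η.hom x) = η'.hom (f.hom x) :=
  h.lift_apply _ x

theorem eq_map (h : IsCohom η) (f : M ⟶ N) {k : V →ₗ[R] V'}
    (hk : ∀ x, k.rTensor X.carrier (η.hom x) = η'.hom (f.hom x)) : k = h.map η' f :=
  h.hom_ext fun x => by rw [hk, map_apply]

theorem map_id (h : IsCohom η) : h.map η (𝟙 M) = LinearMap.id :=
  (h.eq_map _ fun x => by rw [LinearMap.rTensor_id_apply]; rfl).symm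

protected theorem map_zero (h : IsCohom η) : h.map η' 0 = 0 :=
  (h.eq_map _ fun x => by
    rw [LinearMap.rTensor_zero, LinearMap.zero_apply]
    exact (map_zero η'.hom).symm).symm

theorem map_comp (h : IsCohom η) (h' : IsCohom η') (f : M ⟶ N) (g : N ⟶ P) :
    h.map η'' (f ≫ g) = h'.map η'' g ∘ₗ h.map η' f :=
  (h.eq_map _ fun x => by
    rw [LinearMap.rTensor_comp_apply, map_apply, map_apply]
    rfl).symm

theorem map_injective (hX : X.IsInjector) (h : IsCohom η) (h' : IsCohom η') (f : M ⟶ N)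
    (hf : Function.Injective f.hom) : Function.Injective (h.map η' f) := by
  let Q := Injective.under (ModuleCat.of R V)
  let j : V →ₗ[R] Q := (Injective.ι (ModuleCat.of R V)).hom
  have hj : Function.Injective j := (ModuleCat.mono_iff_injective _).1 inferInstance
  have hQ : Injective (X.tensor Q) := hX.injective_obj (X := Q) inferInstance
  have hmono : Mono f := mono_of_injective f hf
  let e : N ⟶ X.tensor Q := Injective.factorThru (η ≫ X.tensorHom j) f
  have he : f ≫ e = η ≫ X.tensorHom j := Injective.comp_factorThru _ _
  have hfactor : h'.lift e ∘ₗ h.map η' f = j := h.hom_ext fun x => by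
    rw [LinearMap.rTensor_comp_apply, map_apply, lift_apply]
    exact LinearMap.congr_fun (congrArg Hom.hom he) x
  exact Function.Injective.of_comp (f := h'.lift e) (by rwa [← LinearMap.coe_comp, hfactor])

theorem ker_map_cokernelπ_le (h : IsCohom η) (h' : IsCohom η') (i : M ⟶ N)
    {ηQ : cokernel i ⟶ X.tensor V''} (hQ : IsCohom ηQ) :
    LinearMap.ker (h'.map ηQ (cokernelπ i)) ≤ LinearMap.range (h.map η' i) := by
  obtain ⟨m, hm⟩ := exists_comp_eq_of_ker_le (cokernelπ i) (Submodule.mkQ_surjective _)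
    (η' ≫ X.tensorHom (LinearMap.range (h.map η' i)).mkQ) (by
      rw [Submodule.ker_mkQ]
      rintro _ ⟨x, rfl⟩
      change (LinearMap.range (h.map η' i)).mkQ.rTensor X.carrier (η'.hom (i.hom x)) = 0
      rw [← h.map_apply, ← LinearMap.rTensor_comp_apply, LinearMap.range_mkQ_comp,
        LinearMap.rTensor_zero, LinearMap.zero_apply])
  have hfactor : hQ.lift m ∘ₗ h'.map ηQ (cokernelπ i) = (LinearMap.range (h.map η' i)).mkQ :=
    h'.hom_ext fun y => by
      rw [LinearMap.rTensor_comp_apply, map_apply, lift_apply]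
      exact LinearMap.congr_fun (congrArg Hom.hom hm) y
  calc LinearMap.ker (h'.map ηQ (cokernelπ i))
      ≤ LinearMap.ker (hQ.lift m ∘ₗ h'.map ηQ (cokernelπ i)) := LinearMap.ker_le_ker_comp _ _
    _ = LinearMap.range (h.map η' i) := by rw [hfactor, Submodule.ker_mkQ]

theorem map_exact (hX : X.IsInjector) [X.IsQuasiFinite] (h : IsCohom η)
    (h' : IsCohom η') (h'' : IsCohom η'') (i : M ⟶ N) (f : N ⟶ P)
    (hif : Function.Exact i.hom f.hom) : Function.Exact (h.map η' i) (h'.map η'' f) := by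
  obtain ⟨l, hl, rfl⟩ := exists_injective_cokernelπ_comp_eq i f hif
  have hQ := isCohom_cohomUnit X (cokernel i)
  refine LinearMap.exact_iff.2 (le_antisymm ?_ ?_)
  · rw [map_comp h' hQ, LinearMap.ker_comp_of_ker_eq_bot _
      (LinearMap.ker_eq_bot.2 (hQ.map_injective hX h'' l hl))]
    exact h.ker_map_cokernelπ_le h' i hQ
  · have hzero : i ≫ cokernelπ i ≫ l = 0 := RightComodule.hom_ext hif.linearMap_comp_eq_zero
    rw [LinearMap.range_le_ker_iff, ← map_comp h h', hzero, IsCohom.map_zero]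

/-- The cohom modules of two universal maps are isomorphic. -/
noncomputable def equiv {η' : M ⟶ X.tensor V'} (h : IsCohom η) (h' : IsCohom η') : V ≃ₗ[R] V' :=
  LinearEquiv.ofLinearMap (h.lift η') (h'.lift η)
    (h'.hom_ext fun x => by
      rw [LinearMap.rTensor_comp_apply, lift_apply, lift_apply, LinearMap.rTensor_id_apply])
    (h.hom_ext fun x => by
      rw [LinearMap.rTensor_comp_apply, lift_apply, lift_apply, LinearMap.rTensor_id_apply])

theorem comp_tensorHom (h : IsCohom η) (e : V ≃ₗ[R] V') :
    IsCohom (η ≫ X.tensorHom e.toLinearMap) where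
  exists_lift f := ⟨h.lift f ∘ₗ e.symm.toLinearMap, by
    ext x
    change (h.lift f ∘ₗ e.symm.toLinearMap).rTensor X.carrier
      (e.toLinearMap.rTensor X.carrier (η.hom x)) = f.hom x
    rw [← LinearMap.rTensor_comp_apply, LinearMap.comp_assoc, LinearEquiv.symm_comp,
      LinearMap.comp_id, lift_apply]⟩
  hom_ext {W} _ _ k k' hk := by
    refine LinearMap.cancel_right e.surjective |>.1 (h.hom_ext fun x => ?_)
    rw [LinearMap.rTensor_comp_apply, LinearMap.rTensor_comp_apply]
    exact hk x

end

section Tensor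

variable {X M : RightComodule R D} {V : Type u} [AddCommGroup V] [Module R V]
  {η : M ⟶ X.tensor V} {W : Type u} [AddCommGroup W] [Module R W]

theorem tensorMap_comp_tensorAssoc_apply (η : M ⟶ X.tensor V) (z : W ⊗[R] M.carrier) :
    (tensorMap W η ≫ X.tensorAssoc W V).hom z =
      (TensorProduct.assoc R W V X.carrier).symm (η.hom.lTensor W z) := rfl

theorem rTensor_tensorMap_tmul (η : M ⟶ X.tensor V) {U : Type u} [AddCommGroup U] [Module R U]
    (k : W ⊗[R] V →ₗ[R] U) (w : W) (m : M.carrier) :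
    k.rTensor X.carrier ((tensorMap W η ≫ X.tensorAssoc W V).hom (w ⊗ₜ m)) =
      (k ∘ₗ TensorProduct.mk R W V w).rTensor X.carrier (η.hom m) := by
  rw [LinearMap.rTensor_comp_apply]
  rfl

/-- The linear map `W → Hom(h(X, M), U)` that corresponds to a colinear map `W ⊗ M → U ⊗ X`. -/
noncomputable def curriedLift (h : IsCohom η) {U : Type u} [AddCommGroup U] [Module R U]
    (f : M.tensor W ⟶ X.tensor U) : W →ₗ[R] V →ₗ[R] U where
  toFun w := h.lift (M.inclTensor w ≫ f)
  map_add' a b := h.hom_ext fun x => by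
    rw [LinearMap.rTensor_add, LinearMap.add_apply, lift_apply, lift_apply, lift_apply]
    exact congrArg f.hom (TensorProduct.add_tmul a b x) |>.trans (map_add f.hom _ _)
  map_smul' r a := h.hom_ext fun x => by
    rw [LinearMap.rTensor_smul, LinearMap.smul_apply, lift_apply, lift_apply]
    exact f.hom.map_smul r (a ⊗ₜ x)

variable (W) in
theorem tensor (h : IsCohom η) : IsCohom (tensorMap W η ≫ X.tensorAssoc W V) where
  exists_lift f := by
    refine ⟨TensorProduct.lift (h.curriedLift f), TensorProduct.ext' fun w m => ?_⟩
    have hw : TensorProduct.lift (h.curriedLift f) ∘ₗ TensorProduct.mk R W V w =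
        h.lift (M.inclTensor w ≫ f) := LinearMap.ext fun _ => TensorProduct.lift.tmul _ _
    rw [LinearMap.comp_apply, rTensor_tensorMap_tmul, hw, lift_apply]
    rfl
  hom_ext hk := TensorProduct.ext <| LinearMap.ext fun w => h.hom_ext fun m =>
    (rTensor_tensorMap_tmul η _ w m).symm.trans
      ((hk (w ⊗ₜ m)).trans (rTensor_tensorMap_tmul η _ w m))

end Tensor

end IsCohom

end RightComodule

/-! ### Bicomodule structures from the coendomorphism coalgebra -/

namespace Bicomodule

/-- The left coaction of a bicomodule as a right colinear map. -/
abbrev lcoactHom (X : Bicomodule R C D) : X.right ⟶ X.right.tensor C where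
  hom := X.lcoact
  colinear := LinearMap.ext fun x => (TensorProduct.assoc R C X.carrier D).symm_apply_eq.2
    (LinearMap.congr_fun X.bicolinear x).symm

theorem lcoassoc_apply (X : Bicomodule R C D) (x : X.carrier) :
    X.lcoact.lTensor C (X.lcoact x) = TensorProduct.assoc R C C X.carrier
      ((Coalgebra.comul (R := R) (A := C)).rTensor X.carrier (X.lcoact x)) :=
  (LinearMap.congr_fun X.lcoassoc x).symm

theorem lcounit_apply (X : Bicomodule R C D) (x : X.carrier) :
    (Coalgebra.counit (R := R) (A := C)).rTensor X.carrier (X.lcoact x) = 1 ⊗ₜ x :=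
  LinearMap.congr_fun X.lcounit x

end Bicomodule

namespace RightComodule

/-- A right comodule that is quasi-finite, flat and an injector, and that cogenerates the category
of right comodules: every comodule embeds into some `W ⊗ X`. -/
structure IsFlatCogenerator (X : RightComodule R D) : Prop where
  isQuasiFinite : X.IsQuasiFinite
  isInjector : X.IsInjector
  flat : Module.Flat R X.carrier
  cogenerates : ∀ M : RightComodule R D, ∃ W : ModuleCat.{u} R, ∃ f : M ⟶ X.tensor W,
    Function.Injective f.hom

theorem IsCohom.injective {X M : RightComodule R D} {V : Type u} [AddCommGroup V] [Module R V]
    {η : M ⟶ X.tensor V} (h : IsCohom η) (hX : X.IsFlatCogenerator) :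
    Function.Injective η.hom := by
  obtain ⟨W, f, hf⟩ := hX.cogenerates M
  intro x y hxy
  apply hf
  rw [← h.lift_apply f, ← h.lift_apply f, hxy]

section

variable (X : RightComodule R D) [X.IsQuasiFinite] (e : X.Coend ≃ₗc[R] C)

theorem lTensor_rTensor_coendCoact (x : X.carrier) :
    (e.toCoalgHom.toLinearMap.rTensor X.carrier ∘ₗ X.coendCoact).lTensor C
        (e.toCoalgHom.toLinearMap.rTensor X.carrier (X.coendCoact x)) =
      TensorProduct.assoc R C C X.carrier ((Coalgebra.comul (R := R) (A := C)).rTensor X.carrier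
        (e.toCoalgHom.toLinearMap.rTensor X.carrier (X.coendCoact x))) := by
  set f := e.toCoalgHom.toLinearMap
  have hcomul : Coalgebra.comul ∘ₗ f = (f.rTensor C ∘ₗ f.lTensor X.Coend) ∘ₗ Coalgebra.comul := by
    rw [LinearMap.rTensor_comp_lTensor]
    exact e.toCoalgHom.map_comp_comul.symm
  have hcoact : TensorProduct.assoc R X.Coend X.Coend X.carrier
      ((Coalgebra.comul (R := R)).rTensor X.carrier (X.coendCoact x)) =
      X.coendCoact.lTensor X.Coend (X.coendCoact x) :=
    (LinearEquiv.symm_apply_eq _).1 (X.coendComul_spec x).symm |>.symm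
  rw [← LinearMap.rTensor_comp_apply, hcomul, LinearMap.rTensor_comp_apply,
    LinearMap.rTensor_comp_apply, assoc_rTensor_rTensor, assoc_lTensor_rTensor, hcoact,
    LinearMap.lTensor_comp_apply, ← lTensor_rTensor_comm, lTensor_rTensor_comm,
    lTensor_rTensor_comm]

/-- The bicomodule structure on `X` transported along a coalgebra isomorphism `e(X) ≃ C`. -/
noncomputable abbrev coendBicomodule : Bicomodule R C D where
  carrier := X.carrier
  rcoact := X.coact
  rcoassoc := X.coassoc
  rcounit := X.counit
  lcoact := e.toCoalgHom.toLinearMap.rTensor X.carrier ∘ₗ X.coendCoact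
  lcoassoc := LinearMap.ext fun x => (X.lTensor_rTensor_coendCoact e x).symm
  lcounit := LinearMap.ext fun x => by
    rw [LinearMap.comp_apply, LinearMap.comp_apply, ← LinearMap.rTensor_comp_apply,
      e.toCoalgHom.counit_comp]
    exact X.coendCounit_spec x
  bicolinear := LinearMap.ext fun x => ((TensorProduct.assoc R C X.carrier D).symm_apply_eq.1
    (LinearMap.congr_fun (X.coendUnit ≫ X.tensorHom e.toCoalgHom.toLinearMap).colinear x)).symm

theorem isCohom_lcoactHom_coendBicomodule : IsCohom (X.coendBicomodule e).lcoactHom :=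
  X.isCohom_coendUnit.comp_tensorHom e.toLinearEquiv

end

end RightComodule

/-! ### The cohom functor into `C`-comodules and its inverse `- □ X` -/

namespace Bicomodule

variable (X : Bicomodule R C D)

/-- The colinear map `W ⊗ X → (W ⊗ C) ⊗ X` given by the left coaction of `X`. -/
noncomputable abbrev tensorLcoactHom (W : Type u) [AddCommGroup W] [Module R W] :
    X.right.tensor W ⟶ X.right.tensor (W ⊗[R] C) :=
  RightComodule.tensorMap W X.lcoactHom ≫ X.right.tensorAssoc W C

theorem lTensor_lTensor_lcoact (W : Type u) [AddCommGroup W] [Module R W]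
    (z : W ⊗[R] X.carrier) :
    (X.lcoact.lTensor C).lTensor W (X.lcoact.lTensor W z) =
      (TensorProduct.assoc R C C X.carrier).toLinearMap.lTensor W
        (((Coalgebra.comul (R := R) (A := C)).rTensor X.carrier).lTensor W
          (X.lcoact.lTensor W z)) := by
  rw [← LinearMap.lTensor_comp_apply, ← LinearMap.lTensor_comp_apply,
    ← LinearMap.lTensor_comp_apply, LinearMap.comp_assoc, X.lcoassoc]

/-- The colinear map `N ⊗ X → (N ⊗ C) ⊗ X` whose kernel is `N □ X`. -/
noncomputable def cotensorHom (N : RightComodule R C) :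
    X.right.tensor N.carrier ⟶ X.right.tensor (N.carrier ⊗[R] C) :=
  X.right.tensorHom N.coact - X.tensorLcoactHom N.carrier

theorem cotensorHom_apply (N : RightComodule R C) (z : N.carrier ⊗[R] X.carrier) :
    (X.cotensorHom N).hom z = N.coact.rTensor X.carrier z -
      (TensorProduct.assoc R N.carrier C X.carrier).symm (X.lcoact.lTensor N.carrier z) := by
  rw [cotensorHom, sub_eq_add_neg, sub_eq_add_neg]
  rfl

theorem mem_ker_cotensorHom (N : RightComodule R C) (z : N.carrier ⊗[R] X.carrier) :
    z ∈ LinearMap.ker (X.cotensorHom N).hom ↔ N.coact.rTensor X.carrier z =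
      (TensorProduct.assoc R N.carrier C X.carrier).symm (X.lcoact.lTensor N.carrier z) := by
  rw [LinearMap.mem_ker, cotensorHom_apply, sub_eq_zero]

end Bicomodule

namespace RightComodule

namespace IsCohom

section

variable {X : Bicomodule R C D} {M N : RightComodule R D} {V V' : Type u} [AddCommGroup V]
  [Module R V] [AddCommGroup V'] [Module R V'] {η : M ⟶ X.right.tensor V}
  {η' : N ⟶ X.right.tensor V'}

/-- The coaction of `C` on `h(X, M)`. -/
noncomputable def coact (h : IsCohom (X := X.right) η) : V →ₗ[R] V ⊗[R] C :=
  h.lift (η ≫ X.tensorLcoactHom V)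

theorem coact_apply (h : IsCohom (X := X.right) η) (x : M.carrier) :
    h.coact.rTensor X.carrier (η.hom x) =
      (TensorProduct.assoc R V C X.carrier).symm (X.lcoact.lTensor V (η.hom x)) :=
  h.lift_apply _ x

/-- The right `C`-comodule `h(X, M)`. -/
noncomputable abbrev comodule (h : IsCohom (X := X.right) η) : RightComodule R C where
  carrier := V
  coact := h.coact
  coassoc := by
    refine h.hom_ext fun x => ?_
    change ((TensorProduct.assoc R V C C).toLinearMap ∘ₗ h.coact.rTensor C ∘ₗ
      h.coact).rTensor X.carrier (η.hom x) =
      ((Coalgebra.comul (R := R)).lTensor V ∘ₗ h.coact).rTensor X.carrier (η.hom x)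
    rw [LinearMap.rTensor_comp_apply, LinearMap.rTensor_comp_apply, LinearMap.rTensor_comp_apply,
      coact_apply, ← assoc_symm_rTensor, ← lTensor_rTensor_comm, coact_apply,
      ← assoc_symm_lTensor_lTensor, X.lTensor_lTensor_lcoact, rTensor_assoc_pentagon,
      assoc_symm_lTensor_rTensor]
  counit := by
    refine h.hom_ext fun x => ?_
    change ((Coalgebra.counit (R := R)).lTensor V ∘ₗ h.coact).rTensor X.carrier
      (η.hom x) = ((TensorProduct.mk R V R).flip 1).rTensor X.carrier (η.hom x)
    rw [LinearMap.rTensor_comp_apply, coact_apply, ← assoc_symm_lTensor_rTensor,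
      ← LinearMap.lTensor_comp_apply, X.lcounit, assoc_symm_lTensor_mk_one]

/-- The `C`-colinear map `h(X, M) → h(X, N)` that corresponds to a colinear map `M → N`. -/
noncomputable abbrev mapHom (h : IsCohom (X := X.right) η) (h' : IsCohom (X := X.right) η')
    (f : M ⟶ N) : h.comodule ⟶ h'.comodule where
  hom := h.map η' f
  colinear := by
    refine h.hom_ext fun x => ?_
    change (h'.coact ∘ₗ h.map η' f).rTensor X.carrier (η.hom x) =
      ((h.map η' f).rTensor C ∘ₗ h.coact).rTensor X.carrier (η.hom x)
    rw [LinearMap.rTensor_comp_apply, LinearMap.rTensor_comp_apply, h.coact_apply, h.map_apply,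
      h'.coact_apply, ← assoc_symm_rTensor, ← lTensor_rTensor_comm, h.map_apply]

end

section LeftCoaction

variable {B : Bicomodule R C D} {X : RightComodule R D} {Y : Type u} [AddCommGroup Y]
  [Module R Y] {δ : B.right ⟶ X.tensor Y}

/-- The left coaction of `C` on `h(X, B)`, for a `C`-`D`-bicomodule `B`. -/
noncomputable def leftCoact (hδ : IsCohom (M := B.right) δ) : Y →ₗ[R] C ⊗[R] Y :=
  hδ.map (tensorMap C δ ≫ X.tensorAssoc C Y) B.lcoactHom

theorem leftCoact_apply (hδ : IsCohom (M := B.right) δ) (b : B.carrier) :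
    hδ.leftCoact.rTensor X.carrier (δ.hom b) =
      (TensorProduct.assoc R C Y X.carrier).symm (δ.hom.lTensor C (B.lcoact b)) :=
  hδ.map_apply _ b

theorem leftCoact_comp (hδ : IsCohom (M := B.right) δ) :
    hδ.leftCoact.rTensor X.carrier ∘ₗ δ.hom =
      (TensorProduct.assoc R C Y X.carrier).symm.toLinearMap ∘ₗ δ.hom.lTensor C ∘ₗ B.lcoact :=
  LinearMap.ext hδ.leftCoact_apply

/-- The left `C`-comodule `h(X, B)`, for a `C`-`D`-bicomodule `B`. -/
noncomputable abbrev leftComodule (hδ : IsCohom (M := B.right) δ) : LeftComodule R C where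
  carrier := Y
  coact := hδ.leftCoact
  coassoc := hδ.hom_ext fun b => by
    rw [LinearMap.rTensor_comp_apply, LinearMap.rTensor_comp_apply, LinearMap.rTensor_comp_apply,
      leftCoact_apply, ← assoc_symm_rTensor, ← lTensor_rTensor_comm, ← assoc_symm_lTensor_rTensor,
      ← LinearMap.lTensor_comp_apply, leftCoact_comp, rTensor_assoc_assoc_symm,
      LinearMap.lTensor_comp_apply, LinearMap.lTensor_comp_apply, assoc_lTensor,
      B.lcoassoc_apply]
  counit := hδ.hom_ext fun b => by
    have hmk : (TensorProduct.assoc R R Y X.carrier).symm.toLinearMap ∘ₗ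
        TensorProduct.mk R R (Y ⊗[R] X.carrier) 1 =
        (TensorProduct.mk R R Y 1).rTensor X.carrier := by
      ext
      simp
    rw [LinearMap.rTensor_comp_apply, leftCoact_apply, ← assoc_symm_rTensor,
      ← lTensor_rTensor_comm, B.lcounit_apply, LinearMap.lTensor_tmul, ← hmk]
    rfl

theorem map_cotensorHom (hδ : IsCohom (M := B.right) δ) (N : RightComodule R C) :
    (hδ.tensor N.carrier).map
        (tensorMap (N.carrier ⊗[R] C) δ ≫ X.tensorAssoc (N.carrier ⊗[R] C) Y) (B.cotensorHom N) =
      N.coact.rTensor Y -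
        (TensorProduct.assoc R N.carrier C Y).symm.toLinearMap ∘ₗ
          hδ.leftCoact.lTensor N.carrier := by
  refine ((hδ.tensor N.carrier).eq_map _ fun z => ?_).symm
  have hsub (f g : N.carrier ⊗[R] Y →ₗ[R] (N.carrier ⊗[R] C) ⊗[R] Y)
      (w : (N.carrier ⊗[R] Y) ⊗[R] X.carrier) : (f - g).rTensor X.carrier w =
        f.rTensor X.carrier w - g.rTensor X.carrier w := by
    rw [LinearMap.rTensor_sub]
    rfl
  rw [tensorMap_comp_tensorAssoc_apply, tensorMap_comp_tensorAssoc_apply, B.cotensorHom_apply,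
    map_sub, map_sub]
  refine (hsub _ _ _).trans (congrArg₂ (· - ·) ?_ ?_)
  · rw [← assoc_symm_rTensor, lTensor_rTensor_comm]
  · rw [LinearMap.rTensor_comp_apply, ← assoc_symm_lTensor_rTensor, ← assoc_symm_lTensor_lTensor,
      ← LinearMap.lTensor_comp_apply, ← LinearMap.lTensor_comp_apply, leftCoact_comp,
      LinearMap.lTensor_comp_apply, rTensor_assoc_symm_assoc_symm]

theorem leftCoact_lcoactHom {X : Bicomodule R C D} (hC : IsCohom X.lcoactHom) :
    leftCoact (B := X) hC = Coalgebra.comul (R := R) :=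
  (hC.eq_map _ fun x => (LinearEquiv.symm_apply_eq _).2 (X.lcoassoc_apply x) |>.symm).symm

end LeftCoaction

theorem surjective_of_map_surjective {X : RightComodule R D} (hX : X.IsFlatCogenerator)
    {M N : RightComodule R D} {V V' : Type u} [AddCommGroup V] [Module R V]
    [AddCommGroup V'] [Module R V'] {η : M ⟶ X.tensor V} {η' : N ⟶ X.tensor V'}
    (h : IsCohom η) (h' : IsCohom η') (f : M ⟶ N)
    (hf : Function.Surjective (h.map η' f)) : Function.Surjective f.hom := by
  have := hX.isQuasiFinite
  have hQ := isCohom_cohomUnit X (cokernel f)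
  have hzero : f ≫ cokernelπ f = 0 := RightComodule.hom_ext (LinearMap.range_mkQ_comp _)
  have hmap : h'.map (X.cohomUnit (cokernel f)) (cokernelπ f) = 0 := by
    refine LinearMap.cancel_right hf |>.1 ?_
    rw [← h.map_comp h', hzero, IsCohom.map_zero, LinearMap.zero_comp]
  refine fun y => (Submodule.Quotient.mk_eq_zero (LinearMap.range f.hom)).1 (hQ.injective hX ?_)
  refine (h'.map_apply (cokernelπ f) y).symm.trans ?_
  rw [hmap, LinearMap.rTensor_zero, LinearMap.zero_apply, map_zero]

end IsCohom

theorem Equivalent.symm (h : Equivalent R C D) : Equivalent R D C := by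
  obtain ⟨F, _, _, _⟩ := h
  have : F.asEquivalence.functor.Additive := ‹F.Additive›
  have : F.asEquivalence.functor.Linear R := ‹F.Linear R›
  exact ⟨F.asEquivalence.inverse, inferInstance, inferInstance, inferInstance⟩

/-- The functor `h(X, -)` from right `D`-comodules to right `C`-comodules. -/
noncomputable abbrev cohomFunctor (X : Bicomodule R C D) [X.right.IsQuasiFinite] :
    RightComodule R D ⥤ RightComodule R C where
  obj M := (isCohom_cohomUnit X.right M).comodule
  map {M N} f := (isCohom_cohomUnit X.right M).mapHom (isCohom_cohomUnit X.right N) f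
  map_id M := hom_ext (isCohom_cohomUnit X.right M).map_id
  map_comp {M N _} f g :=
    hom_ext ((isCohom_cohomUnit X.right M).map_comp (isCohom_cohomUnit X.right N) f g)

instance (X : Bicomodule R C D) [X.right.IsQuasiFinite] : (cohomFunctor X).Additive where
  map_add {M N f g} := by
    refine hom_ext ((isCohom_cohomUnit X.right M).eq_map (f + g) fun x => ?_).symm
    refine (LinearMap.congr_fun (LinearMap.rTensor_add _ _ _) _).trans ?_
    rw [LinearMap.add_apply, IsCohom.map_apply, IsCohom.map_apply, ← map_add]
    rfl

instance (X : Bicomodule R C D) [X.right.IsQuasiFinite] : (cohomFunctor X).Linear R where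
  map_smul {M N} f r := by
    refine hom_ext ((isCohom_cohomUnit X.right M).eq_map (r • f) fun x => ?_).symm
    refine (LinearMap.congr_fun (LinearMap.rTensor_smul _ _ _) _).trans ?_
    rw [LinearMap.smul_apply, IsCohom.map_apply, ← map_smul]
    rfl

theorem cohomFunctor_faithful {X : Bicomodule R C D} (hX : X.right.IsFlatCogenerator)
    [X.right.IsQuasiFinite] : (cohomFunctor X).Faithful where
  map_injective {M N} f g hfg := by
    ext x
    have hM := isCohom_cohomUnit X.right M
    have hmap : hM.map (X.right.cohomUnit N) f = hM.map (X.right.cohomUnit N) g :=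
      congrArg Hom.hom hfg
    apply (isCohom_cohomUnit X.right N).injective hX
    rw [← hM.map_apply, ← hM.map_apply, hmap]

section

variable [Module.Flat R D] {X : Bicomodule R C D}

section Counit

variable {V : Type u} [AddCommGroup V] [Module R V] {N : RightComodule R C}
  {η : kernel (X.cotensorHom N) ⟶ X.right.tensor V}

theorem rTensor_coact_lift_kernelι (h : IsCohom (X := X.right) η)
    (p : (kernel (X.cotensorHom N)).carrier) :
    (N.coact ∘ₗ h.lift (kernelι (X.cotensorHom N))).rTensor X.carrier (η.hom p) =
      (TensorProduct.assoc R N.carrier C X.carrier).symm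
        (X.lcoact.lTensor N.carrier ((kernelι (X.cotensorHom N)).hom p)) := by
  rw [LinearMap.rTensor_comp_apply, h.lift_apply]
  exact (X.mem_ker_cotensorHom N _).1 p.2

/-- The counit `h(X, N □ X) → N`. -/
noncomputable abbrev cotensorCounit (h : IsCohom (X := X.right) η) : h.comodule ⟶ N where
  hom := h.lift (kernelι (X.cotensorHom N))
  colinear := h.hom_ext fun p => by
    change (N.coact ∘ₗ h.lift (kernelι (X.cotensorHom N))).rTensor X.carrier (η.hom p) =
      ((h.lift (kernelι (X.cotensorHom N))).rTensor C ∘ₗ h.coact).rTensor X.carrier (η.hom p)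
    rw [rTensor_coact_lift_kernelι, LinearMap.rTensor_comp_apply, h.coact_apply,
      ← assoc_symm_rTensor, ← lTensor_rTensor_comm, h.lift_apply]

theorem map_kernelι_cotensorHom (h : IsCohom (X := X.right) η) :
    h.map (X.tensorLcoactHom N.carrier) (kernelι (X.cotensorHom N)) =
      N.coact ∘ₗ h.lift (kernelι (X.cotensorHom N)) :=
  (h.eq_map _ (rTensor_coact_lift_kernelι h)).symm

end Counit

theorem cotensorCounit_bijective {V : Type u} [AddCommGroup V] [Module R V]
    {N : RightComodule R C} {η : kernel (X.cotensorHom N) ⟶ X.right.tensor V}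
    (hX : X.right.IsFlatCogenerator) (hC : IsCohom X.lcoactHom)
    (h : IsCohom (X := X.right) η) : Function.Bijective (cotensorCounit h).hom := by
  have := hX.isQuasiFinite
  have hN := hC.tensor N.carrier
  have hinj := h.map_injective hX.isInjector hN (kernelι (X.cotensorHom N))
    (Submodule.injective_subtype _)
  have hexact := h.map_exact hX.isInjector hN (hC.tensor (N.carrier ⊗[R] C))
    (kernelι (X.cotensorHom N)) (X.cotensorHom N) (LinearMap.exact_subtype_ker_map _)
  rw [map_kernelι_cotensorHom] at hinj hexact
  rw [IsCohom.map_cotensorHom (B := X) hC, IsCohom.leftCoact_lcoactHom] at hexact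
  refine ⟨Function.Injective.of_comp hinj, fun n => ?_⟩
  obtain ⟨v, hv⟩ := (hexact (N.coact n)).1 (by
    rw [LinearMap.sub_apply, sub_eq_zero, LinearMap.comp_apply, ← coassoc_apply]
    exact (LinearEquiv.symm_apply_apply _ _).symm)
  exact ⟨v, N.coact_injective hv⟩

theorem cohomFunctor_essSurj (hX : X.right.IsFlatCogenerator) (hC : IsCohom X.lcoactHom)
    [X.right.IsQuasiFinite] : (cohomFunctor X).EssSurj where
  mem_essImage N :=
    have h := isCohom_cohomUnit X.right (kernel (X.cotensorHom N))
    have := isIso_of_bijective (cotensorCounit h) (cotensorCounit_bijective hX hC h)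
    ⟨kernel (X.cotensorHom N), ⟨asIso (cotensorCounit h)⟩⟩

section Unit

variable {M : RightComodule R D} {V : Type u} [AddCommGroup V] [Module R V]
  {η : M ⟶ X.right.tensor V}

theorem exists_comp_kernelι_eq {N : RightComodule R C} (h : IsCohom (X := X.right) η)
    (φ : h.comodule ⟶ N) :
    ∃ g : M ⟶ kernel (X.cotensorHom N),
      g ≫ kernelι (X.cotensorHom N) = η ≫ X.right.tensorHom φ.hom := by
  refine exists_comp_eq_of_range_le _ (Submodule.injective_subtype _) _ ?_
  rintro _ ⟨x, rfl⟩
  have hφ : N.coact ∘ₗ φ.hom = φ.hom.rTensor C ∘ₗ h.coact := φ.colinear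
  rw [Submodule.range_subtype, X.mem_ker_cotensorHom]
  change N.coact.rTensor X.carrier (φ.hom.rTensor X.carrier (η.hom x)) =
    (TensorProduct.assoc R _ C X.carrier).symm
      (X.lcoact.lTensor _ (φ.hom.rTensor X.carrier (η.hom x)))
  rw [← LinearMap.rTensor_comp_apply, hφ, LinearMap.rTensor_comp_apply, h.coact_apply,
    lTensor_rTensor_comm, assoc_symm_rTensor]

theorem bijective_of_comp_kernelι_eq (hX : X.right.IsFlatCogenerator)
    (hC : IsCohom X.lcoactHom) (h : IsCohom (X := X.right) η)
    (j : M ⟶ kernel (X.cotensorHom h.comodule))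
    (hj : j ≫ kernelι (X.cotensorHom h.comodule) = η) : Function.Bijective j.hom := by
  have := hX.isQuasiFinite
  have hj' : ∀ x, (kernelι (X.cotensorHom h.comodule)).hom (j.hom x) = η.hom x := fun x =>
    LinearMap.congr_fun (congrArg Hom.hom hj) x
  have hP := isCohom_cohomUnit X.right (kernel (X.cotensorHom h.comodule))
  have hcounit : (cotensorCounit hP).hom ∘ₗ h.map _ j = LinearMap.id := h.hom_ext fun x => by
    rw [LinearMap.rTensor_comp_apply, h.map_apply, hP.lift_apply, hj', LinearMap.rTensor_id_apply]
  refine ⟨fun x y hxy => h.injective hX (by rw [← hj', ← hj', hxy]), ?_⟩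
  refine IsCohom.surjective_of_map_surjective hX h hP j fun v =>
    ⟨(cotensorCounit hP).hom v, (cotensorCounit_bijective hX hC hP).1 ?_⟩
  exact LinearMap.congr_fun hcounit _

end Unit

theorem cohomFunctor_full (hX : X.right.IsFlatCogenerator) (hC : IsCohom X.lcoactHom)
    [X.right.IsQuasiFinite] : (cohomFunctor X).Full where
  map_surjective {M N} φ := by
    have hM := isCohom_cohomUnit X.right M
    have hN := isCohom_cohomUnit X.right N
    obtain ⟨j, hj⟩ := exists_comp_kernelι_eq hN (𝟙 hN.comodule)
    have hj' : j ≫ kernelι (X.cotensorHom hN.comodule) = X.right.cohomUnit N :=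
      hj.trans (hom_ext (LinearMap.ext fun x => LinearMap.rTensor_id_apply _ _ _))
    have := isIso_of_bijective j (bijective_of_comp_kernelι_eq hX hC hN j hj')
    obtain ⟨g, hg⟩ := exists_comp_kernelι_eq hM φ
    have hcomp : (g ≫ inv j) ≫ X.right.cohomUnit N =
        X.right.cohomUnit M ≫ X.right.tensorHom φ.hom := by
      rw [← hj', Category.assoc, IsIso.inv_hom_id_assoc, hg]
    exact ⟨g ≫ inv j, hom_ext (hM.eq_map _ fun x =>
      (LinearMap.congr_fun (congrArg Hom.hom hcomp) x).symm).symm⟩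

theorem IsFlatCogenerator.equivalent (hX : X.right.IsFlatCogenerator)
    (hC : IsCohom X.lcoactHom) : Equivalent R C D := by
  have := hX.isQuasiFinite
  have := cohomFunctor_faithful hX
  have := cohomFunctor_essSurj hX hC
  have := cohomFunctor_full hX hC
  exact Equivalent.symm ⟨cohomFunctor X, {}, inferInstance, inferInstance⟩

end

end RightComodule

/-! ### Cohom modules as cotensor products -/

/-- The coalgebra `D` as a bicomodule over itself. -/
abbrev Bicomodule.regular (R : Type u) [CommRing R] (D : Type u) [AddCommGroup D] [Module R D]
    [Coalgebra R D] : Bicomodule R D D where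
  carrier := D
  lcoact := Coalgebra.comul
  lcoassoc := Coalgebra.coassoc
  lcounit := Coalgebra.rTensor_counit_comp_comul
  rcoact := Coalgebra.comul
  rcoassoc := Coalgebra.coassoc
  rcounit := Coalgebra.lTensor_counit_comp_comul
  bicolinear := Coalgebra.coassoc

theorem mem_cotensor {M : RightComodule R D} {N : LeftComodule R D}
    {z : M.carrier ⊗[R] N.carrier} : z ∈ cotensor M N ↔
      TensorProduct.assoc R M.carrier D N.carrier (M.coact.rTensor N.carrier z) =
        N.coact.lTensor M.carrier z := by
  rw [cotensor, LinearMap.mem_ker, cotensorMap, LinearMap.sub_apply, sub_eq_zero]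
  rfl

namespace RightComodule

theorem eq_coact_of_coact_rTensor_eq (N : RightComodule R C) (z : N.carrier ⊗[R] C)
    (hz : N.coact.rTensor C z = (TensorProduct.assoc R N.carrier C C).symm
      ((Coalgebra.comul (R := R) (A := C)).lTensor N.carrier z)) :
    z = N.coact (TensorProduct.rid R N.carrier
      ((Coalgebra.counit (R := R) (A := C)).lTensor N.carrier z)) := by
  have hcounit := congrArg (TensorProduct.rid R (N.carrier ⊗[R] C))
    (congrArg ((Coalgebra.counit (R := R) (A := C)).lTensor (N.carrier ⊗[R] C)) hz)
  rw [lTensor_rTensor_comm, ← assoc_symm_lTensor_lTensor, ← LinearMap.lTensor_comp_apply,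
    Coalgebra.lTensor_counit_comp_comul] at hcounit
  have hrid : (TensorProduct.rid R (N.carrier ⊗[R] C)).toLinearMap ∘ₗ N.coact.rTensor R =
      N.coact ∘ₗ (TensorProduct.rid R N.carrier).toLinearMap := by
    ext
    simp
  have hmk : (TensorProduct.rid R (N.carrier ⊗[R] C)).toLinearMap ∘ₗ
      (TensorProduct.assoc R N.carrier C R).symm.toLinearMap ∘ₗ
        ((TensorProduct.mk R C R).flip 1).lTensor N.carrier = LinearMap.id := by
    ext
    simp
  exact (LinearMap.congr_fun hmk z).symm.trans
    (hcounit.symm.trans (LinearMap.congr_fun hrid _))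

theorem exact_coact_cotensorHom (M : RightComodule R D) :
    Function.Exact M.coact ((Bicomodule.regular R D).cotensorHom M).hom := by
  refine fun z => ((Bicomodule.regular R D).mem_ker_cotensorHom M z).trans
    ⟨fun hz => ⟨_, (M.eq_coact_of_coact_rTensor_eq z hz).symm⟩, ?_⟩
  rintro ⟨m, rfl⟩
  exact (LinearEquiv.eq_symm_apply _).2 (M.coassoc_apply m)

namespace IsCohom

variable {X M N : RightComodule R D} {V V' Y : Type u} [AddCommGroup V] [Module R V]
  [AddCommGroup V'] [Module R V'] [AddCommGroup Y] [Module R Y]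
  {η : M ⟶ X.tensor V} {η' : N ⟶ X.tensor V'} {δ : (Bicomodule.regular R D).right ⟶ X.tensor Y}

/-- The map `h(X, M) → h(X, M ⊗ D) = M ⊗ h(X, D)` induced by the coaction of `M`; it identifies
`h(X, M)` with the cotensor product `M □ h(X, D)`. -/
noncomputable def toCotensor (δ : (Bicomodule.regular R D).right ⟶ X.tensor Y) (h : IsCohom η) :
    V →ₗ[R] M.carrier ⊗[R] Y :=
  h.map (tensorMap M.carrier δ ≫ X.tensorAssoc M.carrier Y) M.coactHom

theorem toCotensor_apply (h : IsCohom η) (m : M.carrier) :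
    (h.toCotensor δ).rTensor X.carrier (η.hom m) =
      (TensorProduct.assoc R M.carrier Y X.carrier).symm (δ.hom.lTensor M.carrier (M.coact m)) :=
  h.map_apply _ m

theorem toCotensor_injective (hX : X.IsInjector) (hδ : IsCohom δ) (h : IsCohom η) :
    Function.Injective (h.toCotensor δ) :=
  h.map_injective hX (hδ.tensor M.carrier) M.coactHom M.coact_injective

theorem toCotensor_naturality (h : IsCohom η) (h' : IsCohom η') (f : M ⟶ N) :
    h'.toCotensor δ ∘ₗ h.map η' f = f.hom.rTensor Y ∘ₗ h.toCotensor δ := by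
  refine h.hom_ext fun m => ?_
  rw [LinearMap.rTensor_comp_apply, h.map_apply, toCotensor_apply, LinearMap.rTensor_comp_apply,
    toCotensor_apply, ← assoc_symm_rTensor, ← lTensor_rTensor_comm, colinear_apply]

theorem flat (hX : X.IsInjector) [Module.Flat R D] (hδ : IsCohom δ) : Module.Flat R Y := by
  refine Module.Flat.iff_rTensor_preserves_injective_linearMap.2 fun W W' _ _ _ _ f hf => ?_
  have hf' : Function.Injective ((regular R D).tensorHom f).hom :=
    Module.Flat.rTensor_preserves_injective_linearMap f hf
  convert (hδ.tensor W).map_injective hX (hδ.tensor W') ((regular R D).tensorHom f) hf'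
  refine (hδ.tensor W).eq_map _ fun z => ?_
  rw [tensorMap_comp_tensorAssoc_apply, tensorMap_comp_tensorAssoc_apply, ← assoc_symm_rTensor,
    lTensor_rTensor_comm]

theorem range_toCotensor (hX : X.IsInjector) [X.IsQuasiFinite] (hδ : IsCohom δ)
    (h : IsCohom η) : LinearMap.range (h.toCotensor δ) =
      cotensor M (hδ.leftComodule) := by
  have hexact := map_exact hX h (hδ.tensor M.carrier) (hδ.tensor (M.carrier ⊗[R] D)) M.coactHom
    ((Bicomodule.regular R D).cotensorHom M) M.exact_coact_cotensorHom
  rw [map_cotensorHom hδ] at hexact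
  ext z
  rw [mem_cotensor, ← LinearEquiv.eq_symm_apply, ← sub_eq_zero]
  exact (hexact z).symm

end IsCohom

end RightComodule

/-! ### The adjunction between `X □ -` and `Y ⊗ -` -/

section Rotation

variable {W A B : Type u} [AddCommGroup W] [Module R W] [AddCommGroup A] [Module R A]
  [AddCommGroup B] [Module R B]

/-- The isomorphism `(W ⊗ A) ⊗ B → A ⊗ (B ⊗ W)`. -/
noncomputable def tensorRotate (R : Type u) [CommRing R] (W A B : Type u) [AddCommGroup W]
    [Module R W] [AddCommGroup A] [Module R A] [AddCommGroup B] [Module R B] :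
    (W ⊗[R] A) ⊗[R] B ≃ₗ[R] A ⊗[R] (B ⊗[R] W) :=
  TensorProduct.assoc R W A B ≪≫ₗ TensorProduct.comm R W (A ⊗[R] B) ≪≫ₗ TensorProduct.assoc R A B W

@[simp]
theorem tensorRotate_tmul (w : W) (a : A) (b : B) :
    tensorRotate R W A B ((w ⊗ₜ a) ⊗ₜ b) = a ⊗ₜ (b ⊗ₜ w) := rfl

theorem cotensorMap_tensorRotate (M : RightComodule R D) (N : LeftComodule R D)
    (z : (W ⊗[R] M.carrier) ⊗[R] N.carrier) :
    cotensorMap M (N.tensor W) (tensorRotate R W M.carrier N.carrier z) =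
      (TensorProduct.assoc R D N.carrier W).toLinearMap.lTensor M.carrier
        (tensorRotate R W M.carrier (D ⊗[R] N.carrier) (cotensorMap (M.tensor W) N z)) := by
  have hcomp : cotensorMap M (N.tensor W) ∘ₗ (tensorRotate R W M.carrier N.carrier).toLinearMap =
      (TensorProduct.assoc R D N.carrier W).toLinearMap.lTensor M.carrier ∘ₗ
        (tensorRotate R W M.carrier (D ⊗[R] N.carrier)).toLinearMap ∘ₗ
          cotensorMap (M.tensor W) N := by
    ext w m n
    change TensorProduct.assoc R M.carrier D (N.carrier ⊗[R] W) (M.coact m ⊗ₜ (n ⊗ₜ w)) -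
      m ⊗ₜ (TensorProduct.assoc R D N.carrier W (N.coact n ⊗ₜ w)) =
      (TensorProduct.assoc R D N.carrier W).toLinearMap.lTensor M.carrier
        (tensorRotate R W M.carrier (D ⊗[R] N.carrier)
          (TensorProduct.assoc R (W ⊗[R] M.carrier) D N.carrier
            ((TensorProduct.assoc R W M.carrier D).symm (w ⊗ₜ M.coact m) ⊗ₜ n) -
            (w ⊗ₜ m) ⊗ₜ N.coact n))
    rw [map_sub, map_sub]
    congr 1
    induction M.coact m with
    | zero => simp
    | add a b ha hb => simp only [TensorProduct.tmul_add, TensorProduct.add_tmul, map_add, ha, hb]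
    | tmul a c => simp
  exact LinearMap.congr_fun hcomp z

theorem tensorRotate_mem_cotensor (M : RightComodule R D) (N : LeftComodule R D)
    (z : (W ⊗[R] M.carrier) ⊗[R] N.carrier) :
    tensorRotate R W M.carrier N.carrier z ∈ cotensor M (N.tensor W) ↔
      z ∈ cotensor (M.tensor W) N := by
  have hinj : Function.Injective
      ((TensorProduct.assoc R D N.carrier W).toLinearMap.lTensor M.carrier) :=
    (LinearEquiv.lTensor M.carrier (TensorProduct.assoc R D N.carrier W)).injective
  rw [cotensor, cotensor, LinearMap.mem_ker, LinearMap.mem_ker, cotensorMap_tensorRotate,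
    map_eq_zero_iff _ hinj, LinearEquiv.map_eq_zero_iff]

end Rotation

namespace LeftComodule

variable {M N : LeftComodule R D}

theorem mono_of_injective (f : M ⟶ N) (hf : Function.Injective f.hom) : Mono f where
  right_cancellation _ _ h :=
    hom_ext (LinearMap.cancel_left hf |>.1 (congrArg Hom.hom h))

theorem epi_of_surjective (f : M ⟶ N) (hf : Function.Surjective f.hom) : Epi f where
  left_cancellation _ _ h :=
    hom_ext (LinearMap.cancel_right hf |>.1 (congrArg Hom.hom h))

end LeftComodule

namespace RightComodule.IsCohom

section Coevaluation

variable {X : RightComodule R D} {Y : Type u} [AddCommGroup Y] [Module R Y]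

theorem lTensor_coact_comp (δ : (Bicomodule.regular R D).right ⟶ X.tensor Y) :
    X.coact.lTensor Y ∘ₗ δ.hom = (TensorProduct.assoc R Y X.carrier D).toLinearMap ∘ₗ
      δ.hom.rTensor D ∘ₗ Coalgebra.comul (R := R) :=
  LinearMap.ext fun d => (LinearEquiv.symm_apply_eq _).1 (colinear_apply δ d)

/-- The map `N → D ⊗ N → (Y ⊗ X) ⊗ N → Y ⊗ (X ⊗ N)`, whose values lie in `Y ⊗ (X □ N)` when `Y`
is flat. -/
noncomputable def coevalTensor (δ : (Bicomodule.regular R D).right ⟶ X.tensor Y)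
    (N : LeftComodule R D) : N.carrier →ₗ[R] Y ⊗[R] (X.carrier ⊗[R] N.carrier) :=
  (TensorProduct.assoc R Y X.carrier N.carrier).toLinearMap ∘ₗ
    (δ.hom : D →ₗ[R] Y ⊗[R] X.carrier).rTensor N.carrier ∘ₗ N.coact

theorem coevalTensor_apply (δ : (Bicomodule.regular R D).right ⟶ X.tensor Y)
    (N : LeftComodule R D) (n : N.carrier) :
    coevalTensor δ N n = TensorProduct.assoc R Y X.carrier N.carrier
      ((δ.hom : D →ₗ[R] Y ⊗[R] X.carrier).rTensor N.carrier (N.coact n)) := rfl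

theorem lTensor_cotensorMap_coevalTensor (δ : (Bicomodule.regular R D).right ⟶ X.tensor Y)
    (N : LeftComodule R D) (n : N.carrier) :
    (cotensorMap X N).lTensor Y (coevalTensor δ N n) = 0 := by
  rw [cotensorMap, LinearMap.lTensor_sub, LinearMap.sub_apply, sub_eq_zero,
    LinearMap.lTensor_comp_apply, coevalTensor_apply, ← assoc_lTensor_rTensor,
    ← LinearMap.rTensor_comp_apply N.carrier (X.coact.lTensor Y), lTensor_coact_comp,
    LinearMap.rTensor_comp_apply, LinearMap.rTensor_comp_apply, lTensor_assoc_assoc_rTensor_assoc,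
    assoc_rTensor_rTensor, N.coassoc_apply, ← assoc_lTensor, lTensor_rTensor_comm]

theorem coevalTensor_naturality (δ : (Bicomodule.regular R D).right ⟶ X.tensor Y)
    {N N' : LeftComodule R D} (f : N ⟶ N') (n : N.carrier) :
    coevalTensor δ N' (f.hom n) = (f.hom.lTensor X.carrier).lTensor Y (coevalTensor δ N n) := by
  rw [coevalTensor_apply, coevalTensor_apply, LeftComodule.colinear_apply, ← assoc_lTensor,
    lTensor_rTensor_comm]

theorem leftCoact_coevalTensor {δ : (Bicomodule.regular R D).right ⟶ X.tensor Y} (hδ : IsCohom δ)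
    (N : LeftComodule R D) (n : N.carrier) :
    TensorProduct.assoc R D Y (X.carrier ⊗[R] N.carrier)
      (hδ.leftCoact.rTensor (X.carrier ⊗[R] N.carrier) (coevalTensor δ N n)) =
    (coevalTensor δ N).lTensor D (N.coact n) := by
  rw [coevalTensor_apply, ← assoc_rTensor_rTensor,
    ← LinearMap.rTensor_comp_apply N.carrier (hδ.leftCoact.rTensor X.carrier), hδ.leftCoact_comp,
    LinearMap.rTensor_comp_apply, LinearMap.rTensor_comp_apply, assoc_assoc_rTensor_assoc_symm,
    assoc_lTensor_rTensor, N.coassoc_apply, coevalTensor, LinearMap.lTensor_comp_apply,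
    LinearMap.lTensor_comp_apply]

variable [Module.Flat R Y]

theorem lTensor_subtype_cotensor_injective (X : RightComodule R D) (Y : Type u) [AddCommGroup Y]
    [Module R Y] [Module.Flat R Y] (N : LeftComodule R D) :
    Function.Injective ((cotensor X N).subtype.lTensor Y) :=
  Module.Flat.lTensor_preserves_injective_linearMap _ (Submodule.injective_subtype _)

/-- The coevaluation `N → Y ⊗ (X □ N)`. -/
noncomputable def coeval (δ : (Bicomodule.regular R D).right ⟶ X.tensor Y)
    (N : LeftComodule R D) : N.carrier →ₗ[R] Y ⊗[R] cotensor X N :=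
  (coevalTensor δ N).codRestrictOfInjective ((cotensor X N).subtype.lTensor Y)
    (lTensor_subtype_cotensor_injective X Y N) fun n =>
      (Module.Flat.lTensor_exact Y (LinearMap.exact_subtype_ker_map (cotensorMap X N)) _).1
        (lTensor_cotensorMap_coevalTensor δ N n)

theorem subtype_comp_coeval (δ : (Bicomodule.regular R D).right ⟶ X.tensor Y)
    (N : LeftComodule R D) :
    (cotensor X N).subtype.lTensor Y ∘ₗ coeval δ N = coevalTensor δ N :=
  LinearMap.codRestrictOfInjective_comp ..

theorem subtype_coeval (δ : (Bicomodule.regular R D).right ⟶ X.tensor Y)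
    (N : LeftComodule R D) (n : N.carrier) :
    (cotensor X N).subtype.lTensor Y (coeval δ N n) = coevalTensor δ N n :=
  LinearMap.congr_fun (subtype_comp_coeval δ N) n

theorem coeval_naturality (δ : (Bicomodule.regular R D).right ⟶ X.tensor Y)
    {N N' : LeftComodule R D} (f : N ⟶ N') (n : N.carrier) :
    coeval δ N' (f.hom n) = (X.cotensorFunctor.map f).hom.lTensor Y (coeval δ N n) := by
  let k : cotensor X N →ₗ[R] cotensor X N' := (X.cotensorFunctor.map f).hom
  have hk : (cotensor X N').subtype ∘ₗ k = f.hom.lTensor X.carrier ∘ₗ (cotensor X N).subtype := rfl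
  apply lTensor_subtype_cotensor_injective X Y N'
  rw [subtype_coeval, coevalTensor_naturality, ← subtype_coeval, ← LinearMap.lTensor_comp_apply,
    ← hk]
  exact LinearMap.lTensor_comp_apply _ _ _ _

/-- The coevaluation `N → Y ⊗ (X □ N)` as a map of left comodules. -/
noncomputable def coevalHom {δ : (Bicomodule.regular R D).right ⟶ X.tensor Y} [Module.Flat R D]
    (hδ : IsCohom δ) (N : LeftComodule R D) : N ⟶ hδ.leftComodule.tensor (cotensor X N) where
  hom := coeval δ N
  colinear := by
    have hinj : Function.Injective (((cotensor X N).subtype.lTensor Y).lTensor D) :=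
      Module.Flat.lTensor_preserves_injective_linearMap _
        (lTensor_subtype_cotensor_injective X Y N)
    refine LinearMap.ext fun n => hinj ?_
    change ((cotensor X N).subtype.lTensor Y).lTensor D (TensorProduct.assoc R D Y
      (cotensor X N) (hδ.leftCoact.rTensor (cotensor X N) (coeval δ N n))) =
      ((cotensor X N).subtype.lTensor Y).lTensor D ((coeval δ N).lTensor D (N.coact n))
    rw [← LinearMap.lTensor_comp_apply, ← assoc_lTensor, lTensor_rTensor_comm, subtype_coeval,
      subtype_comp_coeval, leftCoact_coevalTensor]

end Coevaluation

section Copairing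

variable {X : Bicomodule R C D} {Y : Type u} [AddCommGroup Y] [Module R Y]
  {δ : (Bicomodule.regular R D).right ⟶ X.right.tensor Y} (hC : IsCohom X.lcoactHom)

section

variable (δ)

/-- The map `C = h(X, X) → X ⊗ h(X, D)`. -/
noncomputable def copairing : C →ₗ[R] X.carrier ⊗[R] Y := hC.toCotensor δ

theorem copairing_comp :
    (hC.copairing δ).rTensor X.carrier ∘ₗ X.lcoact =
      (TensorProduct.assoc R X.carrier Y X.carrier).symm.toLinearMap ∘ₗ
        δ.hom.lTensor X.carrier ∘ₗ X.rcoact :=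
  LinearMap.ext hC.toCotensor_apply

theorem toCotensor_tensor (W : Type u) [AddCommGroup W] [Module R W] :
    (hC.tensor W).toCotensor δ = (TensorProduct.assoc R W X.carrier Y).symm.toLinearMap ∘ₗ
      (hC.copairing δ).lTensor W := by
  symm
  apply (hC.tensor W).eq_map
  intro (z : W ⊗[R] X.carrier)
  change ((TensorProduct.assoc R W X.carrier Y).symm.toLinearMap ∘ₗ
    (hC.copairing δ).lTensor W).rTensor X.carrier
      ((TensorProduct.assoc R W C X.carrier).symm (X.lcoact.lTensor W z)) =
    (TensorProduct.assoc R (W ⊗[R] X.carrier) Y X.carrier).symm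
      (δ.hom.lTensor (W ⊗[R] X.carrier) ((TensorProduct.assoc R W X.carrier D).symm
        (X.rcoact.lTensor W z)))
  rw [LinearMap.rTensor_comp_apply, ← assoc_symm_lTensor_rTensor, ← LinearMap.lTensor_comp_apply,
    copairing_comp, LinearMap.lTensor_comp_apply, LinearMap.lTensor_comp_apply,
    rTensor_assoc_symm_assoc_symm, assoc_symm_lTensor_lTensor]

/-- The map `C ⊗ W → (X ⊗ Y) ⊗ W → X ⊗ (Y ⊗ W)`. -/
noncomputable def copairingTensor (W : Type u) [AddCommGroup W] [Module R W] :
    C ⊗[R] W →ₗ[R] X.carrier ⊗[R] (Y ⊗[R] W) :=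
  (TensorProduct.assoc R X.carrier Y W).toLinearMap ∘ₗ (hC.copairing δ).rTensor W

theorem copairingTensor_eq (W : Type u) [AddCommGroup W] [Module R W] :
    hC.copairingTensor δ W = (tensorRotate R W X.carrier Y).toLinearMap ∘ₗ
      (hC.tensor W).toCotensor δ ∘ₗ (TensorProduct.comm R C W).toLinearMap := by
  rw [toCotensor_tensor δ hC]
  refine TensorProduct.ext' fun c w => ?_
  simp [copairingTensor, tensorRotate]

theorem copairingTensor_naturality {W W' : Type u} [AddCommGroup W] [Module R W]
    [AddCommGroup W'] [Module R W'] (f : W →ₗ[R] W') (t : C ⊗[R] W) :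
    hC.copairingTensor δ W' (f.lTensor C t) =
      (f.lTensor Y).lTensor X.carrier (hC.copairingTensor δ W t) := by
  change TensorProduct.assoc R X.carrier Y W' ((hC.copairing δ).rTensor W' (f.lTensor C t)) =
    (f.lTensor Y).lTensor X.carrier
      (TensorProduct.assoc R X.carrier Y W ((hC.copairing δ).rTensor W t))
  rw [← assoc_lTensor, lTensor_rTensor_comm]

theorem copairingTensor_assoc_lcoact (N : LeftComodule R D)
    {z : X.carrier ⊗[R] N.carrier} (hz : z ∈ cotensor X.right N) :
    hC.copairingTensor δ (X.carrier ⊗[R] N.carrier)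
        (TensorProduct.assoc R C X.carrier N.carrier (X.lcoact.rTensor N.carrier z)) =
      (coevalTensor δ N).lTensor X.carrier z := by
  change TensorProduct.assoc R X.carrier Y (X.carrier ⊗[R] N.carrier)
    ((hC.copairing δ).rTensor (X.carrier ⊗[R] N.carrier)
      (TensorProduct.assoc R C X.carrier N.carrier (X.lcoact.rTensor N.carrier z))) = _
  rw [← assoc_rTensor_rTensor, ← LinearMap.rTensor_comp_apply N.carrier
      ((hC.copairing δ).rTensor X.carrier), copairing_comp, LinearMap.rTensor_comp_apply,
    LinearMap.rTensor_comp_apply, assoc_assoc_rTensor_assoc_symm, assoc_lTensor_rTensor,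
    mem_cotensor.1 hz, coevalTensor, LinearMap.lTensor_comp_apply, LinearMap.lTensor_comp_apply]

end

section

variable (hδ : IsCohom δ)

theorem lTensor_copairing_comp :
    (hC.copairing δ).lTensor Y ∘ₗ hδ.coact =
      (TensorProduct.assoc R Y X.carrier Y).toLinearMap ∘ₗ δ.hom.rTensor Y ∘ₗ hδ.leftCoact := by
  apply hδ.hom_ext
  intro (d : D)
  change ((hC.copairing δ).lTensor Y ∘ₗ hδ.coact).rTensor X.carrier (δ.hom d) =
    ((TensorProduct.assoc R Y X.carrier Y).toLinearMap ∘ₗ δ.hom.rTensor Y ∘ₗ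
      hδ.leftCoact).rTensor X.carrier (δ.hom d)
  have hcoact : X.rcoact.lTensor Y (δ.hom d) = TensorProduct.assoc R Y X.carrier D
      (δ.hom.rTensor D (Coalgebra.comul (R := R) d)) :=
    LinearMap.congr_fun (lTensor_coact_comp δ) d
  rw [LinearMap.rTensor_comp_apply, LinearMap.rTensor_comp_apply, LinearMap.rTensor_comp_apply,
    hδ.coact_apply, hδ.leftCoact_apply, ← assoc_symm_lTensor_rTensor,
    ← LinearMap.lTensor_comp_apply, copairing_comp, LinearMap.lTensor_comp_apply,
    LinearMap.lTensor_comp_apply, hcoact, ← assoc_lTensor, ← assoc_symm_rTensor,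
    ← lTensor_rTensor_comm, rTensor_assoc_assoc_symm]

theorem copairingTensor_injective (hδ : IsCohom δ) (hX : X.right.IsInjector) (W : Type u)
    [AddCommGroup W] [Module R W] : Function.Injective (hC.copairingTensor δ W) := by
  rw [copairingTensor_eq]
  exact (tensorRotate R W X.carrier Y).injective.comp
    ((toCotensor_injective hX hδ (hC.tensor W)).comp (TensorProduct.comm R C W).injective)

theorem range_copairingTensor (hX : X.right.IsInjector) [X.right.IsQuasiFinite] (W : Type u)
    [AddCommGroup W] [Module R W] : LinearMap.range (hC.copairingTensor δ W) =
      cotensor X.right (hδ.leftComodule.tensor W) := by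
  ext z
  obtain ⟨y, rfl⟩ := (tensorRotate R W X.carrier Y).surjective z
  refine Iff.trans ?_ (tensorRotate_mem_cotensor X.right hδ.leftComodule y).symm
  rw [← range_toCotensor hX hδ (hC.tensor W), copairingTensor_eq, LinearMap.range_comp,
    LinearMap.range_comp_of_range_eq_top _ (LinearEquiv.range _), Submodule.mem_map_equiv,
    LinearEquiv.symm_apply_apply]

variable (hX : X.right.IsInjector) [X.right.IsQuasiFinite] (W : Type u) [AddCommGroup W]
  [Module R W]

/-- The isomorphism `C ⊗ W → X □ (Y ⊗ W)`. -/
noncomputable def cotensorEquiv :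
    C ⊗[R] W ≃ₗ[R] cotensor X.right (hδ.leftComodule.tensor W) :=
  LinearEquiv.ofInjective _ (hC.copairingTensor_injective hδ hX W) ≪≫ₗ
    LinearEquiv.ofEq _ _ (hC.range_copairingTensor hδ hX W)

theorem copairingTensor_comp_cotensorEquiv_symm :
    hC.copairingTensor δ W ∘ₗ (hC.cotensorEquiv hδ hX W).symm.toLinearMap =
      (cotensor X.right (hδ.leftComodule.tensor W)).subtype := by
  refine LinearMap.ext fun z => ?_
  exact congrArg Subtype.val ((hC.cotensorEquiv hδ hX W).apply_symm_apply z)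

/-- The evaluation `X □ (Y ⊗ W) → W` induced by the counit of `C`. -/
noncomputable def cotensorEval : cotensor X.right (hδ.leftComodule.tensor W) →ₗ[R] W :=
  (TensorProduct.lid R W).toLinearMap ∘ₗ (Coalgebra.counit (R := R) (A := C)).rTensor W ∘ₗ
    (hC.cotensorEquiv hδ hX W).symm.toLinearMap

theorem cotensorEval_cotensorEquiv (t : C ⊗[R] W) :
    hC.cotensorEval hδ hX W (hC.cotensorEquiv hδ hX W t) =
      TensorProduct.lid R W ((Coalgebra.counit (R := R) (A := C)).rTensor W t) :=
  congrArg (fun t => TensorProduct.lid R W ((Coalgebra.counit (R := R) (A := C)).rTensor W t))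
    ((hC.cotensorEquiv hδ hX W).symm_apply_apply t)

variable {W} in
theorem cotensorEval_naturality {W' : Type u} [AddCommGroup W'] [Module R W'] (f : W →ₗ[R] W')
    (z : cotensor X.right (hδ.leftComodule.tensor W)) :
    hC.cotensorEval hδ hX W' ((X.right.cotensorFunctor.map
        (hδ.leftComodule.tensorFunctor.map (ModuleCat.ofHom f))).hom z) =
      f (hC.cotensorEval hδ hX W z) := by
  obtain ⟨t, rfl⟩ := (hC.cotensorEquiv hδ hX W).surjective z
  have hmap : (X.right.cotensorFunctor.map (hδ.leftComodule.tensorFunctor.map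
      (ModuleCat.ofHom f))).hom (hC.cotensorEquiv hδ hX W t) =
      hC.cotensorEquiv hδ hX W' (f.lTensor C t) :=
    Subtype.ext (hC.copairingTensor_naturality δ f t).symm
  rw [hmap, cotensorEval_cotensorEquiv, cotensorEval_cotensorEquiv, ← lTensor_rTensor_comm,
    lid_lTensor]

variable [Module.Flat R Y]

theorem lTensor_cotensorEquiv_symm_coeval (s : Y ⊗[R] W) :
    (hC.cotensorEquiv hδ hX W).symm.toLinearMap.lTensor Y
      (coeval δ (hδ.leftComodule.tensor W) s) =
      TensorProduct.assoc R Y C W (hδ.coact.rTensor W s) := by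
  have hinj : Function.Injective ((hC.copairingTensor δ W).lTensor Y) :=
    Module.Flat.lTensor_preserves_injective_linearMap _ (hC.copairingTensor_injective hδ hX W)
  apply hinj
  rw [← LinearMap.lTensor_comp_apply, copairingTensor_comp_cotensorEquiv_symm, copairingTensor,
    LinearMap.lTensor_comp_apply, ← assoc_lTensor_rTensor, ← LinearMap.rTensor_comp_apply,
    lTensor_copairing_comp, LinearMap.rTensor_comp_apply, LinearMap.rTensor_comp_apply,
    lTensor_assoc_assoc_rTensor_assoc]
  refine (subtype_coeval δ (hδ.leftComodule.tensor W) s).trans ?_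
  change TensorProduct.assoc R Y X.carrier (Y ⊗[R] W)
    ((δ.hom : D →ₗ[R] Y ⊗[R] X.carrier).rTensor (Y ⊗[R] W)
      (TensorProduct.assoc R D Y W (hδ.leftCoact.rTensor W s))) = _
  rw [← assoc_rTensor_rTensor]

theorem lTensor_cotensorEval_coeval (s : Y ⊗[R] W) :
    (hC.cotensorEval hδ hX W).lTensor Y (coeval δ (hδ.leftComodule.tensor W) s) = s := by
  have hcounit : (Coalgebra.counit (R := R) (A := C)).lTensor Y ∘ₗ hδ.coact =
    (TensorProduct.mk R Y R).flip 1 := hδ.comodule.counit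
  rw [cotensorEval, LinearMap.lTensor_comp_apply, LinearMap.lTensor_comp_apply,
    lTensor_cotensorEquiv_symm_coeval, ← assoc_lTensor_rTensor, ← LinearMap.rTensor_comp_apply,
    hcounit, lTensor_lid_assoc_rTensor_mk_one]

end

section Adjunction

variable (hδ : IsCohom δ) (hX : X.right.IsInjector) [X.right.IsQuasiFinite] [Module.Flat R Y]
  [Module.Flat R D]

theorem lTensor_subtype_cotensorEquiv_symm_map_coevalHom (N : LeftComodule R D)
    (z : cotensor X.right N) :
    (cotensor X.right N).subtype.lTensor C ((hC.cotensorEquiv hδ hX (cotensor X.right N)).symm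
        ((X.right.cotensorFunctor.map (hδ.coevalHom N)).hom z)) =
      TensorProduct.assoc R C X.carrier N.carrier (X.lcoact.rTensor N.carrier z.1) := by
  apply hC.copairingTensor_injective hδ hX
  rw [copairingTensor_naturality, hC.copairingTensor_assoc_lcoact δ N z.2, ← subtype_comp_coeval,
    LinearMap.lTensor_comp_apply]
  refine congrArg _ (LinearMap.congr_fun (hC.copairingTensor_comp_cotensorEquiv_symm hδ hX _) _)

theorem cotensorEval_map_coevalHom (N : LeftComodule R D) (z : cotensor X.right N) :
    hC.cotensorEval hδ hX (cotensor X.right N)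
      ((X.right.cotensorFunctor.map (hδ.coevalHom N)).hom z) = z := by
  apply Subtype.ext
  change (cotensor X.right N).subtype (TensorProduct.lid R _
    ((Coalgebra.counit (R := R) (A := C)).rTensor _ ((hC.cotensorEquiv hδ hX _).symm _))) = _
  rw [← lid_lTensor, lTensor_rTensor_comm, lTensor_subtype_cotensorEquiv_symm_map_coevalHom,
    ← assoc_rTensor_rTensor, ← LinearMap.rTensor_comp_apply, X.lcounit, lid_assoc_rTensor_mk_one]

/-- The functor `X □ -` is left adjoint to `Y ⊗ -`, for `Y = h(X, D)`. -/
noncomputable def cotensorAdj : X.right.cotensorFunctor ⊣ hδ.leftComodule.tensorFunctor :=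
  Adjunction.mkOfUnitCounit
    { unit :=
        { app := fun N => hδ.coevalHom N
          naturality := fun _ _ f =>
            LeftComodule.hom_ext (LinearMap.ext (coeval_naturality δ f)) }
      counit :=
        { app := fun W => ModuleCat.ofHom (hC.cotensorEval hδ hX W)
          naturality := fun _ _ f => ModuleCat.hom_ext
            (LinearMap.ext (hC.cotensorEval_naturality hδ hX f.hom)) }
      left_triangle := by
        ext N z
        exact hC.cotensorEval_map_coevalHom hδ hX N z
      right_triangle := by
        ext W s
        exact hC.lTensor_cotensorEval_coeval hδ hX W s }

end Adjunction

end Copairing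

end RightComodule.IsCohom

/-! ### Co-opposite coalgebras -/

section Reverse

variable {C C' M : Type u} [AddCommGroup C] [Module R C] [AddCommGroup C'] [Module R C']
  [AddCommGroup M] [Module R M]

/-- The isomorphism `C ⊗ M ≃ M ⊗ C'` that swaps the factors and applies `σ : C ≃ C'`. -/
noncomputable def flipTensor (σ : C ≃ₗ[R] C') (M : Type u) [AddCommGroup M] [Module R M] :
    C ⊗[R] M ≃ₗ[R] M ⊗[R] C' :=
  TensorProduct.comm R C M ≪≫ₗ LinearEquiv.lTensor M σ

@[simp]
theorem flipTensor_tmul (σ : C ≃ₗ[R] C') (c : C) (m : M) :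
    flipTensor σ M (c ⊗ₜ m) = m ⊗ₜ σ c := rfl

theorem flipTensor_naturality (σ : C ≃ₗ[R] C') {N : Type u} [AddCommGroup N] [Module R N]
    (f : M →ₗ[R] N) (z : C ⊗[R] M) :
    flipTensor σ N (f.lTensor C z) = f.rTensor C' (flipTensor σ M z) := by
  induction z with
  | zero => simp only [map_zero]
  | add a b ha hb => simp only [map_add, ha, hb]
  | tmul c m => simp only [LinearMap.lTensor_tmul, flipTensor_tmul, LinearMap.rTensor_tmul]

/-- The isomorphism `C ⊗ (C ⊗ M) ≃ M ⊗ (C' ⊗ C')` that reverses the order of the factors and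
applies `σ : C ≃ C'` twice. -/
noncomputable def flipTensor₂ (σ : C ≃ₗ[R] C') (M : Type u) [AddCommGroup M] [Module R M] :
    C ⊗[R] (C ⊗[R] M) ≃ₗ[R] M ⊗[R] (C' ⊗[R] C') :=
  flipTensor σ (C ⊗[R] M) ≪≫ₗ LinearEquiv.rTensor C' (flipTensor σ M) ≪≫ₗ
    TensorProduct.assoc R M C' C'

@[simp]
theorem flipTensor₂_tmul (σ : C ≃ₗ[R] C') (c d : C) (m : M) :
    flipTensor₂ σ M (c ⊗ₜ (d ⊗ₜ m)) = m ⊗ₜ (σ d ⊗ₜ σ c) := rfl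

theorem flipTensor₂_lTensor (σ : C ≃ₗ[R] C') (l : M →ₗ[R] C ⊗[R] M) (z : C ⊗[R] M) :
    flipTensor₂ σ M (l.lTensor C z) = TensorProduct.assoc R M C' C'
      (((flipTensor σ M).toLinearMap ∘ₗ l).rTensor C' (flipTensor σ M z)) := by
  induction z with
  | zero => simp only [map_zero]
  | add a b ha hb => simp only [map_add, ha, hb]
  | tmul c m => rfl

theorem flipTensor₂_assoc (σ : C ≃ₗ[R] C') (Δ : C →ₗ[R] C ⊗[R] C) (Δ' : C' →ₗ[R] C' ⊗[R] C')
    (h : ∀ c, Δ' (σ c) =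
      TensorProduct.map σ.toLinearMap σ.toLinearMap (TensorProduct.comm R C C (Δ c)))
    (z : C ⊗[R] M) : flipTensor₂ σ M (TensorProduct.assoc R C C M (Δ.rTensor M z)) =
      Δ'.lTensor M (flipTensor σ M z) := by
  induction z with
  | zero => simp only [map_zero]
  | add a b ha hb => simp only [map_add, ha, hb]
  | tmul c m =>
    rw [flipTensor_tmul, LinearMap.lTensor_tmul, h, LinearMap.rTensor_tmul]
    induction Δ c with
    | zero => simp
    | add a b ha hb => simp only [TensorProduct.add_tmul, TensorProduct.tmul_add, map_add, ha, hb]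
    | tmul a b => simp

end Reverse

/-- A linear isomorphism between coalgebras that reverses the comultiplication: it identifies
`C'` with the co-opposite coalgebra of `C`. -/
structure IsAntiEquiv {C' : Type u} [AddCommGroup C'] [Module R C'] [Coalgebra R C']
    (σ : C ≃ₗ[R] C') : Prop where
  comul : ∀ c, Coalgebra.comul (R := R) (σ c) =
    TensorProduct.map σ.toLinearMap σ.toLinearMap
      (TensorProduct.comm R C C (Coalgebra.comul (R := R) c))
  counit : ∀ c, Coalgebra.counit (R := R) (σ c) = Coalgebra.counit (R := R) c

theorem IsAntiEquiv.symm {C' : Type u} [AddCommGroup C'] [Module R C'] [Coalgebra R C']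
    {σ : C ≃ₗ[R] C'} (h : IsAntiEquiv σ) : IsAntiEquiv σ.symm where
  comul c := by
    obtain ⟨c, rfl⟩ := σ.surjective c
    rw [h.comul, LinearEquiv.symm_apply_apply, ← TensorProduct.map_comm, TensorProduct.comm_comm,
      TensorProduct.map_map]
    simp
  counit c := by
    rw [← h.counit, LinearEquiv.apply_symm_apply]

/-- The opposite comultiplication on `C`. -/
noncomputable def coopComul (R C : Type u) [CommRing R] [AddCommGroup C] [Module R C]
    [Coalgebra R C] : C →ₗ[R] C ⊗[R] C :=
  (TensorProduct.comm R C C).toLinearMap ∘ₗ Coalgebra.comul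

theorem coopComul_coassoc (c : C) :
    TensorProduct.assoc R C C C ((coopComul R C).rTensor C (coopComul R C c)) =
      (coopComul R C).lTensor C (coopComul R C c) := by
  have flip_refl (z : C ⊗[R] C) :
      flipTensor (LinearEquiv.refl R C) C z = TensorProduct.comm R C C z := by
    simp [flipTensor]
  have reverse_lTensor := flipTensor₂_lTensor (LinearEquiv.refl R C) Coalgebra.comul
    (Coalgebra.comul (R := R) c)
  have reverse_rTensor := flipTensor₂_assoc (LinearEquiv.refl R C) Coalgebra.comul
    (coopComul R C) (fun c => by simp [coopComul]) (Coalgebra.comul (R := R) c)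
  rw [Coalgebra.coassoc_apply, reverse_lTensor, flip_refl] at reverse_rTensor
  rwa [show (flipTensor (LinearEquiv.refl R C) C).toLinearMap =
    (TensorProduct.comm R C C).toLinearMap from LinearMap.ext flip_refl] at reverse_rTensor

theorem counit_rTensor_coopComul (c : C) :
    (Coalgebra.counit (R := R) (A := C)).rTensor C (coopComul R C c) = 1 ⊗ₜ c := by
  rw [coopComul, LinearMap.comp_apply, LinearEquiv.coe_coe, LinearMap.rTensor_comm,
    Coalgebra.lTensor_counit_comul, TensorProduct.comm_tmul]

theorem counit_lTensor_coopComul (c : C) :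
    (Coalgebra.counit (R := R) (A := C)).lTensor C (coopComul R C c) = c ⊗ₜ 1 := by
  rw [coopComul, LinearMap.comp_apply, LinearEquiv.coe_coe, LinearMap.lTensor_comm,
    Coalgebra.rTensor_counit_comul, TensorProduct.comm_tmul]

/-- The co-opposite coalgebra of `C`, as a type synonym. -/
def Cop (C : Type u) : Type u := C

namespace Cop

instance : AddCommGroup (Cop C) := inferInstanceAs (AddCommGroup C)

instance : Module R (Cop C) := inferInstanceAs (Module R C)

instance [Module.Flat R C] : Module.Flat R (Cop C) := inferInstanceAs (Module.Flat R C)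

/-- The identity map from `C` to its co-opposite coalgebra. -/
def equiv (R : Type u) [CommRing R] (C : Type u) [AddCommGroup C] [Module R C] :
    C ≃ₗ[R] Cop C := LinearEquiv.refl R C

noncomputable instance : Coalgebra R (Cop C) where
  comul := coopComul R C
  counit := Coalgebra.counit (R := R) (A := C)
  coassoc := LinearMap.ext (coopComul_coassoc (R := R) (C := C))
  rTensor_counit_comp_comul := LinearMap.ext (counit_rTensor_coopComul (R := R) (C := C))
  lTensor_counit_comp_comul := LinearMap.ext (counit_lTensor_coopComul (R := R) (C := C))

theorem isAntiEquiv (R : Type u) [CommRing R] (C : Type u) [AddCommGroup C] [Module R C]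
    [Coalgebra R C] : IsAntiEquiv (equiv R C) where
  comul c := by
    have : (equiv R C).toLinearMap = LinearMap.id (R := R) (M := C) := rfl
    exact (LinearMap.congr_fun (TensorProduct.map_id (R := R) (M := C) (N := C)) _).symm
  counit _ := rfl

end Cop

section Flip

variable {C' : Type u} [AddCommGroup C'] [Module R C'] [Coalgebra R C'] {σ : C ≃ₗ[R] C'}

theorem flipTensor_counit (hσ : IsAntiEquiv σ) {M : Type u} [AddCommGroup M] [Module R M]
    (z : C ⊗[R] M) : (Coalgebra.counit (R := R) (A := C')).lTensor M (flipTensor σ M z) =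
      TensorProduct.comm R R M ((Coalgebra.counit (R := R) (A := C)).rTensor M z) := by
  induction z with
  | zero => simp only [map_zero]
  | add a b ha hb => simp only [map_add, ha, hb]
  | tmul c m => simp [hσ.counit]

/-- The left `C`-comodule given by a right `C'`-comodule, for `C'` opposite to `C`. -/
noncomputable abbrev RightComodule.unflip (hσ : IsAntiEquiv σ) (N : RightComodule R C') :
    LeftComodule R C where
  carrier := N.carrier
  coact := (flipTensor σ N.carrier).symm.toLinearMap ∘ₗ N.coact
  coassoc := by
    have flip_coact (n : N.carrier) :
        flipTensor σ N.carrier ((flipTensor σ N.carrier).symm (N.coact n)) = N.coact n :=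
      LinearEquiv.apply_symm_apply _ _
    ext n
    apply (flipTensor₂ σ N.carrier).injective
    refine (flipTensor₂_assoc σ _ _ hσ.comul _).trans ?_
    refine Eq.trans ?_ (flipTensor₂_lTensor σ _ _).symm
    rw [show (flipTensor σ N.carrier).toLinearMap ∘ₗ (flipTensor σ N.carrier).symm.toLinearMap ∘ₗ
      N.coact = N.coact from LinearMap.ext flip_coact, LinearMap.comp_apply, LinearEquiv.coe_coe,
      flip_coact, RightComodule.coassoc_apply]
  counit := by
    ext n
    have h := flipTensor_counit hσ ((flipTensor σ N.carrier).symm (N.coact n))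
    rw [LinearEquiv.apply_symm_apply, RightComodule.counit_apply] at h
    exact (TensorProduct.comm R R N.carrier).injective h.symm

namespace LeftComodule

/-- The right `C'`-comodule given by a left `C`-comodule, for `C'` opposite to `C`. -/
noncomputable abbrev flip (hσ : IsAntiEquiv σ) (M : LeftComodule R C) : RightComodule R C' where
  carrier := M.carrier
  coact := (flipTensor σ M.carrier).toLinearMap ∘ₗ M.coact
  coassoc := by
    ext m
    refine (flipTensor₂_lTensor σ M.coact (M.coact m)).symm.trans ?_
    rw [← M.coassoc_apply]
    exact flipTensor₂_assoc σ _ _ hσ.comul _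
  counit := by
    ext m
    refine (flipTensor_counit hσ (M.coact m)).trans ?_
    rw [counit_apply]
    rfl

/-- The functor from left `C`-comodules to right `C'`-comodules, for `C'` opposite to `C`. -/
noncomputable abbrev flipFunctor (hσ : IsAntiEquiv σ) :
    LeftComodule R C ⥤ RightComodule R C' where
  obj M := M.flip hσ
  map {M N} f := ⟨f.hom, by
    ext m
    change flipTensor σ N.carrier (N.coact (f.hom m)) =
      f.hom.rTensor C' (flipTensor σ M.carrier (M.coact m))
    rw [colinear_apply, flipTensor_naturality]⟩

section

variable (hσ : IsAntiEquiv σ)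

instance : (flipFunctor hσ).Additive where

instance : (flipFunctor hσ).Linear R where

instance : (flipFunctor hσ).Faithful where
  map_injective h := hom_ext (congrArg RightComodule.Hom.hom h)

instance : (flipFunctor hσ).Full where
  map_surjective {M N} f := ⟨⟨f.hom, by
    ext m
    apply (flipTensor σ N.carrier).injective
    refine (RightComodule.colinear_apply f m).trans ?_
    exact (flipTensor_naturality σ f.hom _).symm⟩, rfl⟩

instance : (flipFunctor hσ).EssSurj where
  mem_essImage N := ⟨N.unflip hσ, ⟨by
    let f : (N.unflip hσ).flip hσ ⟶ N := ⟨LinearMap.id, by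
      ext n
      rw [LinearMap.rTensor_id]
      exact (LinearEquiv.apply_symm_apply (flipTensor σ N.carrier) _).symm⟩
    have : IsIso f := RightComodule.isIso_of_bijective f Function.bijective_id
    exact asIso f⟩⟩

instance : (flipFunctor hσ).IsEquivalence where

end

theorem injective_of_mono [Module.Flat R C] {M N : LeftComodule R C} (f : M ⟶ N) [Mono f] :
    Function.Injective f.hom := by
  have := (flipFunctor (Cop.isAntiEquiv R C)).map_mono f
  exact RightComodule.injective_of_mono ((flipFunctor (Cop.isAntiEquiv R C)).map f)

theorem Equivalent.flip (hσ : IsAntiEquiv σ) {D' : Type u} [AddCommGroup D'] [Module R D']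
    [Coalgebra R D'] {τ : D ≃ₗ[R] D'} (hτ : IsAntiEquiv τ) (h : Equivalent R C D) :
    RightComodule.Equivalent R C' D' := by
  obtain ⟨F, hF, hadd, hlin⟩ := h
  have : (flipFunctor hσ).asEquivalence.functor.Additive :=
    inferInstanceAs (flipFunctor hσ).Additive
  have : (flipFunctor hσ).asEquivalence.functor.Linear R :=
    inferInstanceAs ((flipFunctor hσ).Linear R)
  exact ⟨(flipFunctor hσ).asEquivalence.inverse ⋙ F ⋙ flipFunctor hτ, inferInstance,
    inferInstance, inferInstance⟩

theorem Equivalent.of_flip (hσ : IsAntiEquiv σ) {D' : Type u} [AddCommGroup D'] [Module R D']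
    [Coalgebra R D'] {τ : D ≃ₗ[R] D'} (hτ : IsAntiEquiv τ) (h : RightComodule.Equivalent R C' D') :
    Equivalent R C D := by
  obtain ⟨F, hF, hadd, hlin⟩ := h
  have : (flipFunctor hτ).asEquivalence.functor.Additive :=
    inferInstanceAs (flipFunctor hτ).Additive
  have : (flipFunctor hτ).asEquivalence.functor.Linear R :=
    inferInstanceAs ((flipFunctor hτ).Linear R)
  exact ⟨flipFunctor hσ ⋙ F ⋙ (flipFunctor hτ).asEquivalence.inverse, inferInstance,
    inferInstance, inferInstance⟩

end LeftComodule

end Flip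

/-! ### Recognising coendomorphism coalgebras and coflat comodules -/

namespace RightComodule

section

variable {X : RightComodule R D} [X.IsQuasiFinite]

/-- A linear isomorphism `e(X) ≃ C` that turns the coaction of `e(X)` on `X` into a coassociative
and counital coaction `κ` of `C` is an isomorphism of coalgebras. -/
noncomputable def coendCoalgEquiv (e : X.Coend ≃ₗ[R] C) {κ : X.carrier →ₗ[R] C ⊗[R] X.carrier}
    (he : ∀ x, e.toLinearMap.rTensor X.carrier (X.coendCoact x) = κ x)
    (hcomul : ∀ x, (Coalgebra.comul (R := R) (A := C)).rTensor X.carrier (κ x) =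
      (TensorProduct.assoc R C C X.carrier).symm (κ.lTensor C (κ x)))
    (hcounit : ∀ x, (Coalgebra.counit (R := R) (A := C)).rTensor X.carrier (κ x) = 1 ⊗ₜ x) :
    X.Coend ≃ₗc[R] C where
  __ := e
  counit_comp := by
    refine X.coend_hom_ext fun x => ?_
    change (Coalgebra.counit (R := R) (A := C) ∘ₗ e.toLinearMap).rTensor X.carrier _ =
      X.coendCounit.rTensor X.carrier _
    rw [LinearMap.rTensor_comp_apply, he, hcounit, coendCounit_spec]
  map_comp_comul := by
    refine X.coend_hom_ext fun x => ?_
    change (TensorProduct.map e.toLinearMap e.toLinearMap ∘ₗ X.coendComul).rTensor X.carrier _ =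
      (Coalgebra.comul (R := R) (A := C) ∘ₗ e.toLinearMap).rTensor X.carrier _
    rw [LinearMap.rTensor_comp_apply, LinearMap.rTensor_comp_apply, he, hcomul, coendComul_spec,
      ← LinearMap.rTensor_comp_lTensor, LinearMap.rTensor_comp_apply,
      ← assoc_symm_lTensor_rTensor, ← assoc_symm_rTensor, ← LinearMap.lTensor_comp_apply,
      show e.toLinearMap.rTensor X.carrier ∘ₗ X.coendCoact = κ from LinearMap.ext he,
      ← lTensor_rTensor_comm, he]

end

theorem IsCoflat.of_flat [Module.Flat R D] (X : RightComodule R D) [Module.Flat R X.carrier]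
    (h : ∀ ⦃N N' : LeftComodule R D⦄ (g : N ⟶ N'), Function.Surjective g.hom →
      Function.Surjective (X.cotensorFunctor.map g).hom) : X.IsCoflat := by
  intro N₁ N₂ N₃ f g hf hfg hg
  have hfX : Function.Injective (f.hom.lTensor X.carrier) :=
    Module.Flat.lTensor_preserves_injective_linearMap _ hf
  refine ⟨fun a b hab => Subtype.ext (hfX (congrArg Subtype.val hab)), ?_, h g hg⟩
  intro z
  have hexX := Module.Flat.lTensor_exact X.carrier hfg
  constructor
  · intro hz
    obtain ⟨y, hy⟩ := (hexX z.1).1 (congrArg Subtype.val hz)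
    refine ⟨⟨y, ?_⟩, Subtype.ext hy⟩
    have hinj : Function.Injective ((f.hom.lTensor D).lTensor X.carrier) :=
      Module.Flat.lTensor_preserves_injective_linearMap _
        (Module.Flat.lTensor_preserves_injective_linearMap _ hf)
    apply hinj
    rw [← cotensorMap_lTensor, map_zero, hy]
    exact z.2
  · rintro ⟨y, rfl⟩
    exact Subtype.ext (hexX.apply_apply_eq_zero y.1)

end RightComodule

namespace LeftComodule

theorem IsCoflat.of_flat [Module.Flat R D] (Y : LeftComodule R D) [Module.Flat R Y.carrier]
    (h : ∀ ⦃M M' : RightComodule R D⦄ (g : M ⟶ M'), Function.Surjective g.hom →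
      Function.Surjective (Y.cotensorFunctor.map g).hom) : Y.IsCoflat := by
  intro M₁ M₂ M₃ f g hf hfg hg
  have hfY : Function.Injective (f.hom.rTensor Y.carrier) :=
    Module.Flat.rTensor_preserves_injective_linearMap _ hf
  refine ⟨fun a b hab => Subtype.ext (hfY (congrArg Subtype.val hab)), ?_, h g hg⟩
  intro z
  have hexY := Module.Flat.rTensor_exact Y.carrier hfg
  constructor
  · intro hz
    obtain ⟨y, hy⟩ := (hexY z.1).1 (congrArg Subtype.val hz)
    refine ⟨⟨y, ?_⟩, Subtype.ext hy⟩
    have hinj : Function.Injective (f.hom.rTensor (D ⊗[R] Y.carrier)) :=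
      Module.Flat.rTensor_preserves_injective_linearMap _ hf
    apply hinj
    rw [← cotensorMap_rTensor, map_zero, hy]
    exact z.2
  · rintro ⟨y, rfl⟩
    exact Subtype.ext (hexY.apply_apply_eq_zero y.1)

section

variable {Y : LeftComodule R D} [Y.IsQuasiFinite]

/-- The linear isomorphism between `e(Y)` and a module `V` with the universal property of
`e(Y)`. -/
noncomputable def coendLinearEquiv {V : Type u} [AddCommGroup V] [Module R V] {κ : Y ⟶ Y.tensor V}
    (k : V →ₗ[R] Y.Coend) (hk : ∀ x, k.lTensor Y.carrier (κ.hom x) = Y.coendCoact x)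
    (hext : ∀ l : V →ₗ[R] V, (∀ x, l.lTensor Y.carrier (κ.hom x) = κ.hom x) → l = LinearMap.id) :
    Y.Coend ≃ₗ[R] V :=
  have coendLift_apply (x) : (Y.coendLift κ).lTensor Y.carrier (Y.coendCoact x) = κ.hom x :=
    LinearMap.congr_fun (Y.coendLift_spec κ) x
  LinearEquiv.ofLinearMap (Y.coendLift κ) k
    (hext _ fun x => by rw [LinearMap.lTensor_comp_apply, hk, coendLift_apply])
    (Y.coend_hom_ext fun x => by
      rw [LinearMap.lTensor_comp_apply, coendLift_apply, hk, LinearMap.lTensor_id,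
        LinearMap.id_apply])

/-- A linear isomorphism `e(Y) ≃ C` that turns the coaction of `e(Y)` on `Y` into a coassociative
and counital coaction `κ` of `C` is an isomorphism of coalgebras. -/
noncomputable def coendCoalgEquiv (e : Y.Coend ≃ₗ[R] C) {κ : Y.carrier →ₗ[R] Y.carrier ⊗[R] C}
    (he : ∀ y, e.toLinearMap.lTensor Y.carrier (Y.coendCoact y) = κ y)
    (hcomul : ∀ y, (Coalgebra.comul (R := R) (A := C)).lTensor Y.carrier (κ y) =
      TensorProduct.assoc R Y.carrier C C (κ.rTensor C (κ y)))
    (hcounit : ∀ y, (Coalgebra.counit (R := R) (A := C)).lTensor Y.carrier (κ y) = y ⊗ₜ 1) :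
    Y.Coend ≃ₗc[R] C where
  __ := e
  counit_comp := by
    refine Y.coend_hom_ext fun y => ?_
    change (Coalgebra.counit (R := R) (A := C) ∘ₗ e.toLinearMap).lTensor Y.carrier _ =
      Y.coendCounit.lTensor Y.carrier _
    rw [LinearMap.lTensor_comp_apply, he, hcounit, coendCounit_spec]
  map_comp_comul := by
    refine Y.coend_hom_ext fun y => ?_
    change (TensorProduct.map e.toLinearMap e.toLinearMap ∘ₗ Y.coendComul).lTensor Y.carrier _ =
      (Coalgebra.comul (R := R) (A := C) ∘ₗ e.toLinearMap).lTensor Y.carrier _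
    rw [LinearMap.lTensor_comp_apply, LinearMap.lTensor_comp_apply, he, hcomul, coendComul_spec,
      ← LinearMap.lTensor_comp_rTensor, LinearMap.lTensor_comp_apply, ← assoc_lTensor_rTensor,
      ← LinearMap.rTensor_comp_apply,
      show e.toLinearMap.lTensor Y.carrier ∘ₗ Y.coendCoact = κ from LinearMap.ext he,
      ← assoc_lTensor, lTensor_rTensor_comm, he]

end

end LeftComodule

/-! ### From flat cogenerators to Morita–Takeuchi bicomodules -/

theorem LeftComodule.coact_injective (N : LeftComodule R D) : Function.Injective N.coact := by
  intro x y h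
  have e := congrArg (TensorProduct.lid R N.carrier)
    (congrArg ((Coalgebra.counit (R := R) (A := D)).rTensor N.carrier) h)
  simpa only [counit_apply, TensorProduct.lid_tmul, one_smul] using e

namespace RightComodule

theorem cohom_map_hom (X : RightComodule R D) [X.IsQuasiFinite] {M N : RightComodule R D}
    (f : M ⟶ N) :
    (X.cohom.map f).hom = (isCohom_cohomUnit X M).map (X.cohomUnit N) f :=
  (isCohom_cohomUnit X M).eq_map f fun x =>
    (LinearMap.congr_fun (congrArg Hom.hom (X.cohomAdj.unit.naturality f)) x).symm

theorem IsFlatCogenerator.cohom_faithful {X : RightComodule R D} [X.IsQuasiFinite]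
    (hX : X.IsFlatCogenerator) : X.cohom.Faithful := by
  have : ∀ M, Mono (X.cohomAdj.unit.app M) := fun M =>
    mono_of_injective _ ((isCohom_cohomUnit X M).injective hX)
  exact X.cohomAdj.faithful_L_of_mono_unit_app

theorem cotensorFunctor_preservesMonomorphisms [Module.Flat R D] (X : RightComodule R D)
    [Module.Flat R X.carrier] : X.cotensorFunctor.PreservesMonomorphisms where
  preserves f _ := by
    have hf : Function.Injective (f.hom.lTensor X.carrier) :=
      Module.Flat.lTensor_preserves_injective_linearMap _ (LeftComodule.injective_of_mono f)
    exact (ModuleCat.mono_iff_injective _).2 fun a b hab =>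
      Subtype.ext (hf (congrArg Subtype.val hab))

namespace IsCohom

variable {X : Bicomodule R C D} {Y : Type u} [AddCommGroup Y] [Module R Y]
  {δ : (Bicomodule.regular R D).right ⟶ X.right.tensor Y}

/-- The `D`-`C`-bicomodule `h(X, D)`. -/
noncomputable abbrev bicomodule (hδ : IsCohom δ) : Bicomodule R D C where
  carrier := Y
  lcoact := hδ.leftCoact
  lcoassoc := hδ.leftComodule.coassoc
  lcounit := hδ.leftComodule.counit
  rcoact := hδ.coact
  rcoassoc := hδ.comodule.coassoc
  rcounit := hδ.comodule.counit
  bicolinear := by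
    apply hδ.hom_ext
    intro (d : D)
    change ((TensorProduct.assoc R D Y C).toLinearMap ∘ₗ hδ.leftCoact.rTensor C ∘ₗ
      hδ.coact).rTensor X.carrier (δ.hom d) =
      (hδ.coact.lTensor D ∘ₗ hδ.leftCoact).rTensor X.carrier (δ.hom d)
    have hcoact : hδ.coact.rTensor X.carrier ∘ₗ δ.hom =
        (TensorProduct.assoc R Y C X.carrier).symm.toLinearMap ∘ₗ X.lcoact.lTensor Y ∘ₗ δ.hom :=
      LinearMap.ext hδ.coact_apply
    rw [LinearMap.rTensor_comp_apply, LinearMap.rTensor_comp_apply, LinearMap.rTensor_comp_apply,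
      hδ.coact_apply, hδ.leftCoact_apply, ← assoc_symm_rTensor, ← lTensor_rTensor_comm,
      hδ.leftCoact_apply, ← assoc_symm_lTensor_rTensor, ← LinearMap.lTensor_comp_apply, hcoact,
      rTensor_assoc_assoc_symm, ← assoc_symm_lTensor_lTensor, LinearEquiv.apply_symm_apply,
      LinearMap.lTensor_comp_apply, LinearMap.lTensor_comp_apply]

/-- The right coaction of `C` on `h(X, D)` as a left `D`-colinear map. -/
noncomputable abbrev coactLeftHom (hδ : IsCohom δ) :
    hδ.leftComodule ⟶ hδ.leftComodule.tensor C where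
  hom := hδ.coact
  colinear := hδ.bicomodule.bicolinear

/-- `h(X, M) = M □ h(X, D)`, as an isomorphism of functors. -/
noncomputable def cohomIsoCotensor (hX : X.right.IsInjector) [X.right.IsQuasiFinite]
    (hδ : IsCohom δ) : X.right.cohom ≅ hδ.leftComodule.cotensorFunctor :=
  NatIso.ofComponents
    (fun M => (LinearEquiv.ofInjective ((isCohom_cohomUnit X.right M).toCotensor δ)
      (toCotensor_injective hX hδ _) ≪≫ₗ
        LinearEquiv.ofEq _ _ (range_toCotensor hX hδ (isCohom_cohomUnit X.right M))).toModuleIso)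
    (fun {M N} f => by
      ext v
      apply Subtype.ext
      change (isCohom_cohomUnit X.right N).toCotensor δ ((X.right.cohom.map f).hom v) =
        f.hom.rTensor Y ((isCohom_cohomUnit X.right M).toCotensor δ v)
      rw [cohom_map_hom]
      exact LinearMap.congr_fun (toCotensor_naturality (isCohom_cohomUnit X.right M)
        (isCohom_cohomUnit X.right N) f) v)

theorem coeval_injective [Module.Flat R Y] (hδ : IsCohom δ) (hX : X.right.IsFlatCogenerator)
    (N : LeftComodule R D) : Function.Injective (coeval δ N) := by
  have hunit : Function.Injective ((δ.hom : D →ₗ[R] Y ⊗[R] X.carrier).rTensor N.carrier) := by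
    rw [← LinearMap.lTensor_inj_iff_rTensor_inj]
    have h := (hδ.tensor N.carrier).injective hX
    intro a b hab
    exact h (congrArg (TensorProduct.assoc R N.carrier Y X.carrier).symm hab)
  have hcoeval : Function.Injective (coevalTensor δ N) :=
    (TensorProduct.assoc R Y X.carrier N.carrier).injective.comp (hunit.comp N.coact_injective)
  rw [← subtype_comp_coeval, LinearMap.coe_comp] at hcoeval
  exact hcoeval.of_comp

theorem cotensorFunctor_faithful [Module.Flat R D] [Module.Flat R Y] (hδ : IsCohom δ)
    (hX : X.right.IsFlatCogenerator) [X.right.IsQuasiFinite] (hC : IsCohom X.lcoactHom) :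
    X.right.cotensorFunctor.Faithful := by
  have : ∀ N, Mono ((hC.cotensorAdj hδ hX.isInjector).unit.app N) := fun N =>
    LeftComodule.mono_of_injective _ (hδ.coeval_injective hX N)
  exact (hC.cotensorAdj hδ hX.isInjector).faithful_L_of_mono_unit_app

theorem isMoritaTakeuchi_right [Module.Flat R D] (hX : X.right.IsFlatCogenerator)
    (hC : IsCohom X.lcoactHom) : X.right.IsMoritaTakeuchi C := by
  have := hX.isQuasiFinite
  have := hX.flat
  have hδ : IsCohom (X.right.cohomUnit (Bicomodule.regular R D).right) :=
    isCohom_cohomUnit _ _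
  have := hδ.flat hX.isInjector
  have adj := hC.cotensorAdj hδ hX.isInjector
  have := Functor.preservesEpimorphisms_of_adjunction adj
  have hcoflat : X.right.IsCoflat := IsCoflat.of_flat X.right fun N N' g hg => by
    have := LeftComodule.epi_of_surjective g hg
    exact (ModuleCat.epi_iff_surjective _).1 (X.right.cotensorFunctor.map_epi g)
  exact ⟨inferInstance, ⟨hcoflat, hδ.cotensorFunctor_faithful hX hC⟩, hX.isInjector,
    ⟨coendCoalgEquiv ((isCohom_coendUnit X.right).equiv hC)
      ((isCohom_coendUnit X.right).lift_apply X.lcoactHom)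
      (fun x => (TensorProduct.assoc R C C X.carrier).eq_symm_apply.2 (X.lcoassoc_apply x).symm)
      X.lcounit_apply⟩⟩

/-- The isomorphism `C ≃ X □ h(X, D)`. -/
noncomputable def copairingEquiv (hC : IsCohom X.lcoactHom) (hδ : IsCohom δ)
    (hX : X.right.IsInjector) [X.right.IsQuasiFinite] :
    C ≃ₗ[R] cotensor X.right hδ.leftComodule :=
  LinearEquiv.ofInjective (hC.copairing δ) (toCotensor_injective hX hδ hC) ≪≫ₗ
    LinearEquiv.ofEq _ _ (range_toCotensor hX hδ hC)

section LeftCoend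

variable [Module.Flat R Y]

theorem coeval_leftComodule (hC : IsCohom X.lcoactHom) (hδ : IsCohom δ) (hX : X.right.IsInjector)
    [X.right.IsQuasiFinite] : coeval δ hδ.leftComodule =
      (copairingEquiv hC hδ hX).toLinearMap.lTensor Y ∘ₗ hδ.coact := by
  ext y
  apply lTensor_subtype_cotensor_injective X.right Y hδ.leftComodule
  rw [subtype_coeval, LinearMap.comp_apply, ← LinearMap.lTensor_comp_apply]
  exact (LinearMap.congr_fun (lTensor_copairing_comp hC hδ) y).symm

variable [Module.Flat R D] [X.right.IsQuasiFinite] {W : Type u} [AddCommGroup W] [Module R W]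

theorem homEquiv_cotensorAdj_hom (hC : IsCohom X.lcoactHom) (hδ : IsCohom δ)
    (hX : X.right.IsInjector)
    (g : X.right.cotensorFunctor.obj hδ.leftComodule ⟶ ModuleCat.of R W) :
    ((hC.cotensorAdj hδ hX).homEquiv hδ.leftComodule (ModuleCat.of R W) g).hom =
      (g.hom ∘ₗ (copairingEquiv hC hδ hX).toLinearMap).lTensor Y ∘ₗ hδ.coact := by
  rw [Adjunction.homEquiv_unit]
  let k : cotensor X.right hδ.leftComodule →ₗ[R] W := g.hom
  change k.lTensor Y ∘ₗ coeval δ hδ.leftComodule =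
    (k ∘ₗ (copairingEquiv hC hδ hX).toLinearMap).lTensor Y ∘ₗ hδ.coact
  rw [coeval_leftComodule hC hδ hX, LinearMap.lTensor_comp, LinearMap.comp_assoc]

theorem exists_lTensor_coact_eq (hC : IsCohom X.lcoactHom) (hδ : IsCohom δ)
    (hX : X.right.IsInjector) (f : hδ.leftComodule ⟶ hδ.leftComodule.tensor W) :
    ∃ k : C →ₗ[R] W, k.lTensor Y ∘ₗ hδ.coact = f.hom := by
  obtain ⟨g, hg⟩ := ((hC.cotensorAdj hδ hX).homEquiv hδ.leftComodule
    (ModuleCat.of R W)).surjective f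
  exact ⟨g.hom ∘ₗ (copairingEquiv hC hδ hX).toLinearMap,
    (homEquiv_cotensorAdj_hom hC hδ hX g).symm.trans (congrArg LeftComodule.Hom.hom hg)⟩

theorem eq_of_lTensor_coact_eq (hC : IsCohom X.lcoactHom) (hδ : IsCohom δ)
    (hX : X.right.IsInjector) {k l : C →ₗ[R] W}
    (h : k.lTensor Y ∘ₗ hδ.coact = l.lTensor Y ∘ₗ hδ.coact) : k = l := by
  let e := copairingEquiv hC hδ hX
  let precomp (m : C →ₗ[R] W) :
      X.right.cotensorFunctor.obj hδ.leftComodule ⟶ ModuleCat.of R W :=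
    ModuleCat.ofHom (m ∘ₗ e.symm.toLinearMap)
  have precomp_comp (m : C →ₗ[R] W) : (precomp m).hom ∘ₗ e.toLinearMap = m :=
    LinearMap.ext fun c => congrArg m (e.symm_apply_apply c)
  have hkl : precomp k = precomp l := by
    apply ((hC.cotensorAdj hδ hX).homEquiv hδ.leftComodule (ModuleCat.of R W)).injective
    apply LeftComodule.hom_ext
    refine (homEquiv_cotensorAdj_hom hC hδ hX _).trans
      (Eq.trans ?_ (homEquiv_cotensorAdj_hom hC hδ hX _).symm)
    rw [precomp_comp, precomp_comp, h]
  rw [← precomp_comp k, ← precomp_comp l, hkl]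

theorem nonempty_leftComodule_coend_equiv (hC : IsCohom X.lcoactHom) (hδ : IsCohom δ)
    (hX : X.right.IsInjector) [hδ.leftComodule.IsQuasiFinite] :
    Nonempty (hδ.leftComodule.Coend ≃ₗc[R] C) := by
  obtain ⟨k, hk⟩ := exists_lTensor_coact_eq hC hδ hX hδ.leftComodule.coendUnit
  let e := LeftComodule.coendLinearEquiv (κ := hδ.coactLeftHom) k (LinearMap.congr_fun hk)
    fun l hl => eq_of_lTensor_coact_eq hC hδ hX
      ((LinearMap.ext hl).trans (by rw [LinearMap.lTensor_id, LinearMap.id_comp]))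
  exact ⟨LeftComodule.coendCoalgEquiv e
    (LinearMap.congr_fun (hδ.leftComodule.coendLift_spec hδ.coactLeftHom))
    (fun y => (hδ.comodule.coassoc_apply y).symm) hδ.comodule.counit_apply⟩

end LeftCoend

theorem isMoritaTakeuchi_left [Module.Flat R D] (hX : X.right.IsFlatCogenerator)
    (hC : IsCohom X.lcoactHom) (hδ : IsCohom δ) : hδ.leftComodule.IsMoritaTakeuchi C := by
  have := hX.isQuasiFinite
  have := hX.flat
  have hY : Module.Flat R Y := hδ.flat hX.isInjector
  have : Module.Flat R hδ.leftComodule.carrier := hY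
  let adj := hC.cotensorAdj hδ hX.isInjector
  have hquasi : hδ.leftComodule.IsQuasiFinite := adj.isRightAdjoint
  have := cotensorFunctor_preservesMonomorphisms X.right
  have hinjector : hδ.leftComodule.IsInjector :=
    Functor.preservesInjectiveObjects_of_adjunction_of_preservesMonomorphisms adj
  let iso := cohomIsoCotensor hX.isInjector hδ
  have hcoflat : hδ.leftComodule.IsCoflat := LeftComodule.IsCoflat.of_flat _ fun M M' g hg => by
    have := Functor.preservesEpimorphisms_of_adjunction X.right.cohomAdj
    have := Functor.PreservesEpimorphisms.of_iso iso
    have := epi_of_surjective g hg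
    exact (ModuleCat.epi_iff_surjective _).1 (hδ.leftComodule.cotensorFunctor.map_epi g)
  have := hX.cohom_faithful
  exact ⟨hquasi, ⟨hcoflat, Functor.Faithful.of_iso iso⟩, hinjector,
    nonempty_leftComodule_coend_equiv hC hδ hX.isInjector⟩

end IsCohom

end RightComodule

/-! ### From Morita–Takeuchi bicomodules to flat cogenerators -/

theorem Bicomodule.lcoact_lTensor_injective (X : Bicomodule R C D) (W : Type u)
    [AddCommGroup W] [Module R W] : Function.Injective (X.lcoact.lTensor W) := by
  have h : ((TensorProduct.lid R X.carrier).toLinearMap ∘ₗ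
      (Coalgebra.counit (R := R) (A := C)).rTensor X.carrier).lTensor W ∘ₗ
        X.lcoact.lTensor W = LinearMap.id := by
    rw [← LinearMap.lTensor_comp, LinearMap.comp_assoc, X.lcounit]
    ext; simp
  exact Function.LeftInverse.injective (LinearMap.congr_fun h)

namespace RightComodule

theorem mem_cotensor_regular (M : RightComodule R D) {W : Type u} [AddCommGroup W] [Module R W]
    {z : (W ⊗[R] M.carrier) ⊗[R] D} :
    tensorRotate R W M.carrier D z ∈ cotensor M ((Bicomodule.regular R D).left.tensor W) ↔
      ∃ t, (M.tensor W).coact t = z := by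
  refine (tensorRotate_mem_cotensor M (Bicomodule.regular R D).left z).trans
    (mem_cotensor.trans ⟨fun h => ?_, ?_⟩)
  · exact ⟨_, (eq_coact_of_coact_rTensor_eq (M.tensor W) z
      ((TensorProduct.assoc R (W ⊗[R] M.carrier) D D).eq_symm_apply.2 h)).symm⟩
  · rintro ⟨t, rfl⟩
    exact (M.tensor W).coassoc_apply t

section TensorCotensor

variable (M : RightComodule R D) (W W' : Type u) [AddCommGroup W] [Module R W]
  [AddCommGroup W'] [Module R W']

/-- The map `W ⊗ M → M □ (D ⊗ W)` induced by the coaction of `M`. -/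
noncomputable def tensorCotensor :
    W ⊗[R] M.carrier →ₗ[R] cotensor M ((Bicomodule.regular R D).left.tensor W) :=
  ((tensorRotate R W M.carrier D).toLinearMap ∘ₗ (M.tensor W).coact).codRestrict _
    fun t => M.mem_cotensor_regular.2 ⟨t, rfl⟩

theorem tensorCotensor_injective : Function.Injective (M.tensorCotensor W) := fun _ _ h =>
  (M.tensor W).coact_injective ((tensorRotate R W M.carrier D).injective (congrArg Subtype.val h))

theorem tensorCotensor_surjective : Function.Surjective (M.tensorCotensor W) := by
  rintro ⟨z, hz⟩
  obtain ⟨z, rfl⟩ := (tensorRotate R W M.carrier D).surjective z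
  obtain ⟨t, rfl⟩ := M.mem_cotensor_regular.1 hz
  exact ⟨t, rfl⟩

variable {W W'} in
theorem tensorCotensor_naturality (f : W →ₗ[R] W') (t : W ⊗[R] M.carrier) :
    (M.cotensorFunctor.map ((Bicomodule.regular R D).left.tensorFunctor.map
      (ModuleCat.ofHom f))).hom (M.tensorCotensor W t) =
      M.tensorCotensor W' (f.rTensor M.carrier t) := by
  have hrotate : (f.lTensor D).lTensor M.carrier ∘ₗ (tensorRotate R W M.carrier D).toLinearMap =
      (tensorRotate R W' M.carrier D).toLinearMap ∘ₗ (f.rTensor M.carrier).rTensor D := by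
    ext; simp
  apply Subtype.ext
  exact (LinearMap.congr_fun hrotate ((M.tensor W).coact t)).trans
    (congrArg (tensorRotate R W' M.carrier D) (LinearMap.congr_fun (M.tensor_colinear f) t).symm)

end TensorCotensor

theorem IsCoflat.flat [Module.Flat R D] {X : RightComodule R D} (hX : X.IsCoflat) :
    Module.Flat R X.carrier := by
  refine Module.Flat.iff_rTensor_preserves_injective_linearMap.2 fun W W' _ _ _ _ f hf => ?_
  let L := (Bicomodule.regular R D).left.tensorFunctor
  have hinj : Function.Injective (X.cotensorFunctor.map (L.map (ModuleCat.ofHom f))).hom :=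
    (hX (L.map (ModuleCat.ofHom f)) (L.map (ModuleCat.ofHom (LinearMap.range f).mkQ))
      (Module.Flat.lTensor_preserves_injective_linearMap f hf)
      (Module.Flat.lTensor_exact D (LinearMap.exact_map_mkQ_range f))
      (LinearMap.lTensor_surjective D (Submodule.mkQ_surjective _))).1
  have hcomp : Function.Injective fun t => X.tensorCotensor W' (f.rTensor X.carrier t) := by
    rw [← funext (X.tensorCotensor_naturality f)]
    exact hinj.comp (X.tensorCotensor_injective W)
  exact Function.Injective.of_comp hcomp

namespace IsCohom

variable {X : Bicomodule R C D} {Y : Type u} [AddCommGroup Y] [Module R Y]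
  {δ : (Bicomodule.regular R D).right ⟶ X.right.tensor Y}

/-- The universal map `D → h(X, D) ⊗ X` as a left colinear map. -/
noncomputable abbrev unitLeftHom (hδ : IsCohom δ) :
    (Bicomodule.regular R D).left ⟶ hδ.leftComodule.tensor X.carrier where
  hom := δ.hom
  colinear := by
    ext d
    exact ((TensorProduct.assoc R D Y X.carrier).symm_apply_eq.1
      (hδ.leftCoact_apply d).symm).symm

theorem lTensor_unit_coact_injective [Module.Flat R X.carrier] (hC : IsCohom X.lcoactHom)
    (hδ : IsCohom δ) (hX : X.right.IsInjector) (W : Type u) [AddCommGroup W] [Module R W] :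
    Function.Injective fun m : W ⊗[R] X.carrier =>
      δ.hom.lTensor (W ⊗[R] X.carrier) ((X.right.tensor W).coact m) := by
  have h : Function.Injective (((hC.tensor W).toCotensor δ).rTensor X.carrier) :=
    Module.Flat.rTensor_preserves_injective_linearMap _ (toCotensor_injective hX hδ (hC.tensor W))
  intro m m' hm
  apply X.lcoact_lTensor_injective W
  apply (TensorProduct.assoc R W C X.carrier).symm.injective
  apply h
  exact ((hC.tensor W).toCotensor_apply m).trans ((congrArg _ hm).trans
    ((hC.tensor W).toCotensor_apply m').symm)

/-- The universal map tensored with `W`, as a left colinear map `D ⊗ W → h(X, D) ⊗ (X ⊗ W)`. -/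
noncomputable def unitTensorLeftHom (hδ : IsCohom δ) (W : Type u) [AddCommGroup W] [Module R W] :
    (Bicomodule.regular R D).left.tensor W ⟶ hδ.leftComodule.tensor (X.carrier ⊗[R] W) :=
  LeftComodule.tensorMap W hδ.unitLeftHom ≫ hδ.leftComodule.tensorAssoc W X.carrier

theorem cotensorFunctor_map_unitTensorLeftHom (hδ : IsCohom δ) {W : Type u} [AddCommGroup W]
    [Module R W] (m : W ⊗[R] X.carrier) :
    ((X.right.cotensorFunctor.map (hδ.unitTensorLeftHom W)).hom
      (X.right.tensorCotensor W m)).1 =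
      (TensorProduct.assoc R Y X.carrier W).toLinearMap.lTensor X.carrier
        (tensorRotate R W X.carrier (Y ⊗[R] X.carrier)
          (δ.hom.lTensor (W ⊗[R] X.carrier) ((X.right.tensor W).coact m))) := by
  have hrotate : (hδ.unitTensorLeftHom W).hom.lTensor X.carrier ∘ₗ
        (tensorRotate R W X.carrier D).toLinearMap =
      (TensorProduct.assoc R Y X.carrier W).toLinearMap.lTensor X.carrier ∘ₗ
        (tensorRotate R W X.carrier (Y ⊗[R] X.carrier)).toLinearMap ∘ₗ
          (δ.hom : D →ₗ[R] Y ⊗[R] X.carrier).lTensor (W ⊗[R] X.carrier) := by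
    ext; rfl
  exact LinearMap.congr_fun hrotate ((X.right.tensor W).coact m)

theorem lTensor_unit_injective [Module.Flat R D] (hC : IsCohom X.lcoactHom) (hδ : IsCohom δ)
    (hX : X.right.IsInjector) (hcoflat : X.right.IsFaithfullyCoflat) (W : Type u)
    [AddCommGroup W] [Module R W] : Function.Injective (δ.hom.lTensor W) := by
  have := hcoflat.2
  have : Module.Flat R X.carrier := hcoflat.1.flat
  let φ := hδ.unitTensorLeftHom W
  have hmap : Function.Injective
      ((X.right.cotensorFunctor.map φ).hom ∘ X.right.tensorCotensor W) := by
    intro m m' h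
    apply lTensor_unit_coact_injective hC hδ hX W
    apply (tensorRotate R W X.carrier (Y ⊗[R] X.carrier)).injective
    apply (LinearEquiv.lTensor X.carrier (TensorProduct.assoc R Y X.carrier W)).injective
    exact (cotensorFunctor_map_unitTensorLeftHom hδ m).symm.trans
      ((congrArg Subtype.val h).trans (cotensorFunctor_map_unitTensorLeftHom hδ m'))
  have : Mono (X.right.cotensorFunctor.map φ) := (ModuleCat.mono_iff_injective _).2
    (hmap.of_comp_right (X.right.tensorCotensor_surjective W))
  have : Mono φ := X.right.cotensorFunctor.mono_of_mono_map this
  have hφ : Function.Injective φ.hom := LeftComodule.injective_of_mono φ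
  exact (LinearMap.lTensor_inj_iff_rTensor_inj (M := W)
    (δ.hom : D →ₗ[R] Y ⊗[R] X.carrier)).2 fun a b hab =>
      hφ (congrArg (TensorProduct.assoc R Y X.carrier W) hab)

theorem isFlatCogenerator [Module.Flat R D] (hC : IsCohom X.lcoactHom)
    [hquasi : X.right.IsQuasiFinite] (hX : X.right.IsInjector)
    (hcoflat : X.right.IsFaithfullyCoflat) : X.right.IsFlatCogenerator where
  isQuasiFinite := hquasi
  isInjector := hX
  flat := hcoflat.1.flat
  cogenerates M := by
    let δ := X.right.cohomUnit (Bicomodule.regular R D).right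
    have hδ : IsCohom δ := isCohom_cohomUnit X.right (Bicomodule.regular R D).right
    refine ⟨ModuleCat.of R (M.carrier ⊗[R] X.right.cohom.obj (Bicomodule.regular R D).right),
      M.coactHom ≫ tensorMap M.carrier δ ≫ X.right.tensorAssoc M.carrier _, ?_⟩
    exact (TensorProduct.assoc R M.carrier _ X.carrier).symm.injective.comp
        ((hC.lTensor_unit_injective hδ hX hcoflat M.carrier).comp M.coact_injective)

end IsCohom

theorem IsMoritaTakeuchi.exists_bicomodule [Module.Flat R D] {X : RightComodule R D}
    (hX : X.IsMoritaTakeuchi C) : ∃ B : Bicomodule R C D,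
      IsCohom B.lcoactHom ∧ B.right.IsFlatCogenerator := by
  obtain ⟨_, hcoflat, hinj, ⟨e⟩⟩ := hX
  have hC := X.isCohom_lcoactHom_coendBicomodule e
  have : (X.coendBicomodule e).right.IsQuasiFinite := ‹X.IsQuasiFinite›
  exact ⟨X.coendBicomodule e, hC, hC.isFlatCogenerator hinj hcoflat⟩

end RightComodule

/-! ### Transport along an equivalence -/

namespace RightComodule

section Copower

variable {M N : RightComodule R D} {W W' : Type u} [AddCommGroup W] [Module R W]
  [AddCommGroup W'] [Module R W']

/-- The colinear maps `M → W ⊗ M`, `m ↦ w ⊗ m`, as a linear family indexed by `w`. -/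
def inclTensorLinear (M : RightComodule R D) (W : Type u) [AddCommGroup W] [Module R W] :
    W →ₗ[R] (M ⟶ M.tensor W) where
  toFun := M.inclTensor
  map_add' v w := hom_ext (map_add (TensorProduct.mk R W M.carrier) v w)
  map_smul' r w := hom_ext (map_smul (TensorProduct.mk R W M.carrier) r w)

theorem tensor_hom_ext {f g : M.tensor W ⟶ N}
    (h : ∀ w, M.inclTensor w ≫ f = M.inclTensor w ≫ g) : f = g :=
  hom_ext (TensorProduct.ext' fun w m => LinearMap.congr_fun (congrArg Hom.hom (h w)) m)

/-- The colinear map `W ⊗ M → N` given by a linear family of colinear maps `M → N`. -/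
def tensorDesc (k : W →ₗ[R] (M ⟶ N)) : M.tensor W ⟶ N where
  hom := TensorProduct.lift
    { toFun := fun w => (k w).hom
      map_add' := fun a b => by rw [map_add, add_hom]
      map_smul' := fun r a => by rw [map_smul, smul_hom, RingHom.id_apply] }
  colinear := by
    ext w m
    change N.coact ((k w).hom m) =
      LinearMap.rTensor D _ ((TensorProduct.assoc R W M.carrier D).symm (w ⊗ₜ M.coact m))
    rw [colinear_apply]
    induction M.coact m with
    | zero => simp
    | add a b ha hb => simp only [TensorProduct.tmul_add, map_add, ha, hb]
    | tmul a d => rfl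

@[simp]
theorem inclTensor_tensorDesc (k : W →ₗ[R] (M ⟶ N)) (w : W) :
    M.inclTensor w ≫ tensorDesc k = k w := rfl

theorem inclTensor_tensorHom (f : W →ₗ[R] W') (w : W) :
    M.inclTensor w ≫ M.tensorHom f = M.inclTensor (f w) := rfl

theorem inclTensor_tensorMap (f : M ⟶ N) (w : W) :
    M.inclTensor w ≫ tensorMap W f = f ≫ N.inclTensor w := rfl

theorem inclTensor_tensorAssoc (v : W) (w : W') :
    M.inclTensor w ≫ (M.tensor W').inclTensor v ≫ M.tensorAssoc W W' =
      M.inclTensor (v ⊗ₜ[R] w) := rfl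

end Copower

section Comparison

variable (F : RightComodule R C ⥤ RightComodule R D) [F.Additive] [F.Linear R]
  {M N : RightComodule R C} {W W' : Type u} [AddCommGroup W] [Module R W]
  [AddCommGroup W'] [Module R W']

/-- The canonical map `W ⊗ F M → F (W ⊗ M)` for a linear functor `F`. -/
def comparison (M : RightComodule R C) (W : Type u) [AddCommGroup W] [Module R W] :
    (F.obj M).tensor W ⟶ F.obj (M.tensor W) :=
  tensorDesc (F.mapLinearMap R ∘ₗ M.inclTensorLinear W)

theorem inclTensor_comparison (w : W) :
    (F.obj M).inclTensor w ≫ comparison F M W = F.map (M.inclTensor w) := rfl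

theorem comparison_tensorHom (f : W →ₗ[R] W') :
    (F.obj M).tensorHom f ≫ comparison F M W' =
      comparison F M W ≫ F.map (M.tensorHom f) := by
  apply tensor_hom_ext
  intro w
  rw [← Category.assoc, ← Category.assoc, inclTensor_tensorHom, inclTensor_comparison,
    inclTensor_comparison, ← F.map_comp, inclTensor_tensorHom]

theorem comparison_tensorMap (f : M ⟶ N) :
    tensorMap W (F.map f) ≫ comparison F N W = comparison F M W ≫ F.map (tensorMap W f) := by
  apply tensor_hom_ext
  intro w
  rw [← Category.assoc, ← Category.assoc, inclTensor_tensorMap, Category.assoc,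
    inclTensor_comparison, inclTensor_comparison, ← F.map_comp, ← F.map_comp,
    inclTensor_tensorMap]

theorem tensorAssoc_comparison :
    (F.obj M).tensorAssoc W W' ≫ comparison F M (W ⊗[R] W') =
      tensorMap W (comparison F M W') ≫ comparison F (M.tensor W') W ≫
        F.map (M.tensorAssoc W W') := by
  refine tensor_hom_ext fun v => tensor_hom_ext fun w => ?_
  change F.map (M.inclTensor (v ⊗ₜ[R] w)) =
    F.map (M.inclTensor w) ≫ F.map ((M.tensor W').inclTensor v) ≫ F.map (M.tensorAssoc W W')
  rw [← F.map_comp, ← F.map_comp, inclTensor_tensorAssoc]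

variable (M W)

theorem isIso_comparison [F.IsEquivalence] : IsIso (comparison F M W) := by
  let e := F.objObjPreimageIso ((F.obj M).tensor W)
  let mapEquiv := LinearEquiv.ofBijective
    (F.mapLinearMap R (X := M) (Y := F.objPreimage ((F.obj M).tensor W)))
    ⟨F.map_injective, F.map_surjective⟩
  let k : W →ₗ[R] (M ⟶ F.objPreimage ((F.obj M).tensor W)) :=
    mapEquiv.symm.toLinearMap ∘ₗ Linear.rightComp R (F.obj M) e.inv ∘ₗ
      (F.obj M).inclTensorLinear W
  let g : M.tensor W ⟶ F.objPreimage ((F.obj M).tensor W) := tensorDesc k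
  have map_g (w : W) : F.map (M.inclTensor w) ≫ F.map g = (F.obj M).inclTensor w ≫ e.inv := by
    rw [← F.map_comp, inclTensor_tensorDesc]
    exact mapEquiv.apply_symm_apply _
  let h := F.preimage (e.hom ≫ comparison F M W)
  have map_h : F.map h = e.hom ≫ comparison F M W := F.map_preimage _
  have g_comp_h : g ≫ h = 𝟙 _ := by
    apply tensor_hom_ext
    intro w
    apply F.map_injective
    rw [F.map_comp, F.map_comp, map_h, ← Category.assoc, map_g, Category.assoc,
      e.inv_hom_id_assoc, inclTensor_comparison, Category.comp_id]
  refine ⟨F.map g ≫ e.hom, ?_, ?_⟩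
  · apply tensor_hom_ext
    intro w
    rw [← Category.assoc, ← Category.assoc, inclTensor_comparison, map_g, Category.assoc,
      e.inv_hom_id]
  · rw [Category.assoc, ← map_h, ← F.map_comp, g_comp_h, F.map_id]

/-- The isomorphism `W ⊗ F M ≅ F (W ⊗ M)` for a linear equivalence `F`. -/
noncomputable def comparisonIso [F.IsEquivalence] :
    (F.obj M).tensor W ≅ F.obj (M.tensor W) :=
  have := isIso_comparison F M W
  asIso (comparison F M W)

theorem comparisonIso_hom [F.IsEquivalence] : (comparisonIso F M W).hom = comparison F M W := rfl

/-- A linear equivalence commutes with the functors `- ⊗ M`. -/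
noncomputable def tensorFunctorIso [F.IsEquivalence] :
    (F.obj M).tensorFunctor ≅ M.tensorFunctor ⋙ F :=
  NatIso.ofComponents (fun V => comparisonIso F M V) fun f => comparison_tensorHom F f.hom

end Comparison

section Regular

/-- The linear map `W ⊗ C → W` given by the counit. -/
noncomputable def tensorCounit (R : Type u) [CommRing R] (C : Type u) [AddCommGroup C]
    [Module R C] [Coalgebra R C] (W : Type u) [AddCommGroup W] [Module R W] : W ⊗[R] C →ₗ[R] W :=
  (TensorProduct.rid R W).toLinearMap ∘ₗ (Coalgebra.counit (R := R) (A := C)).lTensor W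

theorem tensorCounit_coact (M : RightComodule R C) (m : M.carrier) :
    tensorCounit R C M.carrier (M.coact m) = m := by
  rw [tensorCounit, LinearMap.comp_apply, counit_apply]
  simp

theorem tensorCounit_rTensor_coact {W : Type u} [AddCommGroup W] [Module R W] (z : W ⊗[R] C) :
    (tensorCounit R C W).rTensor C (((regular R C).tensor W).coact z) = z := by
  have hassoc : (tensorCounit R C W).rTensor C ∘ₗ
      (TensorProduct.assoc R W C C).symm.toLinearMap =
      ((TensorProduct.lid R C).toLinearMap ∘ₗ
        (Coalgebra.counit (R := R) (A := C)).rTensor C).lTensor W := by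
    ext w a b
    simp [tensorCounit, TensorProduct.smul_tmul]
  have hid : (tensorCounit R C W).rTensor C ∘ₗ ((regular R C).tensor W).coact =
      LinearMap.id := by
    rw [← LinearMap.comp_assoc, hassoc, ← LinearMap.lTensor_comp, LinearMap.comp_assoc,
      Coalgebra.rTensor_counit_comp_comul]
    ext; simp
  exact LinearMap.congr_fun hid z

/-- The functor `- ⊗ C` is right adjoint to the forgetful functor. -/
noncomputable def forgetAdj (R : Type u) [CommRing R] (C : Type u) [AddCommGroup C]
    [Module R C] [Coalgebra R C] : forget R C ⊣ (regular R C).tensorFunctor :=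
  Adjunction.mkOfUnitCounit
    { unit := { app := fun M => M.coactHom, naturality := fun M N f => hom_ext f.colinear }
      counit :=
        { app := fun W => ModuleCat.ofHom (tensorCounit R C W)
          naturality := fun V W f => by
            apply ModuleCat.hom_ext
            change tensorCounit R C W ∘ₗ f.hom.rTensor C = f.hom ∘ₗ tensorCounit R C V
            ext v c
            simp [tensorCounit] }
      left_triangle := by
        ext M m
        exact M.tensorCounit_coact m
      right_triangle := by
        ext W z
        exact tensorCounit_rTensor_coact z }

instance : (regular R C).IsQuasiFinite := (forgetAdj R C).isRightAdjoint

theorem isInjector_regular [Module.Flat R C] : (regular R C).IsInjector := by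
  have : (forget R C).PreservesMonomorphisms :=
    ⟨fun f _ => (ModuleCat.mono_iff_injective _).2 (injective_of_mono f)⟩
  exact Functor.preservesInjectiveObjects_of_adjunction_of_preservesMonomorphisms (forgetAdj R C)

theorem isCohom_coactHom (M : RightComodule R C) : IsCohom M.coactHom :=
  isCohom_unit_app (forgetAdj R C) M

theorem isFlatCogenerator_regular [Module.Flat R C] : (regular R C).IsFlatCogenerator where
  isQuasiFinite := inferInstance
  isInjector := isInjector_regular
  flat := ‹_›
  cogenerates M := ⟨ModuleCat.of R M.carrier, M.coactHom, M.coact_injective⟩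

end Regular

section Transport

variable (F : RightComodule R C ⥤ RightComodule R D) [F.Additive] [F.Linear R] [F.IsEquivalence]

/-- The image of a colinear map `M → V ⊗ X` under a linear equivalence `F`, as a map
`F M → V ⊗ F X`. -/
noncomputable def mapTensor {X M : RightComodule R C} {V : Type u} [AddCommGroup V] [Module R V]
    (η : M ⟶ X.tensor V) : F.obj M ⟶ (F.obj X).tensor V :=
  F.map η ≫ (comparisonIso F X V).inv

section MapTensor

variable {X M : RightComodule R C} {V W : Type u} [AddCommGroup V] [Module R V]
  [AddCommGroup W] [Module R W]

theorem mapTensor_comparison (η : M ⟶ X.tensor V) :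
    mapTensor F η ≫ comparison F X V = F.map η := by
  rw [mapTensor, Category.assoc, ← comparisonIso_hom, Iso.inv_hom_id, Category.comp_id]

theorem mapTensor_eq_iff {η : M ⟶ X.tensor V} {κ : F.obj M ⟶ (F.obj X).tensor V} :
    mapTensor F η = κ ↔ F.map η = κ ≫ comparison F X V :=
  Iso.comp_inv_eq (comparisonIso F X V)

theorem mapTensor_bijective :
    Function.Bijective (mapTensor F : (M ⟶ X.tensor V) → (F.obj M ⟶ (F.obj X).tensor V)) :=
  (Iso.homToEquiv (comparisonIso F X V).symm).bijective.comp ⟨F.map_injective, F.map_surjective⟩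

theorem mapTensor_tensorHom (η : M ⟶ X.tensor V) (k : V →ₗ[R] W) :
    mapTensor F (η ≫ X.tensorHom k) = mapTensor F η ≫ (F.obj X).tensorHom k := by
  rw [mapTensor_eq_iff, Category.assoc, comparison_tensorHom, ← Category.assoc,
    mapTensor_comparison, F.map_comp]

theorem mapTensor_inclTensor (v : V) : mapTensor F (X.inclTensor v) = (F.obj X).inclTensor v :=
  (mapTensor_eq_iff F).2 (inclTensor_comparison F v).symm

theorem mapTensor_comp_tensorMap_tensorAssoc {N : RightComodule R C} (η : N ⟶ M.tensor V)
    (θ : M ⟶ X.tensor W) :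
    mapTensor F (η ≫ tensorMap V θ ≫ X.tensorAssoc V W) =
      mapTensor F η ≫ tensorMap V (mapTensor F θ) ≫ (F.obj X).tensorAssoc V W := by
  have hθ : tensorMap V (mapTensor F θ) ≫ tensorMap V (comparison F X W) =
      tensorMap V (F.map θ) := by
    rw [← mapTensor_comparison F θ]
    exact hom_ext (LinearMap.lTensor_comp _ _ _).symm
  rw [mapTensor_eq_iff, Category.assoc, Category.assoc, tensorAssoc_comparison,
    ← Category.assoc (tensorMap V (mapTensor F θ)), hθ, ← Category.assoc (tensorMap V _),
    comparison_tensorMap, Category.assoc, ← Category.assoc (mapTensor F η),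
    mapTensor_comparison, F.map_comp, F.map_comp]

theorem isCohom_mapTensor {η : M ⟶ X.tensor V} (h : IsCohom η) : IsCohom (mapTensor F η) where
  exists_lift f := by
    obtain ⟨g, rfl⟩ := (mapTensor_bijective F).2 f
    exact ⟨h.lift g, by
      conv_rhs => rw [← h.comp_tensorHom_lift g, mapTensor_tensorHom]
      rfl⟩
  hom_ext {W} _ _ k k' hk := by
    have hkk' : mapTensor F (η ≫ X.tensorHom k) = mapTensor F (η ≫ X.tensorHom k') := by
      rw [mapTensor_tensorHom, mapTensor_tensorHom]
      exact RightComodule.hom_ext (LinearMap.ext hk)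
    exact h.hom_ext (LinearMap.congr_fun (congrArg Hom.hom ((mapTensor_bijective F).1 hkk')))

theorem mapTensor_injective [Module.Flat R D] {η : M ⟶ X.tensor V} (hη : Function.Injective η.hom) :
    Function.Injective (mapTensor F η).hom := by
  have := mono_of_injective η hη
  have := F.map_mono η
  have : Mono (mapTensor F η) := mono_comp _ _
  exact injective_of_mono (mapTensor F η)

end MapTensor

theorem IsFlatCogenerator.map [Module.Flat R D] {X : RightComodule R C}
    (hX : X.IsFlatCogenerator) : (F.obj X).IsFlatCogenerator where
  isQuasiFinite := by
    have := hX.isQuasiFinite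
    exact Functor.isRightAdjoint_of_iso (tensorFunctorIso F X).symm
  isInjector := ⟨fun {V} hV =>
    Injective.of_iso (comparisonIso F X V).symm
      (F.injective_obj_of_injective (hX.isInjector.injective_obj hV))⟩
  flat := by
    have := hX.flat
    refine Module.Flat.iff_rTensor_preserves_injective_linearMap.2 fun W W' _ _ _ _ f hf => ?_
    have : Mono (X.tensorHom f) :=
      mono_of_injective _ (Module.Flat.rTensor_preserves_injective_linearMap f hf)
    have hcomp : (F.obj X).tensorHom f =
        comparison F X W ≫ F.map (X.tensorHom f) ≫ (comparisonIso F X W').inv := by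
      rw [← Category.assoc, Iso.eq_comp_inv, comparisonIso_hom, comparison_tensorHom]
    have := isIso_comparison F X W
    have : Mono ((F.obj X).tensorHom f) := hcomp ▸ inferInstance
    exact injective_of_mono ((F.obj X).tensorHom f)
  cogenerates M := by
    obtain ⟨W, f, hf⟩ := hX.cogenerates (F.objPreimage M)
    have := mono_of_injective _ (mapTensor_injective F hf)
    let g : M ⟶ (F.obj X).tensor W := (F.objObjPreimageIso M).inv ≫ mapTensor F f
    have : Mono g := mono_comp _ _
    exact ⟨W, g, injective_of_mono g⟩

/-- The image of a bicomodule under a linear equivalence between categories of right comodules. -/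
noncomputable def mapBicomodule {E : Type u} [AddCommGroup E] [Module R E] [Coalgebra R E]
    (X : Bicomodule R E C) : Bicomodule R E D where
  carrier := (F.obj X.right).carrier
  rcoact := (F.obj X.right).coact
  rcoassoc := (F.obj X.right).coassoc
  rcounit := (F.obj X.right).counit
  lcoact := (mapTensor F X.lcoactHom).hom
  lcoassoc := by
    have hlcoassoc : X.lcoactHom ≫ X.right.tensorHom Coalgebra.comul =
        X.lcoactHom ≫ tensorMap E X.lcoactHom ≫ X.right.tensorAssoc E E := by
      ext x
      exact (TensorProduct.assoc R E E X.carrier).eq_symm_apply.2 (X.lcoassoc_apply x).symm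
    have hmap : mapTensor F X.lcoactHom ≫ (F.obj X.right).tensorHom Coalgebra.comul =
        mapTensor F X.lcoactHom ≫ tensorMap E (mapTensor F X.lcoactHom) ≫
          (F.obj X.right).tensorAssoc E E := by
      rw [← mapTensor_tensorHom, hlcoassoc, mapTensor_comp_tensorMap_tensorAssoc]
    ext x
    exact (TensorProduct.assoc R E E (F.obj X.right).carrier).eq_symm_apply.1
      (LinearMap.congr_fun (congrArg Hom.hom hmap) x)
  lcounit := by
    have hlcounit : X.lcoactHom ≫ X.right.tensorHom Coalgebra.counit =
        X.right.inclTensor (1 : R) := hom_ext X.lcounit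
    have hmap : mapTensor F X.lcoactHom ≫ (F.obj X.right).tensorHom Coalgebra.counit =
        (F.obj X.right).inclTensor (1 : R) := by
      rw [← mapTensor_tensorHom, hlcounit, mapTensor_inclTensor]
    exact congrArg Hom.hom hmap
  bicolinear := LinearMap.ext fun x =>
    ((TensorProduct.assoc R E (F.obj X.right).carrier D).symm_apply_eq.1
      (LinearMap.congr_fun (mapTensor F X.lcoactHom).colinear x)).symm

theorem Equivalent.exists_bicomodule [Module.Flat R C] [Module.Flat R D] (h : Equivalent R C D) :
    ∃ B : Bicomodule R C D, IsCohom B.lcoactHom ∧ B.right.IsFlatCogenerator := by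
  obtain ⟨F, _, _, _⟩ := h
  exact ⟨mapBicomodule F (Bicomodule.regular R C), isCohom_mapTensor F (isCohom_coactHom _),
    IsFlatCogenerator.map F isFlatCogenerator_regular⟩

end Transport

end RightComodule

/-! ### Passing between left and right comodules -/

theorem IsAntiEquiv.comp {A B E : Type u} [AddCommGroup A] [Module R A] [Coalgebra R A]
    [AddCommGroup B] [Module R B] [Coalgebra R B] [AddCommGroup E] [Module R E] [Coalgebra R E]
    {τ : B ≃ₗ[R] E} (h : IsAntiEquiv τ) (e : A ≃ₗc[R] B) :
    IsAntiEquiv (e.toLinearEquiv ≪≫ₗ τ) where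
  comul a := by
    have map_comul : TensorProduct.map e.toCoalgHom.toLinearMap e.toCoalgHom.toLinearMap
        (Coalgebra.comul (R := R) a) = Coalgebra.comul (R := R) (e a) :=
      LinearMap.congr_fun e.toCoalgHom.map_comp_comul a
    refine (h.comul (e a)).trans ?_
    rw [← map_comul, ← TensorProduct.map_comm, TensorProduct.map_map]
    rfl
  counit a := (h.counit (e a)).trans (LinearMap.congr_fun e.toCoalgHom.counit_comp a)

section SwapOuter

variable {A B M N : Type u} [AddCommGroup A] [Module R A] [AddCommGroup B] [Module R B]
  [AddCommGroup M] [Module R M] [AddCommGroup N] [Module R N]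

theorem flipTensor_symm_symm_apply (σ : A ≃ₗ[R] B) (z : M ⊗[R] A) :
    (flipTensor σ.symm M).symm z = σ.toLinearMap.rTensor M (TensorProduct.comm R M A z) := by
  rw [LinearEquiv.symm_apply_eq]
  induction z with
  | zero => simp
  | add a b ha hb => simp only [map_add, ← ha, ← hb]
  | tmul m a => simp

/-- The isomorphism `N ⊗ (A ⊗ M) ≃ M ⊗ (B ⊗ N)` that swaps the outer factors and applies
`σ : A ≃ B` to the middle one. -/
noncomputable def swapOuter (σ : A ≃ₗ[R] B) (N M : Type u) [AddCommGroup N] [Module R N]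
    [AddCommGroup M] [Module R M] : N ⊗[R] (A ⊗[R] M) ≃ₗ[R] M ⊗[R] (B ⊗[R] N) :=
  TensorProduct.comm R N (A ⊗[R] M) ≪≫ₗ LinearEquiv.rTensor N (flipTensor σ M) ≪≫ₗ
    TensorProduct.assoc R M B N

theorem swapOuter_tmul (σ : A ≃ₗ[R] B) (n : N) (z : A ⊗[R] M) : swapOuter σ N M (n ⊗ₜ z) =
    TensorProduct.assoc R M B N (flipTensor σ M z ⊗ₜ n) := rfl

theorem swapOuter_assoc_flipTensor_symm_tmul (σ : A ≃ₗ[R] B) (z : B ⊗[R] N) (m : M) :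
    swapOuter σ N M (TensorProduct.assoc R N A M (flipTensor σ.symm N z ⊗ₜ m)) = m ⊗ₜ z := by
  induction z with
  | zero => simp
  | add a b ha hb => simp only [map_add, TensorProduct.add_tmul, TensorProduct.tmul_add, ha, hb]
  | tmul b n => simp [swapOuter_tmul]

end SwapOuter

namespace LeftComodule

variable {D' : Type u} [AddCommGroup D'] [Module R D'] [Coalgebra R D'] {σ : D ≃ₗ[R] D'}
  (hσ : IsAntiEquiv σ)

/-- The isomorphism of right comodules `Y ⊗ W ≅ W ⊗ Y`. -/
noncomputable def flipTensorIso (Y : LeftComodule R D) (W : Type u) [AddCommGroup W]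
    [Module R W] : (Y.tensor W).flip hσ ≅ (Y.flip hσ).tensor W :=
  let f : (Y.tensor W).flip hσ ⟶ (Y.flip hσ).tensor W :=
    { hom := (TensorProduct.comm R Y.carrier W).toLinearMap
      colinear := by
        ext y w
        change (TensorProduct.assoc R W Y.carrier D').symm
          (w ⊗ₜ flipTensor σ Y.carrier (Y.coact y)) =
          (TensorProduct.comm R Y.carrier W).toLinearMap.rTensor D'
            (flipTensor σ (Y.carrier ⊗[R] W)
              (TensorProduct.assoc R D Y.carrier W (Y.coact y ⊗ₜ w)))
        induction Y.coact y with
        | zero => simp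
        | add a b ha hb =>
          simp only [TensorProduct.tmul_add, TensorProduct.add_tmul, map_add, ha, hb]
        | tmul d y => simp }
  have : IsIso f := RightComodule.isIso_of_bijective f (TensorProduct.comm R Y.carrier W).bijective
  asIso f

/-- The functors `Y ⊗ -` and `- ⊗ Y` correspond to each other. -/
noncomputable def tensorFunctorFlipIso (Y : LeftComodule R D) :
    Y.tensorFunctor ⋙ flipFunctor hσ ≅ (Y.flip hσ).tensorFunctor :=
  NatIso.ofComponents (fun W => Y.flipTensorIso hσ W) fun _ =>
    RightComodule.hom_ext (TensorProduct.ext' fun _ _ => rfl)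

theorem swapOuter_cotensorMap (Y : LeftComodule R D) (N : LeftComodule R D')
    (z : N.carrier ⊗[R] Y.carrier) :
    swapOuter σ N.carrier Y.carrier (cotensorMap (N.flip hσ.symm) Y z) =
      -cotensorMap (Y.flip hσ) N (TensorProduct.comm R N.carrier Y.carrier z) := by
  induction z with
  | zero => simp
  | add a b ha hb => simp only [map_add, ha, hb, neg_add]
  | tmul n y =>
    change swapOuter σ N.carrier Y.carrier (TensorProduct.assoc R N.carrier D Y.carrier
        (flipTensor σ.symm N.carrier (N.coact n) ⊗ₜ y) - n ⊗ₜ Y.coact y) =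
      -(TensorProduct.assoc R Y.carrier D' N.carrier
        (flipTensor σ Y.carrier (Y.coact y) ⊗ₜ n) - y ⊗ₜ N.coact n)
    rw [map_sub, swapOuter_assoc_flipTensor_symm_tmul, swapOuter_tmul, neg_sub]

/-- The isomorphism between the cotensor products `N □ Y` and `Y □ N`. -/
noncomputable def cotensorFlipEquiv (Y : LeftComodule R D) (N : LeftComodule R D') :
    cotensor (N.flip hσ.symm) Y ≃ₗ[R] cotensor (Y.flip hσ) N :=
  (TensorProduct.comm R N.carrier Y.carrier).ofSubmodules _ _ (by
    ext z
    obtain ⟨z, rfl⟩ := (TensorProduct.comm R N.carrier Y.carrier).surjective z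
    rw [Submodule.mem_map_equiv, LinearEquiv.symm_apply_apply, cotensor, cotensor,
      LinearMap.mem_ker, LinearMap.mem_ker,
      ← LinearEquiv.map_eq_zero_iff (swapOuter σ N.carrier Y.carrier), swapOuter_cotensorMap,
      neg_eq_zero])

theorem cotensorFlipEquiv_naturality (Y : LeftComodule R D) {N N' : LeftComodule R D'}
    (f : N ⟶ N') :
    ((Y.flip hσ).cotensorFunctor.map f).hom ∘ₗ (Y.cotensorFlipEquiv hσ N).toLinearMap =
      (Y.cotensorFlipEquiv hσ N').toLinearMap ∘ₗ
        (Y.cotensorFunctor.map ((flipFunctor hσ.symm).map f)).hom := by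
  have lTensor_comm : f.hom.lTensor Y.carrier ∘ₗ
      (TensorProduct.comm R N.carrier Y.carrier).toLinearMap =
      (TensorProduct.comm R N'.carrier Y.carrier).toLinearMap ∘ₗ f.hom.rTensor Y.carrier :=
    TensorProduct.ext' fun _ _ => rfl
  exact LinearMap.ext fun z => Subtype.ext (LinearMap.congr_fun lTensor_comm z.1)

/-- The functors `- □ Y` and `Y □ -` correspond to each other. -/
noncomputable def cotensorFunctorFlipIso (Y : LeftComodule R D) :
    flipFunctor hσ.symm ⋙ Y.cotensorFunctor ≅ (Y.flip hσ).cotensorFunctor :=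
  NatIso.ofComponents (fun N => (Y.cotensorFlipEquiv hσ N).toModuleIso) fun f =>
    ModuleCat.hom_ext (Y.cotensorFlipEquiv_naturality hσ f).symm

theorem IsCoflat.flip {Y : LeftComodule R D} (hY : Y.IsCoflat) : (Y.flip hσ).IsCoflat := by
  intro N₁ N₂ N₃ f g hf hfg hg
  obtain ⟨injective, exact, surjective⟩ :=
    hY ((flipFunctor hσ.symm).map f) ((flipFunctor hσ.symm).map g) hf hfg hg
  have nat_f := Y.cotensorFlipEquiv_naturality hσ f
  have nat_g := Y.cotensorFlipEquiv_naturality hσ g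
  refine ⟨?_, Function.Exact.of_ladder_linearEquiv_of_exact nat_f nat_g exact, ?_⟩
  · refine ((Y.cotensorFlipEquiv hσ N₁).toEquiv.injective_comp _).1 ?_
    exact (congrArg (fun l : _ →ₗ[R] _ => Function.Injective l) nat_f).mpr
      ((Y.cotensorFlipEquiv hσ N₂).injective.comp injective)
  · refine ((Y.cotensorFlipEquiv hσ N₂).toEquiv.surjective_comp _).1 ?_
    exact (congrArg (fun l : _ →ₗ[R] _ => Function.Surjective l) nat_g).mpr
      ((Y.cotensorFlipEquiv hσ N₃).surjective.comp surjective)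

section Coend

variable (Y : LeftComodule R D) [Y.IsQuasiFinite]

/-- A quasi-finite left comodule as a right comodule over its coendomorphism coalgebra. -/
noncomputable abbrev coendComodule : RightComodule R Y.Coend where
  carrier := Y.carrier
  coact := Y.coendCoact
  coassoc := LinearMap.ext fun y => (Y.coendComul_spec y).symm
  counit := LinearMap.ext Y.coendCounit_spec

/-- The unit `Y → Y ⊗ e(Y)` as a map of right comodules `Y → e(Y) ⊗ Y`. -/
noncomputable def flipCoendUnit : Y.flip hσ ⟶ (Y.flip hσ).tensor Y.Coend :=
  (flipFunctor hσ).map Y.coendUnit ≫ (Y.flipTensorIso hσ Y.Coend).hom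

theorem rTensor_flipCoendUnit {W : Type u} [AddCommGroup W] [Module R W] (k : Y.Coend →ₗ[R] W)
    (y : Y.carrier) : k.rTensor Y.carrier ((Y.flipCoendUnit hσ).hom y) =
      TensorProduct.comm R Y.carrier W (k.lTensor Y.carrier (Y.coendCoact y)) := by
  have rTensor_comm : k.rTensor Y.carrier ∘ₗ
      (TensorProduct.comm R Y.carrier Y.Coend).toLinearMap =
      (TensorProduct.comm R Y.carrier W).toLinearMap ∘ₗ k.lTensor Y.carrier :=
    TensorProduct.ext' fun _ _ => rfl
  exact LinearMap.congr_fun rTensor_comm _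

theorem isCohom_flipCoendUnit : RightComodule.IsCohom (Y.flipCoendUnit hσ) where
  exists_lift {W} _ _ f := by
    let g : Y ⟶ Y.tensor W := (flipFunctor hσ).preimage (f ≫ (Y.flipTensorIso hσ W).inv)
    have hg : (flipFunctor hσ).map g ≫ (Y.flipTensorIso hσ W).hom = f :=
      (Iso.eq_comp_inv _).1 ((flipFunctor hσ).map_preimage _)
    refine ⟨Y.coendLift g, LinearMap.ext fun y => ?_⟩
    refine (Y.rTensor_flipCoendUnit hσ _ y).trans ?_
    refine (congrArg _ (LinearMap.congr_fun (Y.coendLift_spec g) y)).trans ?_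
    exact LinearMap.congr_fun (congrArg RightComodule.Hom.hom hg) y
  hom_ext {W} _ _ k k' h := Y.coend_hom_ext fun y =>
    (TensorProduct.comm R Y.carrier W).injective ((Y.rTensor_flipCoendUnit hσ k y).symm.trans
      ((h y).trans (Y.rTensor_flipCoendUnit hσ k' y)))

end Coend

variable {E E' : Type u} [AddCommGroup E] [Module R E] [Coalgebra R E]
  [AddCommGroup E'] [Module R E'] [Coalgebra R E'] {τ : E ≃ₗ[R] E'}

/-- If `e(Y) ≃ E`, then the coendomorphism coalgebra of `Y` as a right comodule is opposite
to `E`. -/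
noncomputable def flipCoendEquiv (hτ : IsAntiEquiv τ) (Y : LeftComodule R D) [Y.IsQuasiFinite]
    [(Y.flip hσ).IsQuasiFinite] (e : Y.Coend ≃ₗc[R] E) : (Y.flip hσ).Coend ≃ₗc[R] E' :=
  let t := e.toLinearEquiv ≪≫ₗ τ
  let L : LeftComodule R E' := Y.coendComodule.unflip (hτ.comp e).symm
  have hκ := (Y.isCohom_flipCoendUnit hσ).comp_tensorHom t
  RightComodule.coendCoalgEquiv (κ := L.coact)
    ((RightComodule.isCohom_coendUnit (Y.flip hσ)).equiv hκ)
    (fun y => ((RightComodule.isCohom_coendUnit (Y.flip hσ)).lift_apply _ y).trans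
      (flipTensor_symm_symm_apply t (Y.coendCoact y)).symm)
    (fun y => (TensorProduct.assoc R E' E' Y.carrier).eq_symm_apply.2 (L.coassoc_apply y))
    L.counit_apply

theorem IsMoritaTakeuchi.flip (hτ : IsAntiEquiv τ) {Y : LeftComodule R D}
    (hY : Y.IsMoritaTakeuchi E) : (Y.flip hσ).IsMoritaTakeuchi E' := by
  obtain ⟨hquasi, ⟨hcoflat, hfaithful⟩, hinjector, ⟨e⟩⟩ := hY
  have hquasi' : (Y.flip hσ).IsQuasiFinite :=
    Functor.isRightAdjoint_of_iso (Y.tensorFunctorFlipIso hσ)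
  refine ⟨hquasi', ⟨hcoflat.flip hσ, Functor.Faithful.of_iso (Y.cotensorFunctorFlipIso hσ)⟩,
    ⟨fun {W} hW => ?_⟩, ⟨flipCoendEquiv hσ hτ Y e⟩⟩
  have : Injective (Y.tensor W) := hinjector.injective_obj hW
  exact Injective.of_iso (Y.flipTensorIso hσ W)
    ((flipFunctor hσ).injective_obj_of_injective this)

end LeftComodule

/-! ### The implications between the six conditions -/

theorem RightComodule.Equivalent.exists_right_isMoritaTakeuchi [Module.Flat R C] [Module.Flat R D]
    (h : RightComodule.Equivalent R C D) :
    ∃ X : Bicomodule R C D, X.right.IsMoritaTakeuchi C := by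
  obtain ⟨X, hC, hX⟩ := h.exists_bicomodule
  exact ⟨X, hC.isMoritaTakeuchi_right hX⟩

theorem RightComodule.IsMoritaTakeuchi.equivalent [Module.Flat R D] {X : RightComodule R D}
    (h : X.IsMoritaTakeuchi C) : RightComodule.Equivalent R C D := by
  obtain ⟨B, hC, hB⟩ := h.exists_bicomodule
  exact hB.equivalent hC

theorem RightComodule.IsMoritaTakeuchi.exists_left [Module.Flat R D] {X : RightComodule R D}
    (h : X.IsMoritaTakeuchi C) : ∃ Y : Bicomodule R D C, Y.left.IsMoritaTakeuchi C := by
  obtain ⟨B, hC, hB⟩ := h.exists_bicomodule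
  have := hB.isQuasiFinite
  have hδ := isCohom_cohomUnit B.right (Bicomodule.regular R D).right
  exact ⟨hδ.bicomodule, hC.isMoritaTakeuchi_left hB hδ⟩

theorem LeftComodule.IsMoritaTakeuchi.equivalent [Module.Flat R D] {Y : LeftComodule R D}
    (h : Y.IsMoritaTakeuchi C) : LeftComodule.Equivalent R C D :=
  .of_flip (Cop.isAntiEquiv R C) (Cop.isAntiEquiv R D)
    (h.flip (Cop.isAntiEquiv R D) (Cop.isAntiEquiv R C)).equivalent

theorem LeftComodule.Equivalent.exists_right_isMoritaTakeuchi [Module.Flat R C] [Module.Flat R D]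
    (h : LeftComodule.Equivalent R C D) :
    ∃ X : Bicomodule R C D, X.right.IsMoritaTakeuchi C := by
  obtain ⟨X, hX⟩ :=
    (h.flip (Cop.isAntiEquiv R C) (Cop.isAntiEquiv R D)).exists_right_isMoritaTakeuchi
  obtain ⟨Y, hY⟩ := hX.exists_left
  have hY' := hY.flip (Cop.isAntiEquiv R D).symm (Cop.isAntiEquiv R C).symm
  obtain ⟨B, hC, hB⟩ := hY'.exists_bicomodule
  exact ⟨B, hC.isMoritaTakeuchi_right hB⟩

end MoritaTakeuchi

theorem theorem5 (R : Type u) [CommRing R]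
    (C : Type u) [AddCommGroup C] [Module R C] [Coalgebra R C] [Module.Flat R C]
    (D : Type u) [AddCommGroup D] [Module R D] [Coalgebra R D] [Module.Flat R D] :
    List.TFAE [
      MoritaTakeuchi.RightComodule.Equivalent R C D,
      MoritaTakeuchi.LeftComodule.Equivalent R C D,
      ∃ X : MoritaTakeuchi.Bicomodule R C D, X.right.IsMoritaTakeuchi C,
      ∃ X : MoritaTakeuchi.Bicomodule R C D, X.left.IsMoritaTakeuchi D,
      ∃ Y : MoritaTakeuchi.Bicomodule R D C, Y.right.IsMoritaTakeuchi D,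
      ∃ Y : MoritaTakeuchi.Bicomodule R D C, Y.left.IsMoritaTakeuchi C] := by
  tfae_have 1 → 3 := fun h => h.exists_right_isMoritaTakeuchi
  tfae_have 3 → 1 := fun ⟨_, hX⟩ => hX.equivalent
  tfae_have 3 → 6 := fun ⟨_, hX⟩ => hX.exists_left
  tfae_have 6 → 2 := fun ⟨_, hY⟩ => hY.equivalent
  tfae_have 2 → 3 := fun h => h.exists_right_isMoritaTakeuchi
  tfae_have 1 → 5 := fun h => h.symm.exists_right_isMoritaTakeuchi
  tfae_have 5 → 1 := fun ⟨_, hY⟩ => hY.equivalent.symm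
  tfae_have 5 → 4 := fun ⟨_, hY⟩ => hY.exists_left
  tfae_have 4 → 5 := fun ⟨_, hX⟩ => hX.equivalent.exists_right_isMoritaTakeuchi
  tfae_finish
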